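/- **Language.** Kinds are subsets of $\{D,S,E\}$ (discardable, shareable, escapable). Modes are $\mathsf r$ (read-only), $\mathsf w$ (writable), $\mathsf u$ (unboxed), with kinds $\{D,S\}$, $\{E\}$, $\{D,S,E\}$. Types are type variables $\alpha$, observed variables $\alpha!$, $()$, primitive types $t$ (U8, U16, U32, U64, Bool), abstract types $T\,\overline{\tau}\,m$, functions $\tau\to\rho$, variants $\langle\overline{C\,\tau}\rangle$ (distinct constructors, in no order) and records $\{\overline{f::\hat\tau}\}\,m$ (a sequence of fields), where a field is present ($\tau$) or taken. $!\tau$ makes every writable mode in $\tau$ read-only (not below function arrows) and turns $\alpha$ into $\alpha!$; $!\kappa=\kappa$ if $\{D,S\}\subseteq\kappa$ and $\{D,S\}$ otherwise. In a kind context $\Delta$: $\Delta\vdash\tau:\kappa$ always holds for $()$, primitive and function types; for $\alpha::\kappa'$ in $\Delta$ it requires $\kappa\subseteq\kappa'$ for $\alpha$ and $\kappa\subseteq{!\kappa'}$ for $\alpha!$; a variant needs it for all alternatives; abstract types and records need $\kappa$ to be contained in the kind of the mode, and the judgement for all parameters, respectively all fields that are not taken. Expressions are: variables, $()$, literals, type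 application $f[\overline\tau]$ of a top-level function, primitive operations, application, $\mathsf{let}$, $\mathsf{let!}\,(\overline y)\,x=e_1\,\mathsf{in}\,e_2$, conditionals, $\mathsf{cast}$, $\mathsf{promote}$, $\mathsf{case}$, $\mathsf{esac}$, constructors, unboxed record literals, field access, $\mathsf{put}$ and $\mathsf{take}$. A program defines each function $f::\forall\overline{\alpha::\kappa}.\ \tau\to\rho$ (a closed polytype) either by a body, $f\,x=e$, or as abstract. The judgement $\Delta;\Gamma\vdash e:\tau$ is the usual linear one: contexts are split among subexpressions with only assumptions of kind $\{S\}$ going both ways; assumptions left unused at variables, $()$, literals, $f[\overline\tau]$ and the empty expression sequence must have kind $\{D\}$; bound variables are fresh for the context; branches share a context; $\mathsf{let!}$ types $e_1$ with each $y_i:\tau_i$ changed to $y_i:{!\tau_i}$, requires the type of $e_1$ to have kind $\{E\}$, and gives $y_i:\tau_i$ back in $e_2$; $\mathsf{take}$ and $\mathsf{put}$ need a record that is not read-only; $\mathsf{take}$ marks the field as taken unless its type has kind $\{S\}$, $\mathsf{put}$ needs a taken field unless its type has kind $\{D\}$; field access needs a record of kind $\{S\}$. The program is assumed well-typed: $\overline{\alpha::\kappa};\,x:\tau\vdash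 e:\rho$ for each function with a body. **Semantics.** In the value semantics, $V\vdash e\Downarrow v$, values $v$ are literals, $()$, functions $\langle\!\langle\lambda x.e\rangle\!\rangle$, abstract functions $f[\overline\tau]$, $C\,v$, records, and abstract values $a_v$. In the update semantics, $U\vdash e\,|\,\mu\Downarrow u\,|\,\mu'$, values $u$ may also be pointers into a store $\mu$, a partial map from pointers to update values; evaluation threads the store from left to right, and $\mathsf{put}$ on a boxed record overwrites the record in the store. Both are big-step and call-by-value. The abstract functions $f$ have user-supplied meanings $[\![f]\!]_v:v\mapsto v$ and $[\![f]\!]_u:(u,\mu)\mapsto(u,\mu)$. **Correspondence.** $u\,|\,\mu:v:\tau\ [\mathbf{ro}:r\ \mathbf{rw}:w]$ is defined inductively. Equal literals $\ell$ below the bound of $t$ correspond at $t$, and $()$ at $()$; $\langle\!\langle\lambda x.e\rangle\!\rangle$ corresponds to itself at $\tau\to\rho$ if $x:\tau\vdash e:\rho$; an abstract function $f[\overline\rho]$, with $\rho_i$ of kind $\kappa_i$, corresponds to itself at its instantiated type; in all these cases $r=w=\emptyset$. $C\,u$ and $C\,v$ correspond at a variant type that contains $C\,\tau$ if $u,v$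 do at $\tau$. Unboxed records correspond if their fields that are not taken do, $r$ and $w$ being the unions of the sets $r_i$, $w_i$ of these fields, with $w_i\cap(r_j\cup w_j)=\emptyset$ for $i\ne j$. A pointer $p$ corresponds to a record at mode $\mathsf w$, with sets $r,\{p\}\cup w$, if $\mu(p)$ is a record whose fields correspond with sets $r,w$ and $p\notin r\cup w$; at mode $\mathsf r$, with sets $\{p\}\cup r,\emptyset$, if they correspond with sets $r,\emptyset$. Abstract types are treated alike, through a user-provided relation $a_u\,|\,\mu:a_v:T\,\overline\tau\,m\ [\mathbf{ro}:r\ \mathbf{rw}:w]$. Environments correspond, $U\,|\,\mu:V:\Gamma\ [\mathbf{ro}:r\ \mathbf{rw}:w]$, if for each $x_i:\tau_i$ in $\Gamma$ the values of $x_i$ correspond at $\tau_i$ with sets $r_i,w_i$, where $w_j\cap(r_k\cup w_k)=\emptyset$ for $j\neq k$, $r=\bigcup r_i$ and $w=\bigcup w_i$. The framing relation $w\,|\,\mu\ \mathbf{frame}\ w'\,|\,\mu'$ says, for every pointer $p$: (inertia) if $p\notin w\cup w'$ then $\mu(p)=\mu'(p)$; (leak freedom) if $p\in w$ and $p\notin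 w'$ then $\mu'(p)=\bot$; (fresh allocation) if $p\notin w$ and $p\in w'$ then $\mu(p)=\bot$. **Assumptions on user-supplied code.** (i) The relation on abstract values respects the type system: whenever it holds with $\mu,r,w$, all pointers in $r\cup w$ are allocated in $\mu$; it still holds in every store that agrees with $\mu$ on $r\cup w$; it holds at $!(T\,\overline\tau\,m)$ with the sets $r\cup w,\emptyset$; $w=\emptyset$ if $T\,\overline\tau\,m$ has kind $\{D\}$ or $\{S\}$; and $r=\emptyset$ if it has kind $\{E\}$. (ii) For each abstract function $f::\forall\overline{\alpha::\kappa}.\,\tau\to\tau'$ and all $\rho_i$ of kind $\kappa_i$: if $u\,|\,\mu:v:\tau[\overline\rho/\overline\alpha]\ [\mathbf{ro}:r\ \mathbf{rw}:w]$, $[\![f]\!]_v(v)=v'$ and $[\![f]\!]_u(u,\mu)=(u',\mu')$, then there are $r'\subseteq r$ and $w'$ with $u'\,|\,\mu':v':\tau'[\overline\rho/\overline\alpha]\ [\mathbf{ro}:r'\ \mathbf{rw}:w']$ and $w\,|\,\mu\ \mathbf{frame}\ w'\,|\,\mu'$. **Theorem 1 (Preservation of types and correspondence).** If $\varepsilon;\Gamma\vdash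 e:\tau$ and $U\,|\,\mu:V:\Gamma\ [\mathbf{ro}:r\ \mathbf{rw}:w]$ and $V\vdash e\Downarrow v$ and $U\vdash e\,|\,\mu\Downarrow u\,|\,\mu'$, then there are $r'\subseteq r$ and $w'$ such that $u\,|\,\mu':v:\tau\ [\mathbf{ro}:r'\ \mathbf{rw}:w']$ and $w\,|\,\mu\ \mathbf{frame}\ w'\,|\,\mu'$. Moreover the two statements obtained by erasing one of the semantics, in the definitions and in the assumptions (i), (ii), hold. Value semantics: if $\varepsilon;\Gamma\vdash e:\tau$, $V:\Gamma$ and $V\vdash e\Downarrow v$, then $v:\tau$. Update semantics: if $\varepsilon;\Gamma\vdash e:\tau$, $U\,|\,\mu:\Gamma\ [\mathbf{ro}:r\ \mathbf{rw}:w]$ and $U\vdash e\,|\,\mu\Downarrow u\,|\,\mu'$, then there are $r'\subseteq r$ and $w'$ such that $u\,|\,\mu':\tau\ [\mathbf{ro}:r'\ \mathbf{rw}:w']$ and $w\,|\,\mu\ \mathbf{frame}\ w'\,|\,\mu'$. -/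

import Mathlib

universe uP uU uV

namespace Cogent

/-! ### Types and kinds -/

/-- Names of variables, functions, constructors, record fields and abstract types. -/
abbrev Name := String

/-- Permissions: discardable, shareable, escapable. -/
inductive Perm
  | D
  | S
  | E
  deriving DecidableEq

/-- A kind is a set of permissions. -/
abbrev Kind := Finset Perm

/-- The operation `!` on kinds. -/
def Kind.bang (k : Kind) : Kind :=
  if ({Perm.D, Perm.S} : Kind) ⊆ k then k else {Perm.D, Perm.S}

/-- Storage modes. -/
inductive Mode
  | readOnly
  | writable
  | unboxed

/-- The operation `!` on modes. -/
def Mode.bang : Mode → Mode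
  | .readOnly => .readOnly
  | .writable => .readOnly
  | .unboxed => .unboxed

/-- The kind of a mode. -/
def Mode.kind : Mode → Kind
  | .readOnly => {Perm.D, Perm.S}
  | .writable => {Perm.E}
  | .unboxed => {Perm.D, Perm.S, Perm.E}

/-- Integer types. -/
inductive NumTy
  | u8
  | u16
  | u32
  | u64

/-- The number of values of an integer type. -/
def NumTy.size : NumTy → ℕ
  | .u8 => 2 ^ 8
  | .u16 => 2 ^ 16
  | .u32 => 2 ^ 32
  | .u64 => 2 ^ 64

/-- Primitive types. -/
inductive PrimTy
  | num (n : NumTy)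
  | bool

/-- The bound `|t|`: the literals of type `t` are the numbers below it. Literals are natural
numbers, with `1` for true and `0` for false. -/
def PrimTy.size : PrimTy → ℕ
  | .num n => n.size
  | .bool => 2

/-- A record field is present, or it has been taken. -/
inductive Fld (α : Type) : Type
  | present (a : α)
  | taken (a : α)

/-- Types. A type variable is referred to by its position in the list of quantified variables.
The alternatives of a variant type form a partial map from constructors to types (constructors
are unique and their order is immaterial); the fields of a record form a sequence. -/
inductive Ty : Type
  | var (i : ℕ)
  | varBang (i : ℕ)
  | unit
  | prim (t : PrimTy)
  | abs (T : Name) (ts : List Ty) (m : Mode)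
  | fn (t r : Ty)
  | variant (cs : Name → Option Ty)
  | record (fs : List (Name × Fld Ty)) (m : Mode)

/-- The alternatives of a variant type. -/
abbrev Alts := Name → Option Ty

/-- The fields of a record type. -/
abbrev Fields := List (Name × Fld Ty)

mutual
/-- The operation `!` on types: it makes every writable mode read-only. -/
def Ty.bang : Ty → Ty
  | .var i => .varBang i
  | .varBang i => .varBang i
  | .unit => .unit
  | .prim t => .prim t
  | .abs T ts m => .abs T (Ty.bangList ts) m.bang
  | .fn t r => .fn t r
  | .variant cs => .variant (fun C => Ty.bangOpt (cs C))
  | .record fs m => .record (Ty.bangFields fs) m.bang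
/-- `!` on each type of a list. -/
def Ty.bangList : List Ty → List Ty
  | [] => []
  | t :: ts => t.bang :: Ty.bangList ts
/-- `!` on an optional type. -/
def Ty.bangOpt : Option Ty → Option Ty
  | none => none
  | some t => some t.bang
/-- `!` on each field. -/
def Ty.bangFields : List (Name × Fld Ty) → List (Name × Fld Ty)
  | [] => []
  | (f, .present t) :: fs => (f, .present t.bang) :: Ty.bangFields fs
  | (f, .taken t) :: fs => (f, .taken t.bang) :: Ty.bangFields fs
end

mutual
/-- Simultaneous instantiation of the type variables `0, 1, …` by the types `rs`; an observed
variable `α!` becomes `!` of the type that instantiates `α`. -/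
def Ty.subst (rs : List Ty) : Ty → Ty
  | .var i => (rs[i]?).getD (.var i)
  | .varBang i => ((rs[i]?).getD (.var i)).bang
  | .unit => .unit
  | .prim t => .prim t
  | .abs T ts m => .abs T (Ty.substList rs ts) m
  | .fn t r => .fn (t.subst rs) (r.subst rs)
  | .variant cs => .variant (fun C => Ty.substOpt rs (cs C))
  | .record fs m => .record (Ty.substFields rs fs) m
/-- Instantiation in each type of a list. -/
def Ty.substList (rs : List Ty) : List Ty → List Ty
  | [] => []
  | t :: ts => t.subst rs :: Ty.substList rs ts
/-- Instantiation in an optional type. -/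
def Ty.substOpt (rs : List Ty) : Option Ty → Option Ty
  | none => none
  | some t => some (t.subst rs)
/-- Instantiation in each field. -/
def Ty.substFields (rs : List Ty) : List (Name × Fld Ty) → List (Name × Fld Ty)
  | [] => []
  | (f, .present t) :: fs => (f, .present (t.subst rs)) :: Ty.substFields rs fs
  | (f, .taken t) :: fs => (f, .taken (t.subst rs)) :: Ty.substFields rs fs
end

/-- All type variables of the type are among the first `n`. -/
inductive Ty.Scoped (n : ℕ) : Ty → Prop
  | var {i : ℕ} : i < n → Scoped n (.var i)
  | varBang {i : ℕ} : i < n → Scoped n (.varBang i)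
  | unit : Scoped n .unit
  | prim {t : PrimTy} : Scoped n (.prim t)
  | abs {T : Name} {ts : List Ty} {m : Mode} :
      (∀ t ∈ ts, Scoped n t) → Scoped n (.abs T ts m)
  | fn {t r : Ty} : Scoped n t → Scoped n r → Scoped n (.fn t r)
  | variant {cs : Alts} : (∀ C t, cs C = some t → Scoped n t) → Scoped n (.variant cs)
  | record {fs : Fields} {m : Mode} :
      (∀ f t, (f, Fld.present t) ∈ fs → Scoped n t) →
      (∀ f t, (f, Fld.taken t) ∈ fs → Scoped n t) → Scoped n (.record fs m)

/-- A kind context assigns a kind to each type variable. -/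
abbrev KindCtx := List Kind

/-- The kinding judgement `Δ ⊢ τ : κ`. -/
inductive Kinding (Δ : KindCtx) : Ty → Kind → Prop
  | unit {k : Kind} : Kinding Δ .unit k
  | prim {t : PrimTy} {k : Kind} : Kinding Δ (.prim t) k
  | fn {t r : Ty} {k : Kind} : Kinding Δ (.fn t r) k
  | var {i : ℕ} {k k' : Kind} : Δ[i]? = some k' → k ⊆ k' → Kinding Δ (.var i) k
  | varBang {i : ℕ} {k k' : Kind} :
      Δ[i]? = some k' → k ⊆ k'.bang → Kinding Δ (.varBang i) k
  | variant {cs : Alts} {k : Kind} :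
      (∀ C t, cs C = some t → Kinding Δ t k) → Kinding Δ (.variant cs) k
  | abs {T : Name} {ts : List Ty} {m : Mode} {k : Kind} :
      k ⊆ m.kind → (∀ t ∈ ts, Kinding Δ t k) → Kinding Δ (.abs T ts m) k
  | record {fs : Fields} {m : Mode} {k : Kind} :
      k ⊆ m.kind → (∀ f t, (f, Fld.present t) ∈ fs → Kinding Δ t k) →
      Kinding Δ (.record fs m) k

/-! ### Primitive operations -/

/-- Primitive operations. -/
inductive PrimOp
  | plus (n : NumTy)
  | minus (n : NumTy)
  | times (n : NumTy)
  | divide (n : NumTy)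
  | modulo (n : NumTy)
  | lt (n : NumTy)
  | le (n : NumTy)
  | gt (n : NumTy)
  | ge (n : NumTy)
  | eq (t : PrimTy)
  | ne (t : PrimTy)
  | not
  | and
  | or
  | bitAnd (n : NumTy)
  | bitOr (n : NumTy)
  | bitXor (n : NumTy)
  | complement (n : NumTy)
  | shiftLeft (n : NumTy)
  | shiftRight (n : NumTy)

/-- Argument types and result type of a primitive operation. -/
def PrimOp.type : PrimOp → List PrimTy × PrimTy
  | .plus n => ([.num n, .num n], .num n)
  | .minus n => ([.num n, .num n], .num n)
  | .times n => ([.num n, .num n], .num n)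
  | .divide n => ([.num n, .num n], .num n)
  | .modulo n => ([.num n, .num n], .num n)
  | .lt n => ([.num n, .num n], .bool)
  | .le n => ([.num n, .num n], .bool)
  | .gt n => ([.num n, .num n], .bool)
  | .ge n => ([.num n, .num n], .bool)
  | .eq t => ([t, t], .bool)
  | .ne t => ([t, t], .bool)
  | .not => ([.bool], .bool)
  | .and => ([.bool, .bool], .bool)
  | .or => ([.bool, .bool], .bool)
  | .bitAnd n => ([.num n, .num n], .num n)
  | .bitOr n => ([.num n, .num n], .num n)
  | .bitXor n => ([.num n, .num n], .num n)
  | .complement n => ([.num n], .num n)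
  | .shiftLeft n => ([.num n, .num n], .num n)
  | .shiftRight n => ([.num n, .num n], .num n)

/-- The literal of a truth value. -/
def litBool (p : Prop) [Decidable p] : ℕ := if p then 1 else 0

/-- The meaning of a primitive operation on literals: unsigned machine arithmetic, with division
by zero and remainder by zero giving zero. It is undefined on the wrong number of arguments. -/
def PrimOp.eval : PrimOp → List ℕ → Option ℕ
  | .plus n, [a, b] => some ((a + b) % n.size)
  | .minus n, [a, b] => some ((a + (n.size - b % n.size)) % n.size)
  | .times n, [a, b] => some ((a * b) % n.size)
  | .divide _, [a, b] => some (a / b)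
  | .modulo _, [a, b] => some (if b = 0 then 0 else a % b)
  | .lt _, [a, b] => some (litBool (a < b))
  | .le _, [a, b] => some (litBool (a ≤ b))
  | .gt _, [a, b] => some (litBool (b < a))
  | .ge _, [a, b] => some (litBool (b ≤ a))
  | .eq _, [a, b] => some (litBool (a = b))
  | .ne _, [a, b] => some (litBool (a ≠ b))
  | .not, [a] => some (litBool (a = 0))
  | .and, [a, b] => some (litBool (a ≠ 0 ∧ b ≠ 0))
  | .or, [a, b] => some (litBool (a ≠ 0 ∨ b ≠ 0))
  | .bitAnd _, [a, b] => some (a &&& b)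
  | .bitOr _, [a, b] => some (a ||| b)
  | .bitXor _, [a, b] => some (a ^^^ b)
  | .complement n, [a] => some (n.size - 1 - a)
  | .shiftLeft n, [a, b] => some ((a <<< b) % n.size)
  | .shiftRight _, [a, b] => some (a >>> b)
  | _, _ => none

/-! ### Expressions and programs -/

/-- Expressions of the core language. -/
inductive Expr : Type
  | var (x : Name)
  | unit
  | tyApp (f : Name) (ts : List Ty)
  | primOp (o : PrimOp) (es : List Expr)
  | app (e₁ e₂ : Expr)
  /-- `let x = e₁ in e₂` -/
  | letIn (x : Name) (e₁ e₂ : Expr)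
  /-- `let! (ys) x = e₁ in e₂` -/
  | letBang (ys : List Name) (x : Name) (e₁ e₂ : Expr)
  | ite (e₁ e₂ e₃ : Expr)
  | lit (l : ℕ)
  | cast (t : PrimTy) (e : Expr)
  | promote (cs : Alts) (e : Expr)
  /-- `case e₁ of C x → e₂ else y → e₃` -/
  | caseOf (e₁ : Expr) (C x : Name) (e₂ : Expr) (y : Name) (e₃ : Expr)
  | esac (e : Expr)
  | con (C : Name) (e : Expr)
  | struct (fes : List (Name × Expr))
  | member (e : Expr) (f : Name)
  /-- `put e₁.f := e₂` -/
  | put (e₁ : Expr) (f : Name) (e₂ : Expr)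
  /-- `take x { f = y } = e₁ in e₂` -/
  | take (x f y : Name) (e₁ e₂ : Expr)

mutual
/-- Instantiation of the type variables in an expression. -/
def Expr.subst (rs : List Ty) : Expr → Expr
  | .var x => .var x
  | .unit => .unit
  | .tyApp f ts => .tyApp f (Ty.substList rs ts)
  | .primOp o es => .primOp o (Expr.substList rs es)
  | .app e₁ e₂ => .app (e₁.subst rs) (e₂.subst rs)
  | .letIn x e₁ e₂ => .letIn x (e₁.subst rs) (e₂.subst rs)
  | .letBang ys x e₁ e₂ => .letBang ys x (e₁.subst rs) (e₂.subst rs)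
  | .ite e₁ e₂ e₃ => .ite (e₁.subst rs) (e₂.subst rs) (e₃.subst rs)
  | .lit l => .lit l
  | .cast t e => .cast t (e.subst rs)
  | .promote cs e => .promote (fun C => Ty.substOpt rs (cs C)) (e.subst rs)
  | .caseOf e₁ C x e₂ y e₃ => .caseOf (e₁.subst rs) C x (e₂.subst rs) y (e₃.subst rs)
  | .esac e => .esac (e.subst rs)
  | .con C e => .con C (e.subst rs)
  | .struct fes => .struct (Expr.substFields rs fes)
  | .member e f => .member (e.subst rs) f
  | .put e₁ f e₂ => .put (e₁.subst rs) f (e₂.subst rs)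
  | .take x f y e₁ e₂ => .take x f y (e₁.subst rs) (e₂.subst rs)
/-- Instantiation in each expression of a list. -/
def Expr.substList (rs : List Ty) : List Expr → List Expr
  | [] => []
  | e :: es => e.subst rs :: Expr.substList rs es
/-- Instantiation in each field initialiser. -/
def Expr.substFields (rs : List Ty) : List (Name × Expr) → List (Name × Expr)
  | [] => []
  | (f, e) :: fes => (f, e.subst rs) :: Expr.substFields rs fes
end

/-- Function definitions, of type `∀ αᵢ :: κᵢ. τ → ρ`. -/
inductive FunDef
  /-- `f x = e` -/
  | concrete (ks : List Kind) (t r : Ty) (x : Name) (e : Expr)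
  /-- a function implemented outside the language -/
  | abstract (ks : List Kind) (t r : Ty)

/-- The kinds of the quantified type variables. -/
def FunDef.kinds : FunDef → List Kind
  | .concrete ks _ _ _ _ => ks
  | .abstract ks _ _ => ks

/-- The argument type. -/
def FunDef.arg : FunDef → Ty
  | .concrete _ t _ _ _ => t
  | .abstract _ t _ => t

/-- The result type. -/
def FunDef.res : FunDef → Ty
  | .concrete _ _ r _ _ => r
  | .abstract _ _ r => r

/-- A program: the definition of each function. -/
abbrev Program := Name → Option FunDef

/-! ### Typing -/

/-- A partial map with one entry. -/
def single {α : Type*} (x : Name) (a : α) : Name → Option α :=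
  fun y => if y = x then some a else none

/-- `x ↦ a, F`: the map `F` with the entry of `x` set to `a`. -/
def extend {α : Type*} (x : Name) (a : α) (F : Name → Option α) : Name → Option α :=
  fun y => if y = x then some a else F y

/-- The map without the entry of `x`. -/
def without {α : Type*} (x : Name) (F : Name → Option α) : Name → Option α :=
  fun y => if y = x then none else F y

/-- The value of the field `f` (with distinct field names, the unique one). -/
def getField {α : Type*} (f : Name) : List (Name × α) → Option α
  | [] => none
  | (g, a) :: fs => if g = f then some a else getField f fs

/-- The sequence of fields with the value of the field `f` replaced by `a`. -/
def setField {α : Type*} (f : Name) (a : α) : List (Name × α) → List (Name × α)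
  | [] => []
  | (g, b) :: fs => if g = f then (g, a) :: fs else (g, b) :: setField f a fs

/-- A type context assigns a type to each of its variables. -/
abbrev Ctx := Name → Option Ty

/-- The empty context. -/
def Ctx.empty : Ctx := fun _ => none

/-- Weakening `Δ ⊢ Γ ⇝ Γ'`: assumptions of discardable type are dropped. -/
def Weakening (Δ : KindCtx) (Γ Γ' : Ctx) : Prop :=
  ∀ x, Γ' x = Γ x ∨ (Γ' x = none ∧ ∃ t, Γ x = some t ∧ Kinding Δ t {Perm.D})

/-- What contraction does to one variable. -/
inductive SplitEntry (Δ : KindCtx) : Option Ty → Option Ty → Option Ty → Prop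
  | absent : SplitEntry Δ none none none
  | left {t : Ty} : SplitEntry Δ (some t) (some t) none
  | right {t : Ty} : SplitEntry Δ (some t) none (some t)
  | share {t : Ty} : Kinding Δ t {Perm.S} → SplitEntry Δ (some t) (some t) (some t)

/-- Contraction `Δ ⊢ Γ ⇝ Γ₁ ⊞ Γ₂`: each assumption goes to one side, or to both sides if its type
is shareable. -/
def Split (Δ : KindCtx) (Γ Γ₁ Γ₂ : Ctx) : Prop :=
  ∀ x, SplitEntry Δ (Γ x) (Γ₁ x) (Γ₂ x)

/-- The contexts of `let!`: the context is `vᵢ : τᵢ, Γ` for the variables `vᵢ` in `ys`, with `Γ`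
contracted to `Γ₁` and `Γ₂`, and the results are `vᵢ : !τᵢ, Γ₁` and `vᵢ : τᵢ, Γ₂`. -/
def SplitBang (Δ : KindCtx) (ys : List Name) (Γ Γ₁ Γ₂ : Ctx) : Prop :=
  ∀ x, (x ∈ ys ∧ ∃ t, Γ x = some t ∧ Γ₁ x = some t.bang ∧ Γ₂ x = some t) ∨
    (x ∉ ys ∧ SplitEntry Δ (Γ x) (Γ₁ x) (Γ₂ x))

mutual
/-- The typing judgement `Δ; Γ ⊢ e : τ`. A context `x : ρ, Γ` is formed for `x` outside `Γ` only. -/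
inductive Typing (Pr : Program) (Δ : KindCtx) : Ctx → Expr → Ty → Prop
  | var {Γ : Ctx} {x : Name} {t : Ty} :
      Weakening Δ Γ (single x t) → Typing Pr Δ Γ (.var x) t
  | unit {Γ : Ctx} :
      Weakening Δ Γ Ctx.empty → Typing Pr Δ Γ .unit .unit
  | lit {Γ : Ctx} {l : ℕ} {t : PrimTy} :
      Weakening Δ Γ Ctx.empty → l < t.size → Typing Pr Δ Γ (.lit l) (.prim t)
  | primOp {Γ : Ctx} {o : PrimOp} {es : List Expr} {ts : List PrimTy}
      {t : PrimTy} :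
      TypingList Pr Δ Γ es (ts.map Ty.prim) → o.type = (ts, t) →
      Typing Pr Δ Γ (.primOp o es) (.prim t)
  | cast {Γ : Ctx} {e : Expr} {t t' : PrimTy} :
      Typing Pr Δ Γ e (.prim t') → t'.size ≤ t.size →
      Typing Pr Δ Γ (.cast t e) (.prim t)
  | app {Γ Γ₁ Γ₂ : Ctx} {e₁ e₂ : Expr} {r t : Ty} :
      Split Δ Γ Γ₁ Γ₂ → Typing Pr Δ Γ₁ e₁ (.fn r t) → Typing Pr Δ Γ₂ e₂ r →
      Typing Pr Δ Γ (.app e₁ e₂) t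
  | tyApp {Γ : Ctx} {f : Name} {rs : List Ty} {d : FunDef} :
      Weakening Δ Γ Ctx.empty → Pr f = some d → List.Forall₂ (Kinding Δ) rs d.kinds →
      Typing Pr Δ Γ (.tyApp f rs) ((Ty.fn d.arg d.res).subst rs)
  | ite {Γ Γ₁ Γ₂ : Ctx} {e₁ e₂ e₃ : Expr} {t : Ty} :
      Split Δ Γ Γ₁ Γ₂ → Typing Pr Δ Γ₁ e₁ (.prim .bool) →
      Typing Pr Δ Γ₂ e₂ t → Typing Pr Δ Γ₂ e₃ t →
      Typing Pr Δ Γ (.ite e₁ e₂ e₃) t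
  | caseOf {Γ Γ₁ Γ₂ : Ctx} {e₁ e₂ e₃ : Expr} {C x y : Name} {cs : Alts}
      {r t : Ty} :
      Split Δ Γ Γ₁ Γ₂ → Typing Pr Δ Γ₁ e₁ (.variant cs) → cs C = some r →
      Γ₂ x = none → Typing Pr Δ (extend x r Γ₂) e₂ t →
      Γ₂ y = none → Typing Pr Δ (extend y (.variant (without C cs)) Γ₂) e₃ t →
      Typing Pr Δ Γ (.caseOf e₁ C x e₂ y e₃) t
  | con {Γ : Ctx} {C : Name} {e : Expr} {t : Ty} :
      Typing Pr Δ Γ e t → Typing Pr Δ Γ (.con C e) (.variant (single C t))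
  | promote {Γ : Ctx} {cs bs : Alts} {e : Expr} :
      Typing Pr Δ Γ e (.variant bs) → (∀ C t, bs C = some t → cs C = some t) →
      Typing Pr Δ Γ (.promote cs e) (.variant cs)
  | esac {Γ : Ctx} {C : Name} {e : Expr} {t : Ty} :
      Typing Pr Δ Γ e (.variant (single C t)) → Typing Pr Δ Γ (.esac e) t
  | letIn {Γ Γ₁ Γ₂ : Ctx} {x : Name} {e₁ e₂ : Expr} {r t : Ty} :
      Split Δ Γ Γ₁ Γ₂ → Typing Pr Δ Γ₁ e₁ r →
      Γ₂ x = none → Typing Pr Δ (extend x r Γ₂) e₂ t →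
      Typing Pr Δ Γ (.letIn x e₁ e₂) t
  | letBang {Γ Γ₁ Γ₂ : Ctx} {ys : List Name} {x : Name} {e₁ e₂ : Expr}
      {r t : Ty} :
      SplitBang Δ ys Γ Γ₁ Γ₂ → Kinding Δ r {Perm.E} → Typing Pr Δ Γ₁ e₁ r →
      Γ₂ x = none → Typing Pr Δ (extend x r Γ₂) e₂ t →
      Typing Pr Δ Γ (.letBang ys x e₁ e₂) t
  | take₁ {Γ Γ₁ Γ₂ : Ctx} {x f y : Name} {e₁ e₂ : Expr} {fs : Fields}
      {m : Mode} {r t : Ty} :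
      Split Δ Γ Γ₁ Γ₂ → m ≠ .readOnly → Typing Pr Δ Γ₁ e₁ (.record fs m) →
      getField f fs = some (.present r) → Γ₂ x = none → Γ₂ y = none → x ≠ y →
      Typing Pr Δ (extend x (.record (setField f (.taken r) fs) m) (extend y r Γ₂)) e₂ t →
      Typing Pr Δ Γ (.take x f y e₁ e₂) t
  | take₂ {Γ Γ₁ Γ₂ : Ctx} {x f y : Name} {e₁ e₂ : Expr} {fs : Fields}
      {m : Mode} {r t : Ty} :
      Split Δ Γ Γ₁ Γ₂ → Kinding Δ r {Perm.S} → m ≠ .readOnly →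
      getField f fs = some (.present r) → Typing Pr Δ Γ₁ e₁ (.record fs m) →
      Γ₂ x = none → Γ₂ y = none → x ≠ y →
      Typing Pr Δ (extend x (.record fs m) (extend y r Γ₂)) e₂ t →
      Typing Pr Δ Γ (.take x f y e₁ e₂) t
  | put₁ {Γ Γ₁ Γ₂ : Ctx} {f : Name} {e₁ e₂ : Expr} {fs : Fields}
      {m : Mode} {r : Ty} :
      Split Δ Γ Γ₁ Γ₂ → m ≠ .readOnly → Typing Pr Δ Γ₁ e₁ (.record fs m) →
      getField f fs = some (.taken r) → Typing Pr Δ Γ₂ e₂ r →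
      Typing Pr Δ Γ (.put e₁ f e₂) (.record (setField f (.present r) fs) m)
  | put₂ {Γ Γ₁ Γ₂ : Ctx} {f : Name} {e₁ e₂ : Expr} {fs : Fields}
      {m : Mode} {r : Ty} :
      Split Δ Γ Γ₁ Γ₂ → m ≠ .readOnly → getField f fs = some (.present r) →
      Typing Pr Δ Γ₁ e₁ (.record fs m) → Kinding Δ r {Perm.D} → Typing Pr Δ Γ₂ e₂ r →
      Typing Pr Δ Γ (.put e₁ f e₂) (.record fs m)
  | member {Γ : Ctx} {e : Expr} {f : Name} {fs : Fields} {m : Mode} {t : Ty} :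
      Kinding Δ (.record fs m) {Perm.S} → Typing Pr Δ Γ e (.record fs m) →
      getField f fs = some (.present t) → Typing Pr Δ Γ (.member e f) t
  | struct {Γ : Ctx} {fes : List (Name × Expr)} {ts : List Ty} :
      TypingList Pr Δ Γ (fes.map Prod.snd) ts →
      Typing Pr Δ Γ (.struct fes)
        (.record ((fes.map Prod.fst).zip (ts.map Fld.present)) .unboxed)
/-- The typing judgement for sequences of expressions. -/
inductive TypingList (Pr : Program) (Δ : KindCtx) : Ctx → List Expr → List Ty → Prop
  | nil {Γ : Ctx} : Weakening Δ Γ Ctx.empty → TypingList Pr Δ Γ [] []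
  | cons {Γ Γ₁ Γ₂ : Ctx} {e : Expr} {es : List Expr} {t : Ty} {ts : List Ty} :
      Split Δ Γ Γ₁ Γ₂ → Typing Pr Δ Γ₁ e t → TypingList Pr Δ Γ₂ es ts →
      TypingList Pr Δ Γ (e :: es) (t :: ts)
end

/-- A program is well-typed if the type of each function mentions no type variables but the
quantified ones, and the body of each concrete function has the declared result type when its
parameter has the declared argument type. -/
def Program.WellTyped (Pr : Program) : Prop :=
  (∀ f d, Pr f = some d → d.arg.Scoped d.kinds.length ∧ d.res.Scoped d.kinds.length) ∧
  (∀ f ks t r x e, Pr f = some (.concrete ks t r x e) → Typing Pr ks (single x t) e r)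

/-! ### Value semantics -/

/-- Values of the value semantics, over a type `AV` of abstract values. -/
inductive Val (AV : Type uV)
  | lit (l : ℕ)
  | unit
  | fn (x : Name) (e : Expr)
  | absFn (f : Name) (ts : List Ty)
  | con (C : Name) (v : Val AV)
  | record (fs : List (Name × Val AV))
  | abs (a : AV)

/-- Value environments. -/
abbrev VEnv (AV : Type uV) := Name → Option (Val AV)

/-- The meaning of abstract functions in the value semantics. -/
abbrev VSem (AV : Type uV) := Name → Val AV → Val AV

mutual
/-- Evaluation `V ⊢ e ⇓ v` in the value semantics. -/
inductive VEval {AV : Type uV} (Pr : Program) (sem : VSem AV) :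
    VEnv AV → Expr → Val AV → Prop
  | var {V : VEnv AV} {x : Name} {v : Val AV} :
      V x = some v → VEval Pr sem V (.var x) v
  | unit {V : VEnv AV} : VEval Pr sem V .unit .unit
  | lit {V : VEnv AV} {l : ℕ} : VEval Pr sem V (.lit l) (.lit l)
  | fn {V : VEnv AV} {f : Name} {ts : List Ty} {ks : List Kind} {t r : Ty} {x : Name}
      {e : Expr} :
      Pr f = some (.concrete ks t r x e) →
      VEval Pr sem V (.tyApp f ts) (.fn x (e.subst ts))
  | absFn {V : VEnv AV} {f : Name} {ts : List Ty} {ks : List Kind} {t r : Ty} :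
      Pr f = some (.abstract ks t r) → VEval Pr sem V (.tyApp f ts) (.absFn f ts)
  | cast {V : VEnv AV} {t : PrimTy} {e : Expr} {l : ℕ} :
      VEval Pr sem V e (.lit l) → VEval Pr sem V (.cast t e) (.lit l)
  | app {V : VEnv AV} {e₁ e₂ e : Expr} {x : Name} {v v' : Val AV} :
      VEval Pr sem V e₁ (.fn x e) → VEval Pr sem V e₂ v' →
      VEval Pr sem (single x v') e v → VEval Pr sem V (.app e₁ e₂) v
  | absApp {V : VEnv AV} {e₁ e₂ : Expr} {f : Name} {ts : List Ty} {v v' : Val AV} :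
      VEval Pr sem V e₁ (.absFn f ts) → VEval Pr sem V e₂ v' → sem f v' = v →
      VEval Pr sem V (.app e₁ e₂) v
  | primOp {V : VEnv AV} {o : PrimOp} {es : List Expr} {ls : List ℕ} {l : ℕ} :
      VEvalList Pr sem V es (ls.map Val.lit) → o.eval ls = some l →
      VEval Pr sem V (.primOp o es) (.lit l)
  | letIn {V : VEnv AV} {x : Name} {e₁ e₂ : Expr} {v v' : Val AV} :
      VEval Pr sem V e₁ v' → VEval Pr sem (extend x v' V) e₂ v →
      VEval Pr sem V (.letIn x e₁ e₂) v
  | letBang {V : VEnv AV} {ys : List Name} {x : Name} {e₁ e₂ : Expr} {v v' : Val AV} :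
      VEval Pr sem V e₁ v' → VEval Pr sem (extend x v' V) e₂ v →
      VEval Pr sem V (.letBang ys x e₁ e₂) v
  | iteTrue {V : VEnv AV} {e₁ e₂ e₃ : Expr} {v : Val AV} :
      VEval Pr sem V e₁ (.lit 1) → VEval Pr sem V e₂ v → VEval Pr sem V (.ite e₁ e₂ e₃) v
  | iteFalse {V : VEnv AV} {e₁ e₂ e₃ : Expr} {v : Val AV} :
      VEval Pr sem V e₁ (.lit 0) → VEval Pr sem V e₃ v → VEval Pr sem V (.ite e₁ e₂ e₃) v
  | con {V : VEnv AV} {C : Name} {e : Expr} {v : Val AV} :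
      VEval Pr sem V e v → VEval Pr sem V (.con C e) (.con C v)
  | promote {V : VEnv AV} {cs : Alts} {C : Name} {e : Expr} {v : Val AV} :
      VEval Pr sem V e (.con C v) → VEval Pr sem V (.promote cs e) (.con C v)
  | case₁ {V : VEnv AV} {e₁ e₂ e₃ : Expr} {C x y : Name} {v v' : Val AV} :
      VEval Pr sem V e₁ (.con C v') → VEval Pr sem (extend x v' V) e₂ v →
      VEval Pr sem V (.caseOf e₁ C x e₂ y e₃) v
  | case₂ {V : VEnv AV} {e₁ e₂ e₃ : Expr} {B C x y : Name} {v v' : Val AV} :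
      VEval Pr sem V e₁ (.con B v') → B ≠ C → VEval Pr sem (extend y (.con B v') V) e₃ v →
      VEval Pr sem V (.caseOf e₁ C x e₂ y e₃) v
  | esac {V : VEnv AV} {C : Name} {e : Expr} {v : Val AV} :
      VEval Pr sem V e (.con C v) → VEval Pr sem V (.esac e) v
  | struct {V : VEnv AV} {fes : List (Name × Expr)} {vs : List (Val AV)} :
      VEvalList Pr sem V (fes.map Prod.snd) vs →
      VEval Pr sem V (.struct fes) (.record ((fes.map Prod.fst).zip vs))
  | member {V : VEnv AV} {e : Expr} {f : Name} {fs : List (Name × Val AV)} {v : Val AV} :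
      VEval Pr sem V e (.record fs) → getField f fs = some v →
      VEval Pr sem V (.member e f) v
  | take {V : VEnv AV} {x f y : Name} {e₁ e₂ : Expr} {fs : List (Name × Val AV)}
      {v v' : Val AV} :
      VEval Pr sem V e₁ (.record fs) → getField f fs = some v' →
      VEval Pr sem (extend x (.record fs) (extend y v' V)) e₂ v →
      VEval Pr sem V (.take x f y e₁ e₂) v
  | put {V : VEnv AV} {f : Name} {e₁ e₂ : Expr} {fs : List (Name × Val AV)}
      {v₀ v' : Val AV} :
      VEval Pr sem V e₁ (.record fs) → VEval Pr sem V e₂ v' → getField f fs = some v₀ →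
      VEval Pr sem V (.put e₁ f e₂) (.record (setField f v' fs))
/-- Evaluation of sequences of expressions in the value semantics. -/
inductive VEvalList {AV : Type uV} (Pr : Program) (sem : VSem AV) :
    VEnv AV → List Expr → List (Val AV) → Prop
  | nil {V : VEnv AV} : VEvalList Pr sem V [] []
  | cons {V : VEnv AV} {e : Expr} {es : List Expr} {v : Val AV} {vs : List (Val AV)} :
      VEval Pr sem V e v → VEvalList Pr sem V es vs → VEvalList Pr sem V (e :: es) (v :: vs)
end

/-! ### Update semantics -/

/-- Values of the update semantics, over a type `P` of pointers and a type `AU` of abstract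
values. -/
inductive UVal (P : Type uP) (AU : Type uU)
  | lit (l : ℕ)
  | unit
  | fn (x : Name) (e : Expr)
  | absFn (f : Name) (ts : List Ty)
  | con (C : Name) (u : UVal P AU)
  | record (fs : List (Name × UVal P AU))
  | abs (a : AU)
  | ptr (p : P)

/-- Update environments. -/
abbrev UEnv (P : Type uP) (AU : Type uU) := Name → Option (UVal P AU)

/-- Stores: partial maps from pointers to values. -/
abbrev Store (P : Type uP) (AU : Type uU) := P → Option (UVal P AU)

/-- The meaning of abstract functions in the update semantics. -/
abbrev USem (P : Type uP) (AU : Type uU) := Name → UVal P AU × Store P AU → UVal P AU × Store P AU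

mutual
/-- Evaluation `U ⊢ e | μ ⇓ u | μ'` in the update semantics. -/
inductive UEval {P : Type uP} {AU : Type uU} [DecidableEq P] (Pr : Program) (sem : USem P AU) :
    UEnv P AU → Expr → Store P AU → UVal P AU → Store P AU → Prop
  | var {U : UEnv P AU} {μ : Store P AU} {x : Name} {u : UVal P AU} :
      U x = some u → UEval Pr sem U (.var x) μ u μ
  | unit {U : UEnv P AU} {μ : Store P AU} : UEval Pr sem U .unit μ .unit μ
  | lit {U : UEnv P AU} {μ : Store P AU} {l : ℕ} : UEval Pr sem U (.lit l) μ (.lit l) μ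
  | fn {U : UEnv P AU} {μ : Store P AU} {f : Name} {ts : List Ty} {ks : List Kind} {t r : Ty}
      {x : Name} {e : Expr} :
      Pr f = some (.concrete ks t r x e) →
      UEval Pr sem U (.tyApp f ts) μ (.fn x (e.subst ts)) μ
  | absFn {U : UEnv P AU} {μ : Store P AU} {f : Name} {ts : List Ty} {ks : List Kind}
      {t r : Ty} :
      Pr f = some (.abstract ks t r) → UEval Pr sem U (.tyApp f ts) μ (.absFn f ts) μ
  | cast {U : UEnv P AU} {μ μ' : Store P AU} {t : PrimTy} {e : Expr} {l : ℕ} :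
      UEval Pr sem U e μ (.lit l) μ' → UEval Pr sem U (.cast t e) μ (.lit l) μ'
  | app {U : UEnv P AU} {μ μ₁ μ₂ μ₃ : Store P AU} {e₁ e₂ e : Expr} {x : Name}
      {u u' : UVal P AU} :
      UEval Pr sem U e₁ μ (.fn x e) μ₁ → UEval Pr sem U e₂ μ₁ u' μ₂ →
      UEval Pr sem (single x u') e μ₂ u μ₃ → UEval Pr sem U (.app e₁ e₂) μ u μ₃
  | absApp {U : UEnv P AU} {μ μ₁ μ₂ μ₃ : Store P AU} {e₁ e₂ : Expr} {f : Name} {ts : List Ty}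
      {u u' : UVal P AU} :
      UEval Pr sem U e₁ μ (.absFn f ts) μ₁ → UEval Pr sem U e₂ μ₁ u' μ₂ →
      sem f (u', μ₂) = (u, μ₃) → UEval Pr sem U (.app e₁ e₂) μ u μ₃
  | primOp {U : UEnv P AU} {μ μ' : Store P AU} {o : PrimOp} {es : List Expr} {ls : List ℕ}
      {l : ℕ} :
      UEvalList Pr sem U es μ (ls.map UVal.lit) μ' → o.eval ls = some l →
      UEval Pr sem U (.primOp o es) μ (.lit l) μ'
  | letIn {U : UEnv P AU} {μ μ₁ μ₂ : Store P AU} {x : Name} {e₁ e₂ : Expr}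
      {u u' : UVal P AU} :
      UEval Pr sem U e₁ μ u' μ₁ → UEval Pr sem (extend x u' U) e₂ μ₁ u μ₂ →
      UEval Pr sem U (.letIn x e₁ e₂) μ u μ₂
  | letBang {U : UEnv P AU} {μ μ₁ μ₂ : Store P AU} {ys : List Name} {x : Name} {e₁ e₂ : Expr}
      {u u' : UVal P AU} :
      UEval Pr sem U e₁ μ u' μ₁ → UEval Pr sem (extend x u' U) e₂ μ₁ u μ₂ →
      UEval Pr sem U (.letBang ys x e₁ e₂) μ u μ₂
  | iteTrue {U : UEnv P AU} {μ μ₁ μ₂ : Store P AU} {e₁ e₂ e₃ : Expr} {u : UVal P AU} :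
      UEval Pr sem U e₁ μ (.lit 1) μ₁ → UEval Pr sem U e₂ μ₁ u μ₂ →
      UEval Pr sem U (.ite e₁ e₂ e₃) μ u μ₂
  | iteFalse {U : UEnv P AU} {μ μ₁ μ₂ : Store P AU} {e₁ e₂ e₃ : Expr} {u : UVal P AU} :
      UEval Pr sem U e₁ μ (.lit 0) μ₁ → UEval Pr sem U e₃ μ₁ u μ₂ →
      UEval Pr sem U (.ite e₁ e₂ e₃) μ u μ₂
  | con {U : UEnv P AU} {μ μ' : Store P AU} {C : Name} {e : Expr} {u : UVal P AU} :
      UEval Pr sem U e μ u μ' → UEval Pr sem U (.con C e) μ (.con C u) μ'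
  | promote {U : UEnv P AU} {μ μ' : Store P AU} {cs : Alts} {C : Name} {e : Expr}
      {u : UVal P AU} :
      UEval Pr sem U e μ (.con C u) μ' → UEval Pr sem U (.promote cs e) μ (.con C u) μ'
  | case₁ {U : UEnv P AU} {μ μ₁ μ₂ : Store P AU} {e₁ e₂ e₃ : Expr} {C x y : Name}
      {u u' : UVal P AU} :
      UEval Pr sem U e₁ μ (.con C u') μ₁ → UEval Pr sem (extend x u' U) e₂ μ₁ u μ₂ →
      UEval Pr sem U (.caseOf e₁ C x e₂ y e₃) μ u μ₂
  | case₂ {U : UEnv P AU} {μ μ₁ μ₂ : Store P AU} {e₁ e₂ e₃ : Expr} {B C x y : Name}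
      {u u' : UVal P AU} :
      UEval Pr sem U e₁ μ (.con B u') μ₁ → B ≠ C →
      UEval Pr sem (extend y (.con B u') U) e₃ μ₁ u μ₂ →
      UEval Pr sem U (.caseOf e₁ C x e₂ y e₃) μ u μ₂
  | esac {U : UEnv P AU} {μ μ' : Store P AU} {C : Name} {e : Expr} {u : UVal P AU} :
      UEval Pr sem U e μ (.con C u) μ' → UEval Pr sem U (.esac e) μ u μ'
  | struct {U : UEnv P AU} {μ μ' : Store P AU} {fes : List (Name × Expr)}
      {us : List (UVal P AU)} :
      UEvalList Pr sem U (fes.map Prod.snd) μ us μ' →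
      UEval Pr sem U (.struct fes) μ (.record ((fes.map Prod.fst).zip us)) μ'
  | member₁ {U : UEnv P AU} {μ μ' : Store P AU} {e : Expr} {f : Name}
      {fs : List (Name × UVal P AU)} {u : UVal P AU} :
      UEval Pr sem U e μ (.record fs) μ' → getField f fs = some u →
      UEval Pr sem U (.member e f) μ u μ'
  | member₂ {U : UEnv P AU} {μ μ' : Store P AU} {e : Expr} {f : Name} {p : P}
      {fs : List (Name × UVal P AU)} {u : UVal P AU} :
      UEval Pr sem U e μ (.ptr p) μ' → μ' p = some (.record fs) → getField f fs = some u →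
      UEval Pr sem U (.member e f) μ u μ'
  | take₁ {U : UEnv P AU} {μ μ₁ μ₂ : Store P AU} {x f y : Name} {e₁ e₂ : Expr}
      {fs : List (Name × UVal P AU)} {u u' : UVal P AU} :
      UEval Pr sem U e₁ μ (.record fs) μ₁ → getField f fs = some u' →
      UEval Pr sem (extend x (.record fs) (extend y u' U)) e₂ μ₁ u μ₂ →
      UEval Pr sem U (.take x f y e₁ e₂) μ u μ₂
  | take₂ {U : UEnv P AU} {μ μ₁ μ₂ : Store P AU} {x f y : Name} {e₁ e₂ : Expr} {p : P}
      {fs : List (Name × UVal P AU)} {u u' : UVal P AU} :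
      UEval Pr sem U e₁ μ (.ptr p) μ₁ → μ₁ p = some (.record fs) → getField f fs = some u' →
      UEval Pr sem (extend x (.ptr p) (extend y u' U)) e₂ μ₁ u μ₂ →
      UEval Pr sem U (.take x f y e₁ e₂) μ u μ₂
  | put₁ {U : UEnv P AU} {μ μ₁ μ₂ : Store P AU} {f : Name} {e₁ e₂ : Expr}
      {fs : List (Name × UVal P AU)} {u₀ u' : UVal P AU} :
      UEval Pr sem U e₁ μ (.record fs) μ₁ → UEval Pr sem U e₂ μ₁ u' μ₂ →
      getField f fs = some u₀ →
      UEval Pr sem U (.put e₁ f e₂) μ (.record (setField f u' fs)) μ₂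
  | put₂ {U : UEnv P AU} {μ μ₁ μ₂ : Store P AU} {f : Name} {e₁ e₂ : Expr} {p : P}
      {fs : List (Name × UVal P AU)} {u₀ u' : UVal P AU} :
      UEval Pr sem U e₁ μ (.ptr p) μ₁ → UEval Pr sem U e₂ μ₁ u' μ₂ →
      μ₂ p = some (.record fs) → getField f fs = some u₀ →
      UEval Pr sem U (.put e₁ f e₂) μ (.ptr p)
        (Function.update μ₂ p (some (.record (setField f u' fs))))
/-- Evaluation of sequences of expressions, from left to right, in the update semantics. -/
inductive UEvalList {P : Type uP} {AU : Type uU} [DecidableEq P] (Pr : Program) (sem : USem P AU) :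
    UEnv P AU → List Expr → Store P AU → List (UVal P AU) → Store P AU → Prop
  | nil {U : UEnv P AU} {μ : Store P AU} : UEvalList Pr sem U [] μ [] μ
  | cons {U : UEnv P AU} {μ μ₁ μ₂ : Store P AU} {e : Expr} {es : List Expr} {u : UVal P AU}
      {us : List (UVal P AU)} :
      UEval Pr sem U e μ u μ₁ → UEvalList Pr sem U es μ₁ us μ₂ →
      UEvalList Pr sem U (e :: es) μ (u :: us) μ₂
end

/-- The framing relation `w | μ frame w' | μ'`. -/
structure Frame {P : Type uP} {AU : Type uU} (w : Set P) (μ : Store P AU) (w' : Set P) (μ' : Store P AU) :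
    Prop where
  inertia : ∀ p, p ∉ w ∪ w' → μ p = μ' p
  leakFreedom : ∀ p, p ∈ w → p ∉ w' → μ' p = none
  freshAllocation : ∀ p, p ∉ w → p ∈ w' → μ p = none

/-! ### Correspondence of update values and values -/

/-- A user-provided correspondence of abstract values:
`R aᵤ μ aᵥ T τs m r w` stands for `aᵤ | μ : aᵥ : T τs m [ro: r rw: w]`. -/
abbrev AbsCorr (P : Type uP) (AU : Type uU) (AV : Type uV) :=
  AU → Store P AU → AV → Name → List Ty → Mode → Set P → Set P → Prop

mutual
/-- The correspondence `u | μ : v : τ [ro: r rw: w]` of values. -/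
inductive Corr {P : Type uP} {AU : Type uU} {AV : Type uV} (Pr : Program)
    (R : AbsCorr P AU AV) (μ : Store P AU) :
    UVal P AU → Val AV → Ty → Set P → Set P → Prop
  | lit {l : ℕ} {t : PrimTy} : l < t.size → Corr Pr R μ (.lit l) (.lit l) (.prim t) ∅ ∅
  | unit : Corr Pr R μ .unit .unit .unit ∅ ∅
  | con {C : Name} {u : UVal P AU} {v : Val AV} {t : Ty} {cs : Alts} {r w : Set P} :
      Corr Pr R μ u v t r w → cs C = some t →
      Corr Pr R μ (.con C u) (.con C v) (.variant cs) r w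
  | fn {x : Name} {e : Expr} {t r : Ty} :
      Typing Pr [] (single x t) e r → Corr Pr R μ (.fn x e) (.fn x e) (.fn t r) ∅ ∅
  | absFn {f : Name} {ks : List Kind} {t t' : Ty} {rs : List Ty} :
      Pr f = some (.abstract ks t t') → List.Forall₂ (Kinding []) rs ks →
      Corr Pr R μ (.absFn f rs) (.absFn f rs) ((Ty.fn t t').subst rs) ∅ ∅
  | recU {us : List (Name × UVal P AU)} {vs : List (Name × Val AV)} {fs : Fields}
      {r w : Set P} :
      CorrFields Pr R μ us vs fs r w →
      Corr Pr R μ (.record us) (.record vs) (.record fs .unboxed) r w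
  | absU {a : AU} {b : AV} {T : Name} {ts : List Ty} {r w : Set P} :
      R a μ b T ts .unboxed r w →
      Corr Pr R μ (.abs a) (.abs b) (.abs T ts .unboxed) r w
  | recW {p : P} {us : List (Name × UVal P AU)} {vs : List (Name × Val AV)} {fs : Fields}
      {r w : Set P} :
      μ p = some (.record us) → CorrFields Pr R μ us vs fs r w → p ∉ r ∪ w →
      Corr Pr R μ (.ptr p) (.record vs) (.record fs .writable) r ({p} ∪ w)
  | absW {p : P} {a : AU} {b : AV} {T : Name} {ts : List Ty} {r w : Set P} :
      μ p = some (.abs a) → R a μ b T ts .writable r w → p ∉ r ∪ w →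
      Corr Pr R μ (.ptr p) (.abs b) (.abs T ts .writable) r ({p} ∪ w)
  | recR {p : P} {us : List (Name × UVal P AU)} {vs : List (Name × Val AV)} {fs : Fields}
      {r : Set P} :
      μ p = some (.record us) → CorrFields Pr R μ us vs fs r ∅ →
      Corr Pr R μ (.ptr p) (.record vs) (.record fs .readOnly) ({p} ∪ r) ∅
  | absR {p : P} {a : AU} {b : AV} {T : Name} {ts : List Ty} {r : Set P} :
      μ p = some (.abs a) → R a μ b T ts .readOnly r ∅ →
      Corr Pr R μ (.ptr p) (.abs b) (.abs T ts .readOnly) ({p} ∪ r) ∅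
/-- The correspondence for the fields of records. -/
inductive CorrFields {P : Type uP} {AU : Type uU} {AV : Type uV} (Pr : Program)
    (R : AbsCorr P AU AV) (μ : Store P AU) :
    List (Name × UVal P AU) → List (Name × Val AV) → Fields → Set P → Set P → Prop
  | nil : CorrFields Pr R μ [] [] [] ∅ ∅
  | present {f : Name} {u : UVal P AU} {v : Val AV} {t : Ty} {us : List (Name × UVal P AU)}
      {vs : List (Name × Val AV)} {fs : Fields} {r w r' w' : Set P} :
      Corr Pr R μ u v t r w → CorrFields Pr R μ us vs fs r' w' →
      w ∩ (r' ∪ w') = ∅ → w' ∩ (r ∪ w) = ∅ →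
      CorrFields Pr R μ ((f, u) :: us) ((f, v) :: vs) ((f, .present t) :: fs)
        (r ∪ r') (w ∪ w')
  | taken {f : Name} {u : UVal P AU} {v : Val AV} {t : Ty} {us : List (Name × UVal P AU)}
      {vs : List (Name × Val AV)} {fs : Fields} {r' w' : Set P} :
      CorrFields Pr R μ us vs fs r' w' →
      CorrFields Pr R μ ((f, u) :: us) ((f, v) :: vs) ((f, .taken t) :: fs) r' w'
end

/-- The correspondence `U | μ : V : Γ [ro: r rw: w]` of environments. -/
def CorrEnv {P : Type uP} {AU : Type uU} {AV : Type uV} (Pr : Program) (R : AbsCorr P AU AV) (U : UEnv P AU)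
    (μ : Store P AU) (V : VEnv AV) (Γ : Ctx) (r w : Set P) : Prop :=
  ∃ rs ws : Name → Set P,
    (∀ x t, Γ x = some t →
      ∃ u v, U x = some u ∧ V x = some v ∧ Corr Pr R μ u v t (rs x) (ws x)) ∧
    (∀ x y, Γ x ≠ none → Γ y ≠ none → x ≠ y → ws x ∩ (rs y ∪ ws y) = ∅) ∧
    r = {p | ∃ x, Γ x ≠ none ∧ p ∈ rs x} ∧ w = {p | ∃ x, Γ x ≠ none ∧ p ∈ ws x}

/-- The requirements on a user-provided correspondence of abstract values, that it respects the
type system: the pointers it reports are allocated, it depends on the store at these pointers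
only, it is compatible with `!`, a value of discardable or shareable type has no writable
pointers, and a value of escapable type has no read-only pointers. -/
structure AbsCorr.Lawful {P : Type uP} {AU : Type uU} {AV : Type uV} (R : AbsCorr P AU AV) : Prop where
  allocated : ∀ a μ b T ts m r w, R a μ b T ts m r w → ∀ p ∈ r ∪ w, μ p ≠ none
  local_store : ∀ a μ b T ts m r w, R a μ b T ts m r w →
    ∀ μ' : Store P AU, (∀ p ∈ r ∪ w, μ' p = μ p) → R a μ' b T ts m r w
  bang : ∀ a μ b T ts m r w, R a μ b T ts m r w →
    R a μ b T (ts.map Ty.bang) m.bang (r ∪ w) ∅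
  discard : ∀ a μ b T ts m r w, R a μ b T ts m r w →
    Kinding [] (.abs T ts m) {Perm.D} → w = ∅
  share : ∀ a μ b T ts m r w, R a μ b T ts m r w →
    Kinding [] (.abs T ts m) {Perm.S} → w = ∅
  escape : ∀ a μ b T ts m r w, R a μ b T ts m r w →
    Kinding [] (.abs T ts m) {Perm.E} → r = ∅

/-- The assumption on abstract functions: on corresponding arguments the two meanings of each
abstract function give corresponding results and respect framing. -/
def AbsFunsCorr {P : Type uP} {AU : Type uU} {AV : Type uV} (Pr : Program)
    (R : AbsCorr P AU AV) (semU : USem P AU) (semV : VSem AV) : Prop :=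
  ∀ f ks t t', Pr f = some (.abstract ks t t') →
    ∀ rs, List.Forall₂ (Kinding []) rs ks →
    ∀ u μ v r w, Corr Pr R μ u v (t.subst rs) r w →
    ∀ v' u' μ', semV f v = v' → semU f (u, μ) = (u', μ') →
    ∃ r' w' : Set P, r' ⊆ r ∧ Corr Pr R μ' u' v' (t'.subst rs) r' w' ∧ Frame w μ w' μ'

/-! ### Value typing: the correspondence with the update semantics erased -/

/-- A user-provided typing of abstract values: `R aᵥ T τs m` stands for `aᵥ : T τs m`. -/
abbrev AbsVTy (AV : Type uV) := AV → Name → List Ty → Mode → Prop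

mutual
/-- The typing `v : τ` of values of the value semantics. -/
inductive VTyping {AV : Type uV} (Pr : Program) (R : AbsVTy AV) : Val AV → Ty → Prop
  | lit {l : ℕ} {t : PrimTy} : l < t.size → VTyping Pr R (.lit l) (.prim t)
  | unit : VTyping Pr R .unit .unit
  | con {C : Name} {v : Val AV} {t : Ty} {cs : Alts} :
      VTyping Pr R v t → cs C = some t → VTyping Pr R (.con C v) (.variant cs)
  | fn {x : Name} {e : Expr} {t r : Ty} :
      Typing Pr [] (single x t) e r → VTyping Pr R (.fn x e) (.fn t r)
  | absFn {f : Name} {ks : List Kind} {t t' : Ty} {rs : List Ty} :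
      Pr f = some (.abstract ks t t') → List.Forall₂ (Kinding []) rs ks →
      VTyping Pr R (.absFn f rs) ((Ty.fn t t').subst rs)
  | record {vs : List (Name × Val AV)} {fs : Fields} {m : Mode} :
      VTypingFields Pr R vs fs → VTyping Pr R (.record vs) (.record fs m)
  | abs {b : AV} {T : Name} {ts : List Ty} {m : Mode} :
      R b T ts m → VTyping Pr R (.abs b) (.abs T ts m)
/-- Value typing for the fields of records. -/
inductive VTypingFields {AV : Type uV} (Pr : Program) (R : AbsVTy AV) :
    List (Name × Val AV) → Fields → Prop
  | nil : VTypingFields Pr R [] []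
  | present {f : Name} {v : Val AV} {t : Ty} {vs : List (Name × Val AV)} {fs : Fields} :
      VTyping Pr R v t → VTypingFields Pr R vs fs →
      VTypingFields Pr R ((f, v) :: vs) ((f, .present t) :: fs)
  | taken {f : Name} {v : Val AV} {t : Ty} {vs : List (Name × Val AV)} {fs : Fields} :
      VTypingFields Pr R vs fs →
      VTypingFields Pr R ((f, v) :: vs) ((f, .taken t) :: fs)
end

/-- The typing `V : Γ` of value environments. -/
def VTypingEnv {AV : Type uV} (Pr : Program) (R : AbsVTy AV) (V : VEnv AV) (Γ : Ctx) : Prop :=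
  ∀ x t, Γ x = some t → ∃ v, V x = some v ∧ VTyping Pr R v t

/-- The requirement on a user-provided typing of abstract values. -/
def AbsVTy.Lawful {AV : Type uV} (R : AbsVTy AV) : Prop :=
  ∀ b T ts m, R b T ts m → R b T (ts.map Ty.bang) m.bang

/-- The assumption on abstract functions, with the update semantics erased. -/
def AbsFunsVTyped {AV : Type uV} (Pr : Program) (R : AbsVTy AV) (semV : VSem AV) : Prop :=
  ∀ f ks t t', Pr f = some (.abstract ks t t') →
    ∀ rs, List.Forall₂ (Kinding []) rs ks →
    ∀ v, VTyping Pr R v (t.subst rs) →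
    ∀ v', semV f v = v' → VTyping Pr R v' (t'.subst rs)

/-! ### Update value typing: the correspondence with the value semantics erased -/

/-- A user-provided typing of abstract values in the update semantics:
`R aᵤ μ T τs m r w` stands for `aᵤ | μ : T τs m [ro: r rw: w]`. -/
abbrev AbsUTy (P : Type uP) (AU : Type uU) :=
  AU → Store P AU → Name → List Ty → Mode → Set P → Set P → Prop

mutual
/-- The typing `u | μ : τ [ro: r rw: w]` of values of the update semantics. -/
inductive UTyping {P : Type uP} {AU : Type uU} (Pr : Program) (R : AbsUTy P AU) (μ : Store P AU) :
    UVal P AU → Ty → Set P → Set P → Prop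
  | lit {l : ℕ} {t : PrimTy} : l < t.size → UTyping Pr R μ (.lit l) (.prim t) ∅ ∅
  | unit : UTyping Pr R μ .unit .unit ∅ ∅
  | con {C : Name} {u : UVal P AU} {t : Ty} {cs : Alts} {r w : Set P} :
      UTyping Pr R μ u t r w → cs C = some t → UTyping Pr R μ (.con C u) (.variant cs) r w
  | fn {x : Name} {e : Expr} {t r : Ty} :
      Typing Pr [] (single x t) e r → UTyping Pr R μ (.fn x e) (.fn t r) ∅ ∅
  | absFn {f : Name} {ks : List Kind} {t t' : Ty} {rs : List Ty} :
      Pr f = some (.abstract ks t t') → List.Forall₂ (Kinding []) rs ks →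
      UTyping Pr R μ (.absFn f rs) ((Ty.fn t t').subst rs) ∅ ∅
  | recU {us : List (Name × UVal P AU)} {fs : Fields} {r w : Set P} :
      UTypingFields Pr R μ us fs r w →
      UTyping Pr R μ (.record us) (.record fs .unboxed) r w
  | absU {a : AU} {T : Name} {ts : List Ty} {r w : Set P} :
      R a μ T ts .unboxed r w → UTyping Pr R μ (.abs a) (.abs T ts .unboxed) r w
  | recW {p : P} {us : List (Name × UVal P AU)} {fs : Fields} {r w : Set P} :
      μ p = some (.record us) → UTypingFields Pr R μ us fs r w → p ∉ r ∪ w →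
      UTyping Pr R μ (.ptr p) (.record fs .writable) r ({p} ∪ w)
  | absW {p : P} {a : AU} {T : Name} {ts : List Ty} {r w : Set P} :
      μ p = some (.abs a) → R a μ T ts .writable r w → p ∉ r ∪ w →
      UTyping Pr R μ (.ptr p) (.abs T ts .writable) r ({p} ∪ w)
  | recR {p : P} {us : List (Name × UVal P AU)} {fs : Fields} {r : Set P} :
      μ p = some (.record us) → UTypingFields Pr R μ us fs r ∅ →
      UTyping Pr R μ (.ptr p) (.record fs .readOnly) ({p} ∪ r) ∅
  | absR {p : P} {a : AU} {T : Name} {ts : List Ty} {r : Set P} :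
      μ p = some (.abs a) → R a μ T ts .readOnly r ∅ →
      UTyping Pr R μ (.ptr p) (.abs T ts .readOnly) ({p} ∪ r) ∅
/-- Update value typing for the fields of records. -/
inductive UTypingFields {P : Type uP} {AU : Type uU} (Pr : Program) (R : AbsUTy P AU) (μ : Store P AU) :
    List (Name × UVal P AU) → Fields → Set P → Set P → Prop
  | nil : UTypingFields Pr R μ [] [] ∅ ∅
  | present {f : Name} {u : UVal P AU} {t : Ty} {us : List (Name × UVal P AU)} {fs : Fields}
      {r w r' w' : Set P} :
      UTyping Pr R μ u t r w → UTypingFields Pr R μ us fs r' w' →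
      w ∩ (r' ∪ w') = ∅ → w' ∩ (r ∪ w) = ∅ →
      UTypingFields Pr R μ ((f, u) :: us) ((f, .present t) :: fs) (r ∪ r') (w ∪ w')
  | taken {f : Name} {u : UVal P AU} {t : Ty} {us : List (Name × UVal P AU)} {fs : Fields}
      {r' w' : Set P} :
      UTypingFields Pr R μ us fs r' w' →
      UTypingFields Pr R μ ((f, u) :: us) ((f, .taken t) :: fs) r' w'
end

/-- The typing `U | μ : Γ [ro: r rw: w]` of update environments. -/
def UTypingEnv {P : Type uP} {AU : Type uU} (Pr : Program) (R : AbsUTy P AU) (U : UEnv P AU)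
    (μ : Store P AU) (Γ : Ctx) (r w : Set P) : Prop :=
  ∃ rs ws : Name → Set P,
    (∀ x t, Γ x = some t → ∃ u, U x = some u ∧ UTyping Pr R μ u t (rs x) (ws x)) ∧
    (∀ x y, Γ x ≠ none → Γ y ≠ none → x ≠ y → ws x ∩ (rs y ∪ ws y) = ∅) ∧
    r = {p | ∃ x, Γ x ≠ none ∧ p ∈ rs x} ∧ w = {p | ∃ x, Γ x ≠ none ∧ p ∈ ws x}

/-- The requirements on a user-provided typing of abstract values in the update semantics. -/
structure AbsUTy.Lawful {P : Type uP} {AU : Type uU} (R : AbsUTy P AU) : Prop where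
  allocated : ∀ a μ T ts m r w, R a μ T ts m r w → ∀ p ∈ r ∪ w, μ p ≠ none
  local_store : ∀ a μ T ts m r w, R a μ T ts m r w →
    ∀ μ' : Store P AU, (∀ p ∈ r ∪ w, μ' p = μ p) → R a μ' T ts m r w
  bang : ∀ a μ T ts m r w, R a μ T ts m r w → R a μ T (ts.map Ty.bang) m.bang (r ∪ w) ∅
  discard : ∀ a μ T ts m r w, R a μ T ts m r w → Kinding [] (.abs T ts m) {Perm.D} → w = ∅
  share : ∀ a μ T ts m r w, R a μ T ts m r w → Kinding [] (.abs T ts m) {Perm.S} → w = ∅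
  escape : ∀ a μ T ts m r w, R a μ T ts m r w → Kinding [] (.abs T ts m) {Perm.E} → r = ∅

/-- The assumption on abstract functions, with the value semantics erased. -/
def AbsFunsUTyped {P : Type uP} {AU : Type uU} (Pr : Program) (R : AbsUTy P AU) (semU : USem P AU) : Prop :=
  ∀ f ks t t', Pr f = some (.abstract ks t t') →
    ∀ rs, List.Forall₂ (Kinding []) rs ks →
    ∀ u μ r w, UTyping Pr R μ u (t.subst rs) r w →
    ∀ u' μ', semU f (u, μ) = (u', μ') →
    ∃ r' w' : Set P, r' ⊆ r ∧ UTyping Pr R μ' u' (t'.subst rs) r' w' ∧ Frame w μ w' μ'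

end Cogent

open Cogent

namespace Cogent

/-! ### Observation and instantiation of types -/

theorem Ty.bangList_eq_map (ts : List Ty) : Ty.bangList ts = ts.map Ty.bang := by
  induction ts <;> simp_all [Ty.bangList]

theorem Ty.substList_eq_map (rs ts : List Ty) : Ty.substList rs ts = ts.map (Ty.subst rs) := by
  induction ts <;> simp_all [Ty.substList]

theorem Ty.bangOpt_eq_some {o : Option Ty} {t : Ty} :
    Ty.bangOpt o = some t ↔ ∃ s, o = some s ∧ t = s.bang := by
  cases o <;> simp [Ty.bangOpt, eq_comm]

theorem Ty.substOpt_eq_some {rs : List Ty} {o : Option Ty} {t : Ty} :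
    Ty.substOpt rs o = some t ↔ ∃ s, o = some s ∧ t = s.subst rs := by
  cases o <;> simp [Ty.substOpt, eq_comm]

theorem Ty.present_mem_bangFields {f : Name} {t : Ty} {fs : Fields}
    (h : (f, Fld.present t) ∈ Ty.bangFields fs) :
    ∃ s, (f, Fld.present s) ∈ fs ∧ t = s.bang := by
  induction fs with
  | nil => simp [Ty.bangFields] at h
  | cons a fs ih => obtain ⟨g, _ | _⟩ := a <;> simp [Ty.bangFields] at h <;> grind

theorem Ty.present_mem_substFields {rs : List Ty} {f : Name} {t : Ty} {fs : Fields}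
    (h : (f, Fld.present t) ∈ Ty.substFields rs fs) :
    ∃ s, (f, Fld.present s) ∈ fs ∧ t = s.subst rs := by
  induction fs with
  | nil => simp [Ty.substFields] at h
  | cons a fs ih => obtain ⟨g, _ | _⟩ := a <;> simp [Ty.substFields] at h <;> grind

theorem Mode.bang_bang (m : Mode) : m.bang.bang = m.bang := by cases m <;> rfl

mutual
theorem Ty.bang_bang : ∀ t : Ty, t.bang.bang = t.bang
  | .var _ | .varBang _ | .unit | .prim _ | .fn _ _ => by simp [Ty.bang]
  | .abs T ts m => by simp [Ty.bang, Mode.bang_bang, Ty.bangList_bangList ts]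
  | .variant cs => by
      simp only [Ty.bang, Ty.variant.injEq]
      exact funext fun C => Ty.bangOpt_bangOpt (cs C)
  | .record fs m => by simp [Ty.bang, Mode.bang_bang, Ty.bangFields_bangFields fs]
theorem Ty.bangList_bangList : ∀ ts : List Ty,
    Ty.bangList (Ty.bangList ts) = Ty.bangList ts
  | [] => rfl
  | t :: ts => by simp [Ty.bangList, Ty.bang_bang t, Ty.bangList_bangList ts]
theorem Ty.bangOpt_bangOpt : ∀ o : Option Ty, Ty.bangOpt (Ty.bangOpt o) = Ty.bangOpt o
  | none => rfl
  | some t => by simp [Ty.bangOpt, Ty.bang_bang t]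
theorem Ty.bangFields_bangFields : ∀ fs : List (Name × Fld Ty),
    Ty.bangFields (Ty.bangFields fs) = Ty.bangFields fs
  | [] => rfl
  | (f, .present t) :: fs => by
      simp [Ty.bangFields, Ty.bang_bang t, Ty.bangFields_bangFields fs]
  | (f, .taken t) :: fs => by
      simp [Ty.bangFields, Ty.bang_bang t, Ty.bangFields_bangFields fs]
end

mutual
-- An observed variable is instantiated by `!` of the instance of the variable exactly so that this
-- commutation holds. At a variable that is already observed it rests on idempotence of `!`. It
-- makes the contexts of `let!` stable under instantiation.
theorem Ty.subst_bang (rs : List Ty) : ∀ t : Ty, t.bang.subst rs = (t.subst rs).bang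
  | .var _ | .unit | .prim _ | .fn _ _ => by simp [Ty.bang, Ty.subst]
  | .varBang _ => by simp [Ty.bang, Ty.subst, Ty.bang_bang]
  | .abs T ts m => by simp [Ty.bang, Ty.subst, Ty.substList_bangList rs ts]
  | .variant cs => by
      simp only [Ty.bang, Ty.subst, Ty.variant.injEq]
      exact funext fun C => Ty.substOpt_bangOpt rs (cs C)
  | .record fs m => by simp [Ty.bang, Ty.subst, Ty.substFields_bangFields rs fs]
theorem Ty.substList_bangList (rs : List Ty) : ∀ ts : List Ty,
    Ty.substList rs (Ty.bangList ts) = Ty.bangList (Ty.substList rs ts)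
  | [] => rfl
  | t :: ts => by
      simp [Ty.bangList, Ty.substList, Ty.subst_bang rs t, Ty.substList_bangList rs ts]
theorem Ty.substOpt_bangOpt (rs : List Ty) : ∀ o : Option Ty,
    Ty.substOpt rs (Ty.bangOpt o) = Ty.bangOpt (Ty.substOpt rs o)
  | none => rfl
  | some t => by simp [Ty.bangOpt, Ty.substOpt, Ty.subst_bang rs t]
theorem Ty.substFields_bangFields (rs : List Ty) : ∀ fs : List (Name × Fld Ty),
    Ty.substFields rs (Ty.bangFields fs) = Ty.bangFields (Ty.substFields rs fs)
  | [] => rfl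
  | (f, .present t) :: fs => by
      simp [Ty.bangFields, Ty.substFields, Ty.subst_bang rs t, Ty.substFields_bangFields rs fs]
  | (f, .taken t) :: fs => by
      simp [Ty.bangFields, Ty.substFields, Ty.subst_bang rs t, Ty.substFields_bangFields rs fs]
end

/-- Instantiation composes on types whose variables are all instantiated. -/
theorem Ty.subst_subst {ts rs : List Ty} {t : Ty} (h : t.Scoped ts.length) :
    (t.subst ts).subst rs = t.subst (Ty.substList rs ts) := by
  induction h with
  | var hi | varBang hi =>
    -- The bound `hi` excludes the default of `getD`: a variable beyond `ts` would be instantiated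
    -- by `rs` on the left and stay a variable on the right.
    simp [Ty.subst, Ty.substList_eq_map, List.getElem?_eq_getElem hi, Ty.subst_bang]
  | unit | prim => simp [Ty.subst]
  | @abs T us m _ ih =>
    simp only [Ty.subst, Ty.abs.injEq, true_and, and_true]
    simpa [Ty.substList_eq_map] using ih
  | fn _ _ ih₁ ih₂ => simp [Ty.subst, ih₁, ih₂]
  | @variant cs _ ih =>
    simp only [Ty.subst, Ty.variant.injEq]
    funext C
    cases hC : cs C with
    | none => rfl
    | some t => simp [Ty.substOpt, ih C t hC]
  | @record fs m _ _ ih₁ ih₂ =>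
    simp only [Ty.subst, Ty.record.injEq, and_true]
    clear * - ih₁ ih₂
    induction fs with
    | nil => rfl
    | cons a fs ih =>
      obtain ⟨g, _ | _⟩ := a <;> simp [Ty.substFields] <;> grind

/-! ### Kinding -/

theorem Kinding.mono {Δ : KindCtx} {t : Ty} {k k' : Kind} (h : Kinding Δ t k) (hk : k' ⊆ k) :
    Kinding Δ t k' := by
  induction h with
  | unit => exact .unit
  | prim => exact .prim
  | fn => exact .fn
  | var h₁ h₂ => exact .var h₁ (hk.trans h₂)
  | varBang h₁ h₂ => exact .varBang h₁ (hk.trans h₂)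
  | variant _ ih => exact .variant fun C t hC => ih C t hC hk
  | abs h _ ih => exact .abs (hk.trans h) fun t ht => ih t ht hk
  | record h _ ih => exact .record (hk.trans h) fun f t ht => ih f t ht hk

theorem Kind.bang_subset_bang_kind {k : Kind} {m : Mode} (h : k ⊆ m.kind) :
    k.bang ⊆ m.bang.kind := by
  unfold Kind.bang
  cases m with
  | readOnly => split <;> simp_all [Mode.kind, Mode.bang]
  | writable =>
    -- A kind contained in `{E}` lacks `D`, so the first branch is impossible; in the second one `!`
    -- yields `{D, S}`, the kind of the read-only mode.
    split
    · rename_i h'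
      exact absurd (h (h' (Finset.mem_insert_self _ _))) (by simp [Mode.kind])
    · simp [Mode.kind, Mode.bang]
  | unboxed => intro p _; cases p <;> simp [Mode.kind, Mode.bang]

/-- In the empty kind context the variable rules cannot occur, so only modes matter. This is what
the instantiation of observed variables needs in `Kinding.subst`. -/
theorem Kinding.bang {t : Ty} {k : Kind} (h : Kinding [] t k) : Kinding [] t.bang k.bang := by
  induction h with
  | unit => exact .unit
  | prim => exact .prim
  | fn => exact .fn
  | var h | varBang h => simp at h
  | variant _ ih =>
    refine .variant fun C t hC => ?_
    obtain ⟨s, hs, rfl⟩ := Ty.bangOpt_eq_some.1 hC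
    exact ih C s hs
  | abs h _ ih =>
    refine .abs (Kind.bang_subset_bang_kind h) fun t ht => ?_
    rw [Ty.bangList_eq_map, List.mem_map] at ht
    obtain ⟨s, hs, rfl⟩ := ht
    exact ih s hs
  | record h _ ih =>
    refine .record (Kind.bang_subset_bang_kind h) fun f t ht => ?_
    obtain ⟨s, hs, rfl⟩ := Ty.present_mem_bangFields ht
    exact ih f s hs

theorem forall₂_getElem? {α β : Type*} {r : α → β → Prop} {as : List α} {bs : List β}
    (h : List.Forall₂ r as bs) {i : ℕ} {b : β} (hb : bs[i]? = some b) :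
    ∃ a, as[i]? = some a ∧ r a b := by
  induction h generalizing i with
  | nil => simp at hb
  | cons hr _ ih => cases i <;> simp_all

/-- Kinding is stable under instantiation by types of the declared kinds. -/
theorem Kinding.subst {Δ : KindCtx} {rs : List Ty} (hrs : List.Forall₂ (Kinding []) rs Δ)
    {t : Ty} {k : Kind} (h : Kinding Δ t k) : Kinding [] (t.subst rs) k := by
  induction h with
  | unit => exact .unit
  | prim => exact .prim
  | fn => exact .fn
  | var h hk =>
    obtain ⟨a, ha, hak⟩ := forall₂_getElem? hrs h
    simpa [Ty.subst, ha] using hak.mono hk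
  | varBang h hk =>
    obtain ⟨a, ha, hak⟩ := forall₂_getElem? hrs h
    simpa [Ty.subst, ha] using hak.bang.mono hk
  | variant _ ih =>
    refine .variant fun C t hC => ?_
    obtain ⟨s, hs, rfl⟩ := Ty.substOpt_eq_some.1 hC
    exact ih C s hs
  | abs h _ ih =>
    refine .abs h fun t ht => ?_
    rw [Ty.substList_eq_map, List.mem_map] at ht
    obtain ⟨s, hs, rfl⟩ := ht
    exact ih s hs
  | record h _ ih =>
    refine .record h fun f t ht => ?_
    obtain ⟨s, hs, rfl⟩ := Ty.present_mem_substFields ht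
    exact ih f s hs

theorem Kinding.forall₂_substList {Δ : KindCtx} {rs ts : List Ty} {ks : List Kind}
    (hrs : List.Forall₂ (Kinding []) rs Δ) (h : List.Forall₂ (Kinding Δ) ts ks) :
    List.Forall₂ (Kinding []) (Ty.substList rs ts) ks := by
  induction h with
  | nil => exact .nil
  | cons h _ ih => exact .cons (h.subst hrs) ih

/-! ### Fields -/

theorem getField_setField {α : Type*} {f : Name} {a b : α} {fs : List (Name × α)}
    (h : getField f fs = some b) : getField f (setField f a fs) = some a := by
  induction fs with
  | nil => simp [getField] at h
  | cons c fs ih => simp only [setField]; split <;> simp_all [getField]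

/-- Lets `put` on a present field be treated as taking the field and then filling it: the record
type comes back unchanged. -/
theorem setField_setField_self {α : Type*} {f : Name} {a b : α} {fs : List (Name × α)}
    (h : getField f fs = some b) : setField f b (setField f a fs) = fs := by
  induction fs with
  | nil => rfl
  | cons c fs ih =>
    obtain ⟨g, c⟩ := c
    by_cases hg : g = f <;> simp_all [getField, setField]

theorem getField_substFields_present {rs : List Ty} {f : Name} {t : Ty} {fs : Fields}
    (h : getField f fs = some (.present t)) :
    getField f (Ty.substFields rs fs) = some (.present (t.subst rs)) := by
  induction fs with
  | nil => simp [getField] at h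
  | cons a fs ih =>
    obtain ⟨g, _ | _⟩ := a <;> by_cases hg : g = f <;> simp_all [getField, Ty.substFields]

theorem getField_substFields_taken {rs : List Ty} {f : Name} {t : Ty} {fs : Fields}
    (h : getField f fs = some (.taken t)) :
    getField f (Ty.substFields rs fs) = some (.taken (t.subst rs)) := by
  induction fs with
  | nil => simp [getField] at h
  | cons a fs ih =>
    obtain ⟨g, _ | _⟩ := a <;> by_cases hg : g = f <;> simp_all [getField, Ty.substFields]

theorem substFields_setField_present (rs : List Ty) (f : Name) (t : Ty) (fs : Fields) :
    Ty.substFields rs (setField f (.present t) fs) =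
      setField f (.present (t.subst rs)) (Ty.substFields rs fs) := by
  induction fs with
  | nil => rfl
  | cons a fs ih =>
    obtain ⟨g, _ | _⟩ := a <;> by_cases hg : g = f <;> simp_all [setField, Ty.substFields]

theorem substFields_setField_taken (rs : List Ty) (f : Name) (t : Ty) (fs : Fields) :
    Ty.substFields rs (setField f (.taken t) fs) =
      setField f (.taken (t.subst rs)) (Ty.substFields rs fs) := by
  induction fs with
  | nil => rfl
  | cons a fs ih =>
    obtain ⟨g, _ | _⟩ := a <;> by_cases hg : g = f <;> simp_all [setField, Ty.substFields]

theorem substFields_zip (rs : List Ty) (ns : List Name) (ts : List Ty) :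
    Ty.substFields rs (ns.zip (ts.map Fld.present)) =
      ns.zip ((Ty.substList rs ts).map Fld.present) := by
  induction ns generalizing ts with
  | nil => rfl
  | cons n ns ih => cases ts <;> simp_all [Ty.substFields, Ty.substList]

/-! ### Instantiation of typing derivations -/

/-- Instantiation of the type variables in a context. -/
def Ctx.subst (rs : List Ty) (Γ : Ctx) : Ctx := fun x => Ty.substOpt rs (Γ x)

theorem Ctx.subst_single (rs : List Ty) (x : Name) (t : Ty) :
    Ctx.subst rs (single x t) = single x (t.subst rs) := by
  funext y; by_cases h : y = x <;> simp [Ctx.subst, single, h, Ty.substOpt]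

theorem Ctx.subst_extend (rs : List Ty) (x : Name) (t : Ty) (Γ : Ctx) :
    Ctx.subst rs (extend x t Γ) = extend x (t.subst rs) (Ctx.subst rs Γ) := by
  funext y; by_cases h : y = x <;> simp [Ctx.subst, extend, h, Ty.substOpt]

theorem Ctx.subst_eq_none {rs : List Ty} {Γ : Ctx} {x : Name} (h : Γ x = none) :
    Ctx.subst rs Γ x = none := by simp [Ctx.subst, h, Ty.substOpt]

theorem Ty.subst_variant_single (rs : List Ty) (C : Name) (t : Ty) :
    (Ty.variant (single C t)).subst rs = .variant (single C (t.subst rs)) :=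
  congrArg Ty.variant (Ctx.subst_single rs C t)

theorem Ty.subst_variant_without (rs : List Ty) (C : Name) (cs : Alts) :
    (Ty.variant (without C cs)).subst rs =
      .variant (without C fun D => Ty.substOpt rs (cs D)) := by
  simp only [Ty.subst, Ty.variant.injEq]
  funext D; by_cases h : D = C <;> simp [without, h, Ty.substOpt]

theorem Ty.substList_map_prim (rs : List Ty) (ts : List PrimTy) :
    Ty.substList rs (ts.map Ty.prim) = ts.map Ty.prim := by
  simp [Ty.substList_eq_map, Ty.subst]

theorem Expr.substList_map_snd (rs : List Ty) (fes : List (Name × Expr)) :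
    Expr.substList rs (fes.map Prod.snd) = (Expr.substFields rs fes).map Prod.snd := by
  induction fes <;> simp_all [Expr.substList, Expr.substFields]

theorem Expr.map_fst_substFields (rs : List Ty) (fes : List (Name × Expr)) :
    (Expr.substFields rs fes).map Prod.fst = fes.map Prod.fst := by
  induction fes <;> simp_all [Expr.substFields]

theorem Weakening.subst {Δ : KindCtx} {rs : List Ty} (hrs : List.Forall₂ (Kinding []) rs Δ)
    {Γ Γ' : Ctx} (h : Weakening Δ Γ Γ') : Weakening [] (Γ.subst rs) (Γ'.subst rs) := by
  intro x
  rcases h x with h | ⟨h, t, ht, hk⟩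
  · exact .inl (by simp [Ctx.subst, h])
  · exact .inr ⟨Ctx.subst_eq_none h, _, by simp [Ctx.subst, ht, Ty.substOpt], hk.subst hrs⟩

theorem SplitEntry.subst {Δ : KindCtx} {rs : List Ty} (hrs : List.Forall₂ (Kinding []) rs Δ)
    {a b c : Option Ty} (h : SplitEntry Δ a b c) :
    SplitEntry [] (Ty.substOpt rs a) (Ty.substOpt rs b) (Ty.substOpt rs c) := by
  cases h with
  | absent => exact .absent
  | left => exact .left
  | right => exact .right
  | share hk => exact .share (hk.subst hrs)

theorem Split.subst {Δ : KindCtx} {rs : List Ty} (hrs : List.Forall₂ (Kinding []) rs Δ)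
    {Γ Γ₁ Γ₂ : Ctx} (h : Split Δ Γ Γ₁ Γ₂) :
    Split [] (Γ.subst rs) (Γ₁.subst rs) (Γ₂.subst rs) :=
  fun x => (h x).subst hrs

theorem SplitBang.subst {Δ : KindCtx} {rs : List Ty} (hrs : List.Forall₂ (Kinding []) rs Δ)
    {ys : List Name} {Γ Γ₁ Γ₂ : Ctx} (h : SplitBang Δ ys Γ Γ₁ Γ₂) :
    SplitBang [] ys (Γ.subst rs) (Γ₁.subst rs) (Γ₂.subst rs) := by
  intro x
  rcases h x with ⟨hx, t, h, h₁, h₂⟩ | ⟨hx, h⟩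
  · exact .inl ⟨hx, t.subst rs, by
      simp [Ctx.subst, h, h₁, h₂, Ty.substOpt, Ty.subst_bang]⟩
  · exact .inr ⟨hx, h.subst hrs⟩

/-- Typing is stable under instantiation by types of the declared kinds. -/
theorem Typing.subst {Pr : Program} (hPr : Pr.WellTyped) {Δ : KindCtx} {rs : List Ty}
    (hrs : List.Forall₂ (Kinding []) rs Δ) {Γ : Ctx} {e : Expr} {t : Ty}
    (h : Typing Pr Δ Γ e t) : Typing Pr [] (Γ.subst rs) (e.subst rs) (t.subst rs) := by
  refine Typing.rec (Pr := Pr) (Δ := Δ)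
    (motive_1 := fun Γ e t _ => Typing Pr [] (Γ.subst rs) (e.subst rs) (t.subst rs))
    (motive_2 := fun Γ es ts _ =>
      TypingList Pr [] (Γ.subst rs) (Expr.substList rs es) (Ty.substList rs ts))
    ?var ?unit ?lit ?primOp ?cast ?app ?tyApp ?ite ?caseOf ?con ?promote ?esac ?letIn ?letBang
    ?take₁ ?take₂ ?put₁ ?put₂ ?member ?struct ?nil ?cons h
  case var => intro Γ x t h; exact .var (by simpa [Ctx.subst_single] using h.subst hrs)
  case unit => intro Γ h; exact .unit (h.subst hrs)
  case lit => intro Γ l t h hl; exact .lit (h.subst hrs) hl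
  case primOp =>
    intro Γ o es ts t _ ho ih
    exact .primOp (by simpa [Ty.substList_map_prim] using ih) ho
  case cast => intro Γ e t t' _ hs ih; exact .cast (by simpa [Ty.subst] using ih) hs
  case app =>
    intro Γ Γ₁ Γ₂ e₁ e₂ r t hs _ _ ih₁ ih₂
    exact .app (hs.subst hrs) (by simpa [Ty.subst] using ih₁) ih₂
  case tyApp =>
    intro Γ f ts d hw hd hts
    have hl : d.kinds.length = ts.length := hts.length_eq.symm
    have hs := hPr.1 f d hd
    rw [hl] at hs
    -- The declared type mentions quantified variables only, and `ts` instantiates all of them, so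
    -- the two instantiations merge into one.
    rw [Ty.subst_subst (.fn hs.1 hs.2)]
    exact .tyApp (hw.subst hrs) hd (Kinding.forall₂_substList hrs hts)
  case ite =>
    intro Γ Γ₁ Γ₂ e₁ e₂ e₃ t hs _ _ _ ih₁ ih₂ ih₃
    exact .ite (hs.subst hrs) (by simpa [Ty.subst] using ih₁) ih₂ ih₃
  case caseOf =>
    intro Γ Γ₁ Γ₂ e₁ e₂ e₃ C x y cs r t hs _ hC hx _ hy _ ih₁ ih₂ ih₃
    rw [Ctx.subst_extend] at ih₂ ih₃
    rw [Ty.subst_variant_without] at ih₃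
    exact .caseOf (hs.subst hrs) ih₁ (by simp [hC, Ty.substOpt]) (Ctx.subst_eq_none hx) ih₂
      (Ctx.subst_eq_none hy) ih₃
  case con =>
    intro Γ C e t _ ih
    rw [Ty.subst_variant_single]
    exact .con ih
  case promote =>
    intro Γ cs bs e _ hsub ih
    refine .promote ih fun C t hC => ?_
    obtain ⟨s, hs, rfl⟩ := Ty.substOpt_eq_some.1 hC
    exact Ty.substOpt_eq_some.2 ⟨s, hsub C s hs, rfl⟩
  case esac =>
    intro Γ C e t _ ih
    rw [Ty.subst_variant_single] at ih
    exact .esac ih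
  case letIn =>
    intro Γ Γ₁ Γ₂ x e₁ e₂ r t hs _ hx _ ih₁ ih₂
    rw [Ctx.subst_extend] at ih₂
    exact .letIn (hs.subst hrs) ih₁ (Ctx.subst_eq_none hx) ih₂
  case letBang =>
    intro Γ Γ₁ Γ₂ ys x e₁ e₂ r t hs hk _ hx _ ih₁ ih₂
    rw [Ctx.subst_extend] at ih₂
    exact .letBang (hs.subst hrs) (hk.subst hrs) ih₁ (Ctx.subst_eq_none hx) ih₂
  case take₁ =>
    intro Γ Γ₁ Γ₂ x f y e₁ e₂ fs m r t hs hm _ hf hx hy hxy _ ih₁ ih₂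
    rw [Ctx.subst_extend, Ctx.subst_extend, Ty.subst, substFields_setField_taken] at ih₂
    exact .take₁ (hs.subst hrs) hm ih₁ (getField_substFields_present hf) (Ctx.subst_eq_none hx)
      (Ctx.subst_eq_none hy) hxy ih₂
  case take₂ =>
    intro Γ Γ₁ Γ₂ x f y e₁ e₂ fs m r t hs hk hm hf _ hx hy hxy _ ih₁ ih₂
    rw [Ctx.subst_extend, Ctx.subst_extend] at ih₂
    exact .take₂ (hs.subst hrs) (hk.subst hrs) hm (getField_substFields_present hf) ih₁
      (Ctx.subst_eq_none hx) (Ctx.subst_eq_none hy) hxy ih₂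
  case put₁ =>
    intro Γ Γ₁ Γ₂ f e₁ e₂ fs m r hs hm _ hf _ ih₁ ih₂
    rw [Ty.subst, substFields_setField_present]
    exact .put₁ (hs.subst hrs) hm ih₁ (getField_substFields_taken hf) ih₂
  case put₂ =>
    intro Γ Γ₁ Γ₂ f e₁ e₂ fs m r hs hm hf _ hk _ ih₁ ih₂
    exact .put₂ (hs.subst hrs) hm (getField_substFields_present hf) ih₁ (hk.subst hrs) ih₂
  case member =>
    intro Γ e f fs m t hk _ hf ih
    exact .member (hk.subst hrs) ih (getField_substFields_present hf)
  case struct =>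
    intro Γ fes ts _ ih
    rw [Expr.substList_map_snd] at ih
    have := Typing.struct ih
    rwa [Expr.map_fst_substFields, ← substFields_zip] at this
  case nil => intro Γ h; exact .nil (h.subst hrs)
  case cons =>
    intro Γ Γ₁ Γ₂ e es t ts hs _ _ ih₁ ih₂
    exact .cons (hs.subst hrs) ih₁ ih₂

/-- The instantiated body of a concrete function has the instantiated type. -/
theorem Program.WellTyped.body {Pr : Program} (hPr : Pr.WellTyped) {f : Name} {ks : List Kind}
    {t r : Ty} {x : Name} {e : Expr} (hf : Pr f = some (.concrete ks t r x e)) {rs : List Ty}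
    (hrs : List.Forall₂ (Kinding []) rs ks) :
    Typing Pr [] (single x (t.subst rs)) (e.subst rs) (r.subst rs) := by
  simpa [Ctx.subst_single] using (hPr.2 f ks t r x e hf).subst hPr hrs

/-! ### Primitive operations -/

theorem litBool_lt (p : Prop) [Decidable p] : litBool p < 2 := by unfold litBool; split <;> simp

theorem NumTy.exists_size (n : NumTy) : ∃ k, n.size = 2 ^ k := by cases n <;> exact ⟨_, rfl⟩

/-- Primitive operations on literals below the bounds of their types yield literals below the
bound of the result type. -/
theorem PrimOp.eval_lt {o : PrimOp} {ts : List PrimTy} {t : PrimTy} {ls : List ℕ} {l : ℕ}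
    (ho : o.type = (ts, t)) (hl : List.Forall₂ (fun l t => l < PrimTy.size t) ls ts)
    (h : o.eval ls = some l) : l < t.size := by
  cases o with
  | not =>
    cases ho
    rcases hl with _ | ⟨_, _ | _⟩
    cases h
    exact litBool_lt _
  | complement n =>
    cases ho
    rcases hl with _ | ⟨h₁, _ | _⟩
    cases h
    simp only [PrimTy.size] at *
    omega
  | _ =>
    cases ho
    rcases hl with _ | ⟨h₁, _ | ⟨h₂, _ | _⟩⟩
    cases h
    first
    | exact litBool_lt _
    -- The modulus is positive because the first operand lies below it.
    | exact Nat.mod_lt _ (by simp only [PrimTy.size] at *; omega)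
    | exact (Nat.div_le_self _ _).trans_lt h₁
    | exact Nat.and_le_left.trans_lt h₁
    | exact (Nat.shiftRight_le _ _).trans_lt h₁
    | (split
       · simp only [PrimTy.size] at *; omega
       · exact (Nat.mod_le _ _).trans_lt h₁)
    -- Bitwise or and exclusive or stay below the bound only because it is a power of two.
    | (rename_i n _ _
       obtain ⟨k, hk⟩ := n.exists_size
       simp only [PrimTy.size, hk] at *
       first
       | exact Nat.or_lt_two_pow h₁ h₂
       | exact Nat.xor_lt_two_pow h₁ h₂)


/-! ### Framing -/

section Frame

variable {P : Type uP} {AU : Type uU}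

theorem Frame.refl (w : Set P) (μ : Store P AU) : Frame w μ w μ :=
  ⟨fun _ _ => rfl, fun _ h h' => absurd h h', fun _ h h' => absurd h' h⟩

/-- Each clause splits on whether the pointer is in the intermediate set `w'`. The notable case is a
pointer in `w'` but in neither end: it was fresh for the first step and is freed by the second, so
it is unallocated in both outer stores and inertia holds. -/
theorem Frame.trans {w w' w'' : Set P} {μ μ' μ'' : Store P AU} (h : Frame w μ w' μ')
    (h' : Frame w' μ' w'' μ'') : Frame w μ w'' μ'' := by
  obtain ⟨i, l, f⟩ := h
  obtain ⟨i', l', f'⟩ := h'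
  simp only [Set.mem_union] at i i'
  constructor <;> intro p <;> have := i p <;> have := l p <;> have := f p <;> have := i' p <;>
    have := l' p <;> have := f' p <;> by_cases hp : p ∈ w' <;> grind

/-- On `s` all three clauses become vacuous, and off `s` they are the old ones. No disjointness is
needed, so the footprint of the unused rest of an environment can always be added. -/
theorem Frame.union_right {w w' : Set P} {μ μ' : Store P AU} (h : Frame w μ w' μ') (s : Set P) :
    Frame (w ∪ s) μ (w' ∪ s) μ' := by
  obtain ⟨i, l, f⟩ := h
  simp only [Set.mem_union] at i
  constructor <;> intro p <;> have := i p <;> have := l p <;> have := f p <;>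
    grind

/-- Writable pointers of the result were writable before, or they are newly allocated. -/
theorem Frame.notMem_of_allocated {w w' : Set P} {μ μ' : Store P AU} (h : Frame w μ w' μ') {p : P}
    (hp : p ∉ w) (ha : μ p ≠ none) : p ∉ w' :=
  fun hp' => ha (h.freshAllocation p hp hp')

/-- Fresh allocation keeps such a pointer out of `w'`; then inertia applies to it. -/
theorem Frame.eq_of_allocated {w w' : Set P} {μ μ' : Store P AU} (h : Frame w μ w' μ') {p : P}
    (hp : p ∉ w) (ha : μ p ≠ none) : μ' p = μ p :=
  (h.inertia p fun h' => h'.elim hp (h.notMem_of_allocated hp ha)).symm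

/-- Framing says nothing about the contents of the final store at its final writable pointers:
inertia and leak freedom exempt them, and fresh allocation speaks of the initial store. This is what
permits an update in place. -/
theorem Frame.update [DecidableEq P] {w w' : Set P} {μ μ' : Store P AU} (h : Frame w μ w' μ')
    {p : P} (hp : p ∈ w') (a : Option (UVal P AU)) : Frame w μ w' (Function.update μ' p a) := by
  refine ⟨fun q hq => ?_, fun q hq hq' => ?_, h.freshAllocation⟩
  · have : q ≠ p := fun e => hq (.inr (e ▸ hp))
    rw [Function.update_of_ne this]
    exact h.inertia q hq
  · have : q ≠ p := fun e => hq' (e ▸ hp)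
    rw [Function.update_of_ne this]
    exact h.leakFreedom q hq hq'

end Frame

/-! ### Corresponding values -/

section Corr

variable {P : Type uP} {AU : Type uU} {AV : Type uV} {Pr : Program} {R : AbsCorr P AU AV}
  {μ μ' : Store P AU}

/-- A writable pointer of one component is not a pointer of the other. -/
def NonInterfering (r w r' w' : Set P) : Prop := w ∩ (r' ∪ w') = ∅ ∧ w' ∩ (r ∪ w) = ∅

theorem nonInterfering_iff {r w r' w' : Set P} : NonInterfering r w r' w' ↔
    (∀ p ∈ w, p ∉ r' ∧ p ∉ w') ∧ ∀ p ∈ w', p ∉ r ∧ p ∉ w := by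
  simp only [NonInterfering, Set.eq_empty_iff_forall_notMem, Set.mem_inter_iff, Set.mem_union]
  grind

theorem NonInterfering.symm {r w r' w' : Set P} (h : NonInterfering r w r' w') :
    NonInterfering r' w' r w := ⟨h.2, h.1⟩

theorem Corr.cast {u : UVal P AU} {v : Val AV} {t : Ty} {r w r' w' : Set P}
    (h : Corr Pr R μ u v t r w) (hr : r = r') (hw : w = w') : Corr Pr R μ u v t r' w' := by
  subst hr hw; exact h

theorem CorrFields.cast {us : List (Name × UVal P AU)} {vs : List (Name × Val AV)} {fs : Fields}
    {r w r' w' : Set P} (h : CorrFields Pr R μ us vs fs r w) (hr : r = r') (hw : w = w') :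
    CorrFields Pr R μ us vs fs r' w' := by
  subst hr hw; exact h

/-- All pointers of a value are allocated. -/
theorem Corr.allocated (hR : R.Lawful) {u : UVal P AU} {v : Val AV} {t : Ty} {r w : Set P}
    (h : Corr Pr R μ u v t r w) : ∀ p ∈ r ∪ w, μ p ≠ none := by
  refine Corr.rec (Pr := Pr) (R := R) (μ := μ)
    (motive_1 := fun _ _ _ r w _ => ∀ p ∈ r ∪ w, μ p ≠ none)
    (motive_2 := fun _ _ _ r w _ => ∀ p ∈ r ∪ w, μ p ≠ none)
    ?_ ?_ ?_ ?_ ?_ ?_ ?_ ?_ ?_ ?_ ?_ ?_ ?_ ?_ h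
  case refine_7 => intro a b T ts r w h; exact hR.allocated _ _ _ _ _ _ _ _ h
  case refine_9 =>
    intro p a b T ts r w hp h hpr q hq
    have := hR.allocated _ _ _ _ _ _ _ _ h q
    grind
  case refine_11 =>
    intro p a b T ts r hp h q hq
    have := hR.allocated _ _ _ _ _ _ _ _ h q
    grind
  all_goals intros; grind

/-- Every store lookup in a derivation is at a pointer that the rule puts into the footprint; for
abstract values this is assumed. -/
theorem Corr.of_eqOn (hR : R.Lawful) {u : UVal P AU} {v : Val AV} {t : Ty} {r w : Set P}
    (h : Corr Pr R μ u v t r w) (hμ : ∀ p ∈ r ∪ w, μ' p = μ p) : Corr Pr R μ' u v t r w := by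
  refine Corr.rec (Pr := Pr) (R := R) (μ := μ)
    (motive_1 := fun u v t r w _ => (∀ p ∈ r ∪ w, μ' p = μ p) → Corr Pr R μ' u v t r w)
    (motive_2 := fun us vs fs r w _ =>
      (∀ p ∈ r ∪ w, μ' p = μ p) → CorrFields Pr R μ' us vs fs r w)
    ?lit ?unit ?con ?fn ?absFn ?recU ?absU ?recW ?absW ?recR ?absR ?nil ?present ?taken h hμ
  case lit => intro _ _ h _; exact .lit h
  case unit => intro _; exact .unit
  case con => intro _ _ _ _ _ _ _ _ hC ih hμ; exact .con (ih hμ) hC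
  case fn => intro _ _ _ _ h _; exact .fn h
  case absFn => intro _ _ _ _ _ h h' _; exact .absFn h h'
  case recU => intro _ _ _ _ _ _ ih hμ; exact .recU (ih hμ)
  case absU => intro _ _ _ _ _ _ h hμ; exact .absU (hR.local_store _ _ _ _ _ _ _ _ h _ hμ)
  case recW =>
    intro p _ _ _ r w hp _ hn ih hμ
    exact .recW ((hμ p (by simp)).trans hp) (ih fun q hq => hμ q (by grind)) hn
  case absW =>
    intro p _ _ _ _ r w hp h hn hμ
    exact .absW ((hμ p (by simp)).trans hp)
      (hR.local_store _ _ _ _ _ _ _ _ h _ fun q hq => hμ q (by grind)) hn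
  case recR =>
    intro p _ _ _ r hp _ ih hμ
    exact .recR ((hμ p (by simp)).trans hp) (ih fun q hq => hμ q (by grind))
  case absR =>
    intro p _ _ _ _ r hp h hμ
    exact .absR ((hμ p (by simp)).trans hp)
      (hR.local_store _ _ _ _ _ _ _ _ h _ fun q hq => hμ q (by grind))
  case nil => intro _; exact .nil
  case present =>
    intro _ _ _ _ _ _ _ _ _ _ _ _ _ h₁ h₂ ih₁ ih₂ hμ
    exact .present (ih₁ fun q hq => hμ q (by grind)) (ih₂ fun q hq => hμ q (by grind)) h₁ h₂
  case taken => intro _ _ _ _ _ _ _ _ _ _ ih hμ; exact .taken (ih hμ)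

/-- A writable pointer to a record or an abstract value comes with the writable mode, whose kind is
`{E}` and excludes `k`; unboxed abstract values obey by assumption. Taken fields contribute no
pointers, in accordance with kinding, which ignores them. -/
theorem Corr.no_writable (hR : R.Lawful) {k : Perm} (hk : k ≠ .E) {u : UVal P AU} {v : Val AV}
    {t : Ty} {r w : Set P} (h : Corr Pr R μ u v t r w) (ht : Kinding [] t {k}) : w = ∅ := by
  refine Corr.rec (Pr := Pr) (R := R) (μ := μ)
    (motive_1 := fun _ _ t _ w _ => Kinding [] t {k} → w = ∅)
    (motive_2 := fun _ _ fs _ w _ =>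
      (∀ f t, (f, Fld.present t) ∈ fs → Kinding [] t {k}) → w = ∅)
    ?lit ?unit ?con ?fn ?absFn ?recU ?absU ?recW ?absW ?recR ?absR ?nil ?present ?taken h ht
  case con => intro _ _ _ _ _ _ _ _ hC ih ht; cases ht with | variant ht => exact ih (ht _ _ hC)
  case recU => intro _ _ _ _ _ _ ih ht; cases ht with | record _ ht => exact ih ht
  case absU =>
    intro _ _ _ _ _ _ h ht
    cases k with
    | D => exact hR.discard _ _ _ _ _ _ _ _ h ht
    | S => exact hR.share _ _ _ _ _ _ _ _ h ht
    | E => exact absurd rfl hk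
  case recW =>
    intro _ _ _ _ _ _ _ _ _ _ ht
    cases ht with | record ht _ => simp [Mode.kind, hk] at ht
  case absW =>
    intro _ _ _ _ _ _ _ _ _ _ ht
    cases ht with | abs ht _ => simp [Mode.kind, hk] at ht
  case present =>
    intro _ _ _ _ _ _ _ _ _ _ _ _ _ _ _ ih₁ ih₂ ht
    rw [ih₁ (ht _ _ List.mem_cons_self), ih₂ fun f t h => ht f t (List.mem_cons_of_mem _ h)]
    simp
  case taken =>
    intro _ _ _ _ _ _ _ _ _ _ ih ht
    exact ih fun f t h => ht f t (List.mem_cons_of_mem _ h)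
  all_goals intros; rfl

/-- Dual to `Corr.no_writable`: the read-only mode has kind `{D, S}` and so cannot be escapable. A
writable record may be, but only if its present fields are, whence the induction on fields. -/
theorem Corr.escape (hR : R.Lawful) {u : UVal P AU} {v : Val AV}
    {t : Ty} {r w : Set P} (h : Corr Pr R μ u v t r w) (ht : Kinding [] t {Perm.E}) : r = ∅ := by
  refine Corr.rec (Pr := Pr) (R := R) (μ := μ)
    (motive_1 := fun _ _ t r _ _ => Kinding [] t {Perm.E} → r = ∅)
    (motive_2 := fun _ _ fs r _ _ =>
      (∀ f t, (f, Fld.present t) ∈ fs → Kinding [] t {Perm.E}) → r = ∅)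
    ?lit ?unit ?con ?fn ?absFn ?recU ?absU ?recW ?absW ?recR ?absR ?nil ?present ?taken h ht
  case con => intro _ _ _ _ _ _ _ _ hC ih ht; cases ht with | variant ht => exact ih (ht _ _ hC)
  case recU => intro _ _ _ _ _ _ ih ht; cases ht with | record _ ht => exact ih ht
  case absU => intro _ _ _ _ _ _ h ht; exact hR.escape _ _ _ _ _ _ _ _ h ht
  case recW => intro _ _ _ _ _ _ _ _ _ ih ht; cases ht with | record _ ht => exact ih ht
  case absW => intro _ _ _ _ _ _ _ _ h _ ht; exact hR.escape _ _ _ _ _ _ _ _ h ht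
  case recR =>
    intro _ _ _ _ _ _ _ _ ht
    cases ht with | record ht _ => simp [Mode.kind] at ht
  case absR =>
    intro _ _ _ _ _ _ _ _ ht
    cases ht with | abs ht _ => simp [Mode.kind] at ht
  case present =>
    intro _ _ _ _ _ _ _ _ _ _ _ _ _ _ _ ih₁ ih₂ ht
    rw [ih₁ (ht _ _ List.mem_cons_self), ih₂ fun f t h => ht f t (List.mem_cons_of_mem _ h)]
    simp
  case taken =>
    intro _ _ _ _ _ _ _ _ _ _ ih ht
    exact ih fun f t h => ht f t (List.mem_cons_of_mem _ h)
  all_goals intros; rfl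

/-- Observation turns the writable pointers into read-only ones. -/
theorem Corr.bang (hR : R.Lawful) {u : UVal P AU} {v : Val AV}
    {t : Ty} {r w : Set P} (h : Corr Pr R μ u v t r w) : Corr Pr R μ u v t.bang (r ∪ w) ∅ := by
  refine Corr.rec (Pr := Pr) (R := R) (μ := μ)
    (motive_1 := fun u v t r w _ => Corr Pr R μ u v t.bang (r ∪ w) ∅)
    (motive_2 := fun us vs fs r w _ => CorrFields Pr R μ us vs (Ty.bangFields fs) (r ∪ w) ∅)
    ?lit ?unit ?con ?fn ?absFn ?recU ?absU ?recW ?absW ?recR ?absR ?nil ?present ?taken h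
  case lit => intro _ _ h; exact (Corr.lit h).cast (by simp) rfl
  case unit => exact Corr.unit.cast (by simp) rfl
  case con => intro _ _ _ _ _ _ _ _ hC ih; exact .con ih (Ty.bangOpt_eq_some.2 ⟨_, hC, rfl⟩)
  case fn => intro _ _ _ _ h; exact (Corr.fn h).cast (by simp) rfl
  case absFn => intro _ _ _ _ _ h h'; exact (Corr.absFn h h').cast (by simp) rfl
  case recU => intro _ _ _ _ _ _ ih; exact .recU ih
  case absU =>
    intro _ _ _ _ _ _ h
    have := hR.bang _ _ _ _ _ _ _ _ h
    rw [← Ty.bangList_eq_map] at this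
    exact .absU this
  case recW =>
    intro p _ _ _ r w hp _ _ ih
    -- The pointer `p` of the record moves from the writable to the read-only set, together with the
    -- writable pointers of the fields.
    exact (Corr.recR hp ih).cast (Set.union_left_comm ..) rfl
  case absW =>
    intro p _ _ _ _ r w hp h _
    have := hR.bang _ _ _ _ _ _ _ _ h
    rw [← Ty.bangList_eq_map] at this
    exact (Corr.absR hp this).cast (Set.union_left_comm ..) rfl
  case recR => intro p _ _ _ r hp _ ih; exact (Corr.recR hp ih).cast (by simp) rfl
  case absR =>
    intro p _ _ _ _ r hp h
    have := hR.bang _ _ _ _ _ _ _ _ h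
    rw [← Ty.bangList_eq_map] at this
    exact (Corr.absR hp this).cast (by simp) rfl
  case nil => exact CorrFields.nil.cast (by simp) rfl
  case present =>
    intro _ _ _ _ _ _ _ _ _ _ _ _ _ _ _ ih₁ ih₂
    -- After observation both writable sets are empty, so non-interference of the fields is vacuous.
    exact (CorrFields.present ih₁ ih₂ (by simp) (by simp)).cast (by grind) (by simp)
  case taken => intro _ _ _ _ _ _ _ _ _ _ ih; exact .taken ih

/-! Inversion of the correspondence. -/

theorem Corr.lit_inv {u : UVal P AU} {v : Val AV} {t : PrimTy} {r w : Set P}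
    (h : Corr Pr R μ u v (.prim t) r w) :
    ∃ l, u = .lit l ∧ v = .lit l ∧ l < t.size ∧ r = ∅ ∧ w = ∅ := by
  cases h; exact ⟨_, rfl, rfl, ‹_›, rfl, rfl⟩

theorem Corr.con_inv {u : UVal P AU} {v : Val AV} {cs : Alts} {r w : Set P}
    (h : Corr Pr R μ u v (.variant cs) r w) :
    ∃ C u' v' t, u = .con C u' ∧ v = .con C v' ∧ cs C = some t ∧ Corr Pr R μ u' v' t r w := by
  cases h; exact ⟨_, _, _, _, rfl, rfl, ‹_›, ‹_›⟩

theorem Corr.fn_inv {x : Name} {e : Expr} {v : Val AV} {t t' : Ty} {r w : Set P}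
    (h : Corr Pr R μ (.fn x e) v (.fn t t') r w) :
    v = .fn x e ∧ Typing Pr [] (single x t) e t' ∧ r = ∅ ∧ w = ∅ := by
  cases h; exact ⟨rfl, ‹_›, rfl, rfl⟩

theorem Corr.absFn_inv {f : Name} {rs : List Ty} {v : Val AV} {t t' : Ty} {r w : Set P}
    (h : Corr Pr R μ (.absFn f rs) v (.fn t t') r w) :
    v = .absFn f rs ∧ (∃ ks s s', Pr f = some (.abstract ks s s') ∧
      List.Forall₂ (Kinding []) rs ks ∧ t = s.subst rs ∧ t' = s'.subst rs) ∧ r = ∅ ∧ w = ∅ := by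
  -- The type index of the constructor is an instantiation rather than a constructor pattern, so the
  -- equation of types is kept aside and unfolded separately.
  generalize hT : Ty.fn t t' = T at h
  cases h with
  | absFn hf hrs =>
    rw [Ty.subst, Ty.fn.injEq] at hT
    exact ⟨rfl, ⟨_, _, _, hf, hrs, hT.1, hT.2⟩, rfl, rfl⟩

/-- The pointers and the fields of a record that is not read-only: `s` is empty, or it holds the
pointer to the record. -/
inductive RecordAt (μ : Store P AU) : UVal P AU → Mode → List (Name × UVal P AU) → Set P → Prop
  | unboxed {us : List (Name × UVal P AU)} : RecordAt μ (.record us) .unboxed us ∅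
  | boxed {p : P} {us : List (Name × UVal P AU)} :
      μ p = some (.record us) → RecordAt μ (.ptr p) .writable us {p}

/-- Treats unboxed and writable records uniformly. Keeping the pointer of the record in `s`, apart
from the pointers `w'` of the fields, allows fields to be removed or replaced while the box stays.
-/
theorem Corr.record_inv {u : UVal P AU} {v : Val AV} {fs : Fields} {m : Mode} {r w : Set P}
    (hm : m ≠ .readOnly) (h : Corr Pr R μ u v (.record fs m) r w) :
    ∃ us vs s w', v = .record vs ∧ RecordAt μ u m us s ∧ CorrFields Pr R μ us vs fs r w' ∧
      w = s ∪ w' ∧ ∀ p ∈ s, p ∉ r ∪ w' := by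
  cases h with
  | recU h => exact ⟨_, _, ∅, _, rfl, .unboxed, h, by simp, by simp⟩
  | recW hp h hn => exact ⟨_, _, {_}, _, rfl, .boxed hp, h, rfl, by simpa using hn⟩
  | recR => exact absurd rfl hm

/-- Converse of `Corr.record_inv`, for reassembling a record after its fields have changed. -/
theorem RecordAt.corr {u : UVal P AU} {vs : List (Name × Val AV)} {fs : Fields} {m : Mode}
    {us : List (Name × UVal P AU)} {s r w : Set P} (h : RecordAt μ u m us s)
    (hf : CorrFields Pr R μ us vs fs r w) (hs : ∀ p ∈ s, p ∉ r ∪ w) :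
    Corr Pr R μ u (.record vs) (.record fs m) r (s ∪ w) := by
  cases h with
  | unboxed => exact (Corr.recU hf).cast rfl (by simp)
  | boxed hp => exact .recW hp hf (hs _ rfl)

/-! Corresponding fields. -/

theorem CorrFields.of_eqOn (hR : R.Lawful) {us : List (Name × UVal P AU)}
    {vs : List (Name × Val AV)} {fs : Fields} {r w : Set P}
    (h : CorrFields Pr R μ us vs fs r w) (hμ : ∀ p ∈ r ∪ w, μ' p = μ p) :
    CorrFields Pr R μ' us vs fs r w := by
  -- An unboxed record has the footprint of its fields, so the claim for values contains the claim
  -- for fields.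
  cases (Corr.recU h).of_eqOn hR hμ; assumption

/-- Non-interference of the fields is pairwise, so the footprint splits into that of one field and
that of the others. Marking the field as taken removes its share and leaves the stored values alone.
-/
theorem CorrFields.get {us : List (Name × UVal P AU)} {vs : List (Name × Val AV)}
    {fs : Fields} {r w : Set P} {f : Name} {t : Ty} (h : CorrFields Pr R μ us vs fs r w)
    (hf : getField f fs = some (.present t)) :
    ∃ u v r₁ w₁ r₂ w₂, getField f us = some u ∧ getField f vs = some v ∧
      Corr Pr R μ u v t r₁ w₁ ∧ CorrFields Pr R μ us vs (setField f (.taken t) fs) r₂ w₂ ∧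
      NonInterfering r₁ w₁ r₂ w₂ ∧ r = r₁ ∪ r₂ ∧ w = w₁ ∪ w₂ := by
  induction fs generalizing us vs r w with
  | nil => simp [getField] at hf
  | cons a fs ih =>
    cases h with
    | @present g u v t' us vs _ r w r' w' h hs h₁ h₂ =>
      by_cases hg : g = f
      · obtain rfl : t' = t := by simpa [getField, hg] using hf
        refine ⟨u, v, r, w, r', w', ?_, ?_, h, ?_, ⟨h₁, h₂⟩, rfl, rfl⟩
        · simp [getField, hg]
        · simp [getField, hg]
        · simpa [setField, hg] using hs.taken
      · have hf' : getField f fs = some (.present t) := by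
          simpa [getField, hg] using hf
        obtain ⟨u', v', r₁, w₁, r₂, w₂, hu, hv, hc, hcs, hd, rfl, rfl⟩ := ih hs hf'
        rw [nonInterfering_iff] at hd
        have hd' := nonInterfering_iff.1 ⟨h₁, h₂⟩
        have hn : NonInterfering r w r₂ w₂ := nonInterfering_iff.2 (by grind)
        refine ⟨u', v', r₁, w₁, r ∪ r₂, w ∪ w₂, ?_, ?_, hc, ?_, ?_, by grind, by grind⟩
        · simpa [getField, hg] using hu
        · simpa [getField, hg] using hv
        · simpa [setField, hg] using CorrFields.present h hcs hn.1 hn.2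
        · exact nonInterfering_iff.2 (by grind)
    | @taken g u v t' us vs _ r w hs =>
      by_cases hg : g = f
      · simp [getField, hg] at hf
      · have hf' : getField f fs = some (.present t) := by
          simpa [getField, hg] using hf
        obtain ⟨u', v', r₁, w₁, r₂, w₂, hu, hv, hc, hcs, hd, rfl, rfl⟩ := ih hs hf'
        refine ⟨u', v', r₁, w₁, r₂, w₂, ?_, ?_, hc, ?_, hd, rfl, rfl⟩
        · simpa [getField, hg] using hu
        · simpa [getField, hg] using hv
        · simpa [setField, hg] using hcs.taken

/-- Inverse to `CorrFields.get`: the taken field has no share in the footprint, so the old entry is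
irrelevant and the new one only has to avoid interference with the rest. The existence of an old
entry is the premise of the `put` rule in the value semantics. -/
theorem CorrFields.set {us : List (Name × UVal P AU)} {vs : List (Name × Val AV)}
    {fs : Fields} {r w r' w' : Set P} {f : Name} {t : Ty} {u : UVal P AU} {v : Val AV}
    (h : CorrFields Pr R μ us vs fs r w) (hf : getField f fs = some (.taken t))
    (hc : Corr Pr R μ u v t r' w') (hd : NonInterfering r' w' r w) :
    (∃ v₀, getField f vs = some v₀) ∧
      CorrFields Pr R μ (setField f u us) (setField f v vs) (setField f (.present t) fs)
        (r' ∪ r) (w' ∪ w) := by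
  induction fs generalizing us vs r w with
  | nil => simp [getField] at hf
  | cons a fs ih =>
    cases h with
    | @present g u₀ v₀ t' us vs _ r₁ w₁ r₂ w₂ h hs h₁ h₂ =>
      by_cases hg : g = f
      · simp [getField, hg] at hf
      · have hf' : getField f fs = some (.taken t) := by
          simpa [getField, hg] using hf
        rw [nonInterfering_iff] at hd
        have hd' := nonInterfering_iff.1 ⟨h₁, h₂⟩
        obtain ⟨hv, hcs⟩ := ih hs hf' (nonInterfering_iff.2 (by grind))
        have hn : NonInterfering r₁ w₁ (r' ∪ r₂) (w' ∪ w₂) := nonInterfering_iff.2 (by grind)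
        refine ⟨by simpa [getField, hg] using hv, ?_⟩
        simpa [setField, hg, Set.union_left_comm] using
          CorrFields.present h hcs hn.1 hn.2
    | @taken g u₀ v₀ t' us vs _ r₁ w₁ hs =>
      by_cases hg : g = f
      · obtain rfl : t' = t := by simpa [getField, hg] using hf
        refine ⟨by simp [getField, hg], ?_⟩
        simpa [setField, hg] using CorrFields.present hc hs hd.1 hd.2
      · have hf' : getField f fs = some (.taken t) := by
          simpa [getField, hg] using hf
        obtain ⟨hv, hcs⟩ := ih hs hf' hd
        refine ⟨by simpa [getField, hg] using hv, ?_⟩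
        simpa [setField, hg] using hcs.taken

end Corr

/-! ### Corresponding environments -/

section CorrEnv

variable {P : Type uP} {AU : Type uU} {AV : Type uV} {Pr : Program} {R : AbsCorr P AU AV}
  {μ μ' : Store P AU} {U : UEnv P AU} {V : VEnv AV} {Γ Γ₁ Γ₂ : Ctx} {r w : Set P}

/-- The correspondence of environments, with the pointer sets of each variable. -/
structure CorrVars (Pr : Program) (R : AbsCorr P AU AV) (U : UEnv P AU) (μ : Store P AU)
    (V : VEnv AV) (Γ : Ctx) (rs ws : Name → Set P) : Prop where
  corr : ∀ x t, Γ x = some t →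
    ∃ u v, U x = some u ∧ V x = some v ∧ Corr Pr R μ u v t (rs x) (ws x)
  disj : ∀ x y, Γ x ≠ none → Γ y ≠ none → x ≠ y → ∀ p ∈ ws x, p ∉ rs y ∧ p ∉ ws y

/-- The union of the pointer sets of the variables of a context. -/
def Ctx.support (Γ : Ctx) (rs : Name → Set P) : Set P := {p | ∃ x, Γ x ≠ none ∧ p ∈ rs x}

theorem corrEnv_iff : CorrEnv Pr R U μ V Γ r w ↔
    ∃ rs ws, CorrVars Pr R U μ V Γ rs ws ∧ r = Γ.support rs ∧ w = Γ.support ws := by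
  have aux : ∀ a b c : Set P, a ∩ (b ∪ c) = ∅ ↔ ∀ p ∈ a, p ∉ b ∧ p ∉ c := by
    intro a b c
    simp [Set.eq_empty_iff_forall_notMem]
  constructor
  · rintro ⟨rs, ws, h₁, h₂, h₃, h₄⟩
    exact ⟨rs, ws, ⟨h₁, fun x y hx hy hxy => (aux _ _ _).1 (h₂ x y hx hy hxy)⟩, h₃, h₄⟩
  · rintro ⟨rs, ws, ⟨h₁, h₂⟩, h₃, h₄⟩
    exact ⟨rs, ws, h₁, fun x y hx hy hxy => (aux _ _ _).2 (h₂ x y hx hy hxy), h₃, h₄⟩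

theorem CorrEnv.allocated (hR : R.Lawful) (h : CorrEnv Pr R U μ V Γ r w) :
    ∀ p ∈ r ∪ w, μ p ≠ none := by
  obtain ⟨rs, ws, ⟨hc, -⟩, rfl, rfl⟩ := corrEnv_iff.1 h
  rintro p (⟨x, hx, hp⟩ | ⟨x, hx, hp⟩) <;> obtain ⟨t, ht⟩ := Option.ne_none_iff_exists'.1 hx <;>
    obtain ⟨u, v, -, -, hcorr⟩ := hc x t ht
  · exact hcorr.allocated hR p (.inl hp)
  · exact hcorr.allocated hR p (.inr hp)

theorem CorrEnv.of_eqOn (hR : R.Lawful) (h : CorrEnv Pr R U μ V Γ r w)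
    (hμ : ∀ p ∈ r ∪ w, μ' p = μ p) : CorrEnv Pr R U μ' V Γ r w := by
  obtain ⟨rs, ws, ⟨hc, hd⟩, rfl, rfl⟩ := corrEnv_iff.1 h
  refine corrEnv_iff.2 ⟨rs, ws, ⟨fun x t hx => ?_, hd⟩, rfl, rfl⟩
  obtain ⟨u, v, hu, hv, hcorr⟩ := hc x t hx
  have hx' : Γ x ≠ none := by simp [hx]
  refine ⟨u, v, hu, hv, hcorr.of_eqOn hR fun p hp => hμ p ?_⟩
  exact hp.imp (fun hp => ⟨x, hx', hp⟩) fun hp => ⟨x, hx', hp⟩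

theorem corrEnv_empty : CorrEnv Pr R U μ V Ctx.empty ∅ ∅ :=
  ⟨fun _ => ∅, fun _ => ∅, by simp [Ctx.empty], by simp, by simp, by simp⟩

/-- Freshness of `x` for `Γ` ensures that redefining the footprint of `x` does not disturb a
variable of `Γ`. -/
theorem CorrEnv.extend (h : CorrEnv Pr R U μ V Γ r w) {x : Name} (hx : Γ x = none)
    {u : UVal P AU} {v : Val AV} {t : Ty} {r' w' : Set P} (hc : Corr Pr R μ u v t r' w')
    (hd : NonInterfering r' w' r w) :
    CorrEnv Pr R (extend x u U) μ (extend x v V) (extend x t Γ) (r' ∪ r) (w' ∪ w) := by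
  obtain ⟨rs, ws, ⟨hcs, hds⟩, rfl, rfl⟩ := corrEnv_iff.1 h
  have hne : ∀ y, Γ y ≠ none → y ≠ x := fun y hy e => hy (e ▸ hx)
  rw [nonInterfering_iff] at hd
  refine corrEnv_iff.2 ⟨Function.update rs x r', Function.update ws x w', ⟨?_, ?_⟩, ?_, ?_⟩
  · intro y s hy
    by_cases hyx : y = x
    · subst hyx
      obtain rfl : t = s := by simpa [Cogent.extend] using hy
      exact ⟨u, v, by simp [Cogent.extend], by simp [Cogent.extend], by simpa using hc⟩
    · simpa [Cogent.extend, hyx] using hcs y s (by simpa [Cogent.extend, hyx] using hy)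
  · intro y z hy hz hyz p hp
    by_cases hyx : y = x
    · have hzx : z ≠ x := fun e => hyz (hyx.trans e.symm)
      simp only [Cogent.extend, hzx, if_false] at hz
      simp only [hyx, Function.update_self] at hp
      simp only [Function.update_of_ne hzx]
      have := hd.1 p hp
      exact ⟨fun h => this.1 ⟨z, hz, h⟩, fun h => this.2 ⟨z, hz, h⟩⟩
    · simp only [Cogent.extend, hyx, if_false] at hy
      simp only [Function.update_of_ne hyx] at hp
      by_cases hzx : z = x
      · simp only [hzx, Function.update_self]
        exact hd.2 p ⟨y, hy, hp⟩
      · simp only [Cogent.extend, hzx, if_false] at hz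
        simp only [Function.update_of_ne hzx]
        exact hds y z hy hz hyz p hp
  all_goals
    ext p
    simp only [Ctx.support, Set.mem_union, Set.mem_ofPred_eq]
    constructor
    · rintro (hp | ⟨y, hy, hp⟩)
      · exact ⟨x, by simp [Cogent.extend], by simpa using hp⟩
      · exact ⟨y, by simpa [Cogent.extend, hne y hy] using hy, by simpa [hne y hy] using hp⟩
    · rintro ⟨y, hy, hp⟩
      by_cases hyx : y = x
      · exact .inl (by simpa [hyx] using hp)
      · exact .inr ⟨y, by simpa [Cogent.extend, hyx] using hy, by simpa [hyx] using hp⟩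

theorem Corr.single {x : Name} {u : UVal P AU} {v : Val AV} {t : Ty}
    (hc : Corr Pr R μ u v t r w) :
    CorrEnv Pr R (single x u) μ (single x v) (single x t) r w := by
  have := (corrEnv_empty (Pr := Pr) (R := R) (μ := μ) (U := fun _ => none)
    (V := fun _ => none)).extend (x := x) rfl hc (by simp [NonInterfering])
  simp only [Set.union_empty] at this
  exact this

-- Weakening and contraction of environments.

theorem CorrEnv.of_weakening_empty (hR : R.Lawful) (hw : Weakening [] Γ Ctx.empty)
    (h : CorrEnv Pr R U μ V Γ r w) : w = ∅ := by
  obtain ⟨rs, ws, ⟨hc, -⟩, rfl, rfl⟩ := corrEnv_iff.1 h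
  rw [Set.eq_empty_iff_forall_notMem]
  rintro p ⟨x, hx, hp⟩
  rcases hw x with hx' | ⟨-, t, ht, hk⟩
  · exact hx hx'.symm
  · obtain ⟨u, v, -, -, hcorr⟩ := hc x t ht
    rw [hcorr.no_writable hR (by decide) hk] at hp
    exact hp

/-- The dropped variables are discardable, hence without writable pointers, so the writable set of
the remaining variable is all of `w`. Equality matters: with an unchanged store, leak freedom would
fail for any writable pointer that got lost, as it is still allocated. Read-only pointers may be
dropped. -/
theorem CorrEnv.of_weakening_single (hR : R.Lawful) {x : Name} {t : Ty}
    (hw : Weakening [] Γ (single x t)) (h : CorrEnv Pr R U μ V Γ r w) :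
    ∃ u v r', U x = some u ∧ V x = some v ∧ r' ⊆ r ∧ Corr Pr R μ u v t r' w := by
  obtain ⟨rs, ws, ⟨hc, -⟩, rfl, rfl⟩ := corrEnv_iff.1 h
  have hx : Γ x = some t := by
    rcases hw x with hx | ⟨hx, -⟩ <;> simp_all [Cogent.single]
  obtain ⟨u, v, hu, hv, hcorr⟩ := hc x t hx
  refine ⟨u, v, rs x, hu, hv, fun p hp => ⟨x, by simp [hx], hp⟩, hcorr.cast rfl ?_⟩
  ext p
  refine ⟨fun hp => ⟨x, by simp [hx], hp⟩, ?_⟩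
  rintro ⟨y, hy, hp⟩
  by_cases hyx : y = x
  · exact hyx ▸ hp
  · rcases hw y with hy' | ⟨-, s, hs, hk⟩
    · simp [Cogent.single, hyx] at hy'
      exact absurd hy'.symm (by simpa [eq_comm] using hy)
    · obtain ⟨u, v, -, -, hcorr⟩ := hc y s hs
      rw [hcorr.no_writable hR (by decide) hk] at hp
      exact absurd hp (by simp)

/-- Contraction for `let!`: the first environment may read what the second one may write. -/
theorem CorrEnv.splitBang (hR : R.Lawful) {ys : List Name} (hs : SplitBang [] ys Γ Γ₁ Γ₂)
    (h : CorrEnv Pr R U μ V Γ r w) :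
    ∃ r₁ w₁ r₂ w₂, CorrEnv Pr R U μ V Γ₁ r₁ w₁ ∧ CorrEnv Pr R U μ V Γ₂ r₂ w₂ ∧
      (ys = [] → r₁ ⊆ r) ∧ r₂ ⊆ r ∧ w = w₁ ∪ w₂ ∧ (∀ p ∈ w₁, p ∉ r₂ ∧ p ∉ w₂) ∧
      (ys = [] → ∀ p ∈ w₂, p ∉ r₁) := by
  obtain ⟨rs, ws, ⟨hc, hd⟩, rfl, rfl⟩ := corrEnv_iff.1 h
  classical
  -- In the first environment an observed variable has its writable pointers turned into read-only
  -- ones, as in `Corr.bang`; all other variables keep their sets.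
  let rs' : Name → Set P := fun x => if x ∈ ys then rs x ∪ ws x else rs x
  let ws' : Name → Set P := fun x => if x ∈ ys then ∅ else ws x
  have hsub : ∀ x p, p ∈ ws' x → p ∈ ws x := by
    intro x p hp; simp only [ws'] at hp; split at hp <;> simp_all
  have hsub' : ∀ x p, p ∈ rs' x → p ∈ rs x ∨ p ∈ ws x := by
    intro x p hp; simp only [rs'] at hp; split at hp <;> simp_all
  -- A variable present on both sides without being observed was contracted, so its type is
  -- shareable.
  have hshare : ∀ x, Γ₁ x ≠ none → Γ₂ x ≠ none → x ∉ ys → ws x = ∅ := by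
    intro x h₁ h₂ hx
    rcases hs x with ⟨hx', -⟩ | ⟨-, hs⟩
    · exact absurd hx' hx
    · generalize ha : Γ x = a at *; generalize Γ₁ x = b at *; generalize Γ₂ x = c at *
      cases hs with
      | share hk =>
        obtain ⟨u, v, -, -, hcorr⟩ := hc x _ ha
        exact hcorr.no_writable hR (by decide) hk
      | _ => simp_all
  have hΓ₁ : ∀ x, Γ₁ x ≠ none → Γ x ≠ none := by
    intro x h₁
    rcases hs x with ⟨-, t, h, -⟩ | ⟨-, hs⟩
    · simp [h]
    · intro h; rw [h] at hs; generalize Γ₁ x = b at *; generalize Γ₂ x = c at *; cases hs; simp at h₁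
  have hΓ₂ : ∀ x t, Γ₂ x = some t → Γ x = some t := by
    intro x t h₂
    rcases hs x with ⟨-, s, h, -, h'⟩ | ⟨-, hs⟩
    · rw [h, ← h', h₂]
    · rw [h₂] at hs; generalize Γ x = b at *; generalize Γ₁ x = c at *; cases hs <;> rfl
  have hΓ₂' : ∀ x, Γ₂ x ≠ none → Γ x ≠ none := by
    intro x h
    obtain ⟨t, ht⟩ := Option.ne_none_iff_exists'.1 h
    simp [hΓ₂ x t ht]
  refine ⟨Γ₁.support rs', Γ₁.support ws', Γ₂.support rs, Γ₂.support ws,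
    corrEnv_iff.2 ⟨rs', ws', ⟨?_, ?_⟩, rfl, rfl⟩, corrEnv_iff.2 ⟨rs, ws, ⟨?_, ?_⟩, rfl, rfl⟩,
    ?_, ?_, ?_, ?_, ?_⟩
  · intro x t hx
    rcases hs x with ⟨hy, s, h, h', -⟩ | ⟨hy, hs⟩
    · obtain ⟨u, v, hu, hv, hcorr⟩ := hc x s h
      obtain rfl : s.bang = t := by simpa [h'] using hx
      exact ⟨u, v, hu, hv, by simpa [rs', ws', hy] using hcorr.bang hR⟩
    · have : Γ x = some t := by
        rw [hx] at hs; generalize Γ x = b at *; generalize Γ₂ x = c at *; cases hs <;> rfl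
      simpa [rs', ws', hy] using hc x t this
  · intro x y hx hy hxy p hp
    have := hd x y (hΓ₁ x hx) (hΓ₁ y hy) hxy p (hsub x p hp)
    exact ⟨fun h => (hsub' y p h).elim this.1 this.2, fun h => this.2 (hsub y p h)⟩
  · intro x t hx; exact hc x t (hΓ₂ x t hx)
  · intro x y hx hy; exact hd x y (hΓ₂' x hx) (hΓ₂' y hy)
  · rintro rfl p ⟨x, hx, hp⟩; exact ⟨x, hΓ₁ x hx, by simpa [rs'] using hp⟩
  · rintro p ⟨x, hx, hp⟩; exact ⟨x, hΓ₂' x hx, hp⟩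
  · ext p
    constructor
    · rintro ⟨x, hx, hp⟩
      rcases hs x with ⟨-, t, -, -, h₂⟩ | ⟨hy, hs⟩
      · exact .inr ⟨x, by simp [h₂], hp⟩
      · have : Γ₁ x ≠ none ∨ Γ₂ x ≠ none := by
          generalize Γ x = a at *; generalize Γ₁ x = b at *; generalize Γ₂ x = c at *
          cases hs <;> simp_all
        exact this.imp (fun h => ⟨x, h, by simpa [ws', hy] using hp⟩) fun h => ⟨x, h, hp⟩
    · rintro (⟨x, hx, hp⟩ | ⟨x, hx, hp⟩)
      · exact ⟨x, hΓ₁ x hx, hsub x p hp⟩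
      · exact ⟨x, hΓ₂' x hx, hp⟩
  · rintro p ⟨x, hx, hp⟩
    have key : ∀ y, Γ₂ y ≠ none → p ∉ rs y ∧ p ∉ ws y := by
      intro y hy
      by_cases hxy : x = y
      · subst hxy
        by_cases hx' : x ∈ ys
        · simp [ws', hx'] at hp
        · have := hsub x p hp
          rw [hshare x hx hy hx'] at this
          exact absurd this (by simp)
      · exact hd x y (hΓ₁ x hx) (hΓ₂' y hy) hxy p (hsub x p hp)
    exact ⟨fun ⟨y, hy, h⟩ => (key y hy).1 h, fun ⟨y, hy, h⟩ => (key y hy).2 h⟩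
  · rintro rfl p ⟨x, hx, hp⟩ ⟨y, hy, h⟩
    by_cases hxy : x = y
    · subst hxy
      rw [hshare x hy hx (by simp)] at hp
      exact hp
    · exact (hd x y (hΓ₂' x hx) (hΓ₁ y hy) hxy p hp).1 (by simpa [rs'] using h)

/-- Ordinary contraction is the case without observed variables. For it the conditional clauses of
`CorrEnv.splitBang` apply, which makes non-interference symmetric. -/
theorem Split.splitBang {Δ : KindCtx} (h : Split Δ Γ Γ₁ Γ₂) : SplitBang Δ [] Γ Γ₁ Γ₂ :=
  fun x => .inr ⟨by simp, h x⟩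

theorem CorrEnv.split (hR : R.Lawful) (hs : Split [] Γ Γ₁ Γ₂) (h : CorrEnv Pr R U μ V Γ r w) :
    ∃ r₁ w₁ r₂ w₂, CorrEnv Pr R U μ V Γ₁ r₁ w₁ ∧ CorrEnv Pr R U μ V Γ₂ r₂ w₂ ∧
      r₁ ⊆ r ∧ r₂ ⊆ r ∧ w = w₁ ∪ w₂ ∧ NonInterfering r₁ w₁ r₂ w₂ := by
  obtain ⟨r₁, w₁, r₂, w₂, h₁, h₂, hr₁, hr₂, hw, hd, hd'⟩ := h.splitBang hR hs.splitBang
  refine ⟨r₁, w₁, r₂, w₂, h₁, h₂, hr₁ rfl, hr₂, hw, nonInterfering_iff.2 ⟨hd, ?_⟩⟩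
  exact fun p hp => ⟨hd' rfl p hp, fun h => (hd p h).2 hp⟩

/-- An environment is unaffected by an evaluation that may write other pointers only. -/
theorem CorrEnv.frame (hR : R.Lawful) (h : CorrEnv Pr R U μ V Γ r w) {w₁ w₁' : Set P}
    (hd : ∀ p ∈ w₁, p ∉ r ∧ p ∉ w) (hf : Frame w₁ μ w₁' μ') :
    CorrEnv Pr R U μ' V Γ r w ∧ ∀ p ∈ w₁', p ∉ r ∧ p ∉ w := by
  have hn : ∀ p ∈ r ∪ w, p ∉ w₁ := fun p hp h' => hp.elim (hd p h').1 (hd p h').2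
  have ha := h.allocated hR
  refine ⟨h.of_eqOn hR fun p hp => hf.eq_of_allocated (hn p hp) (ha p hp), fun p hp => ?_⟩
  exact ⟨fun h' => hf.notMem_of_allocated (hn p (.inl h')) (ha p (.inl h')) hp,
    fun h' => hf.notMem_of_allocated (hn p (.inr h')) (ha p (.inr h')) hp⟩

/-- A value is unaffected by an evaluation that may write other pointers only. -/
theorem Corr.frame (hR : R.Lawful) {u : UVal P AU} {v : Val AV} {t : Ty}
    (h : Corr Pr R μ u v t r w) {w₁ w₁' : Set P}
    (hd : ∀ p ∈ w₁, p ∉ r ∧ p ∉ w) (hf : Frame w₁ μ w₁' μ') :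
    Corr Pr R μ' u v t r w ∧ ∀ p ∈ w₁', p ∉ r ∧ p ∉ w := by
  have hn : ∀ p ∈ r ∪ w, p ∉ w₁ := fun p hp h' => hp.elim (hd p h').1 (hd p h').2
  have ha := h.allocated hR
  refine ⟨h.of_eqOn hR fun p hp => hf.eq_of_allocated (hn p hp) (ha p hp), fun p hp => ?_⟩
  exact ⟨fun h' => hf.notMem_of_allocated (hn p (.inl h')) (ha p (.inl h')) hp,
    fun h' => hf.notMem_of_allocated (hn p (.inr h')) (ha p (.inr h')) hp⟩

end CorrEnv


/-! ### Simulation -/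

/-- A relation that is closed under the rules of the value semantics, except for the rule of
abstract functions. -/
structure EvalClosed {AV : Type uV} (Pr : Program) (E : VEnv AV → Expr → Val AV → Prop)
    (EL : VEnv AV → List Expr → List (Val AV) → Prop) : Prop where
  var : ∀ {V x v}, V x = some v → E V (.var x) v
  unit : ∀ {V}, E V .unit .unit
  lit : ∀ {V l}, E V (.lit l) (.lit l)
  fn : ∀ {V f ts ks t r x e}, Pr f = some (.concrete ks t r x e) →
    E V (.tyApp f ts) (.fn x (e.subst ts))
  absFn : ∀ {V f ts ks t r}, Pr f = some (.abstract ks t r) → E V (.tyApp f ts) (.absFn f ts)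
  cast : ∀ {V t e l}, E V e (.lit l) → E V (.cast t e) (.lit l)
  app : ∀ {V e₁ e₂ x e v v'}, E V e₁ (.fn x e) → E V e₂ v' → E (single x v') e v →
    E V (.app e₁ e₂) v
  primOp : ∀ {V o es} {ls : List ℕ} {l}, EL V es (ls.map Val.lit) → o.eval ls = some l →
    E V (.primOp o es) (.lit l)
  letIn : ∀ {V x e₁ e₂ v v'}, E V e₁ v' → E (extend x v' V) e₂ v → E V (.letIn x e₁ e₂) v
  letBang : ∀ {V ys x e₁ e₂ v v'}, E V e₁ v' → E (extend x v' V) e₂ v →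
    E V (.letBang ys x e₁ e₂) v
  iteTrue : ∀ {V e₁ e₂ e₃ v}, E V e₁ (.lit 1) → E V e₂ v → E V (.ite e₁ e₂ e₃) v
  iteFalse : ∀ {V e₁ e₂ e₃ v}, E V e₁ (.lit 0) → E V e₃ v → E V (.ite e₁ e₂ e₃) v
  con : ∀ {V C e v}, E V e v → E V (.con C e) (.con C v)
  promote : ∀ {V cs C e v}, E V e (.con C v) → E V (.promote cs e) (.con C v)
  case₁ : ∀ {V e₁ C x e₂ y e₃ v v'}, E V e₁ (.con C v') → E (extend x v' V) e₂ v →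
    E V (.caseOf e₁ C x e₂ y e₃) v
  case₂ : ∀ {V e₁ B C x e₂ y e₃ v v'}, E V e₁ (.con B v') → B ≠ C →
    E (extend y (.con B v') V) e₃ v → E V (.caseOf e₁ C x e₂ y e₃) v
  esac : ∀ {V C e v}, E V e (.con C v) → E V (.esac e) v
  struct : ∀ {V} {fes : List (Name × Expr)} {vs}, EL V (fes.map Prod.snd) vs →
    E V (.struct fes) (.record ((fes.map Prod.fst).zip vs))
  member : ∀ {V e f fs v}, E V e (.record fs) → getField f fs = some v → E V (.member e f) v
  take : ∀ {V x f y e₁ e₂ fs v v'}, E V e₁ (.record fs) → getField f fs = some v' →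
    E (extend x (.record fs) (extend y v' V)) e₂ v → E V (.take x f y e₁ e₂) v
  put : ∀ {V f e₁ e₂ fs v₀ v'}, E V e₁ (.record fs) → E V e₂ v' → getField f fs = some v₀ →
    E V (.put e₁ f e₂) (.record (setField f v' fs))
  nil : ∀ {V}, EL V [] []
  cons : ∀ {V e es v vs}, E V e v → EL V es vs → EL V (e :: es) (v :: vs)

section

variable {P : Type uP} {AU : Type uU} {AV : Type uV} {Pr : Program} {R : AbsCorr P AU AV}
  {μ μ' : Store P AU}

/-- The abstract functions preserve the correspondence for some result that the relation `E`
allows for their application. -/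
def AbsFunsSimulate (Pr : Program) (R : AbsCorr P AU AV) (semU : USem P AU)
    (E : VEnv AV → Expr → Val AV → Prop) : Prop :=
  ∀ f ks t t', Pr f = some (.abstract ks t t') →
    ∀ rs, List.Forall₂ (Kinding []) rs ks →
    ∀ u μ v r w, Corr Pr R μ u v (t.subst rs) r w →
    ∀ u' μ', semU f (u, μ) = (u', μ') →
    ∃ v' r' w', r' ⊆ r ∧ Corr Pr R μ' u' v' (t'.subst rs) r' w' ∧ Frame w μ w' μ' ∧
      ∀ V e₁ e₂, E V e₁ (.absFn f rs) → E V e₂ v → E V (.app e₁ e₂) v'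

/-- Correspondence of sequences of values that do not interfere. -/
inductive CorrList (Pr : Program) (R : AbsCorr P AU AV) (μ : Store P AU) :
    List (UVal P AU) → List (Val AV) → List Ty → Set P → Set P → Prop
  | nil : CorrList Pr R μ [] [] [] ∅ ∅
  | cons {u : UVal P AU} {v : Val AV} {t : Ty} {us : List (UVal P AU)} {vs : List (Val AV)}
      {ts : List Ty} {r w r' w' : Set P} :
      Corr Pr R μ u v t r w → CorrList Pr R μ us vs ts r' w' → NonInterfering r w r' w' →
      CorrList Pr R μ (u :: us) (v :: vs) (t :: ts) (r ∪ r') (w ∪ w')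

/-- The lengths must agree because truncation by a shorter list of names would lose the pointers of
the dropped components. For this reason `SimulatesList` also records a length. -/
theorem CorrList.zip {us : List (UVal P AU)} {vs : List (Val AV)} {ts : List Ty} {r w : Set P}
    (h : CorrList Pr R μ us vs ts r w) {ns : List Name} (hn : ns.length = us.length) :
    CorrFields Pr R μ (ns.zip us) (ns.zip vs) (ns.zip (ts.map Fld.present)) r w := by
  induction h generalizing ns with
  | nil => obtain rfl := List.length_eq_zero_iff.1 hn; exact .nil
  | cons h _ hd ih =>
    cases ns with
    | nil => simp at hn
    | cons n ns => exact .present h (ih (by simpa using hn)) hd.1 hd.2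

theorem CorrList.prims {us : List (UVal P AU)} {vs : List (Val AV)} {ts : List PrimTy}
    {r w : Set P} (h : CorrList Pr R μ us vs (ts.map Ty.prim) r w) :
    ∃ ls : List ℕ, us = ls.map UVal.lit ∧ vs = ls.map Val.lit ∧
      List.Forall₂ (fun l t => l < PrimTy.size t) ls ts ∧ w = ∅ := by
  induction ts generalizing us vs r w with
  | nil => cases h; exact ⟨[], rfl, rfl, .nil, rfl⟩
  | cons t ts ih =>
    cases h with
    | cons h hs _ =>
      obtain ⟨l, rfl, rfl, hl, rfl, rfl⟩ := h.lit_inv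
      obtain ⟨ls, rfl, rfl, hls, rfl⟩ := ih hs
      exact ⟨l :: ls, rfl, rfl, .cons hl hls, by simp⟩

/-- The value is a record with the given fields, or a pointer to one. -/
def Contents (μ : Store P AU) (u : UVal P AU) (us : List (Name × UVal P AU)) : Prop :=
  u = .record us ∨ ∃ p, u = .ptr p ∧ μ p = some (.record us)

/-- Identifies the record found through its type with the record read by the evaluation rule. -/
theorem Contents.unique {u : UVal P AU} {us us' : List (Name × UVal P AU)}
    (h : Contents μ u us) (h' : Contents μ u us') : us = us' := by
  rcases h with rfl | ⟨p, rfl, hp⟩ <;> rcases h' with h' | ⟨q, hq, hq'⟩ <;> simp_all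

theorem RecordAt.contents {u : UVal P AU} {m : Mode} {us : List (Name × UVal P AU)} {s : Set P}
    (h : RecordAt μ u m us s) : Contents μ u us := by
  cases h with
  | unboxed => exact .inl rfl
  | boxed hp => exact .inr ⟨_, rfl, hp⟩

theorem Corr.record_fields {u : UVal P AU} {v : Val AV} {fs : Fields} {m : Mode} {r w : Set P}
    (h : Corr Pr R μ u v (.record fs m) r w) :
    ∃ us vs r' w', v = .record vs ∧ Contents μ u us ∧ CorrFields Pr R μ us vs fs r' w' ∧
      r' ⊆ r ∧ w' ⊆ w := by
  cases h with
  | recU h => exact ⟨_, _, _, _, rfl, .inl rfl, h, subset_rfl, subset_rfl⟩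
  | recW hp h => exact ⟨_, _, _, _, rfl, .inr ⟨_, rfl, hp⟩, h, subset_rfl, by simp⟩
  | recR hp h => exact ⟨_, _, _, _, rfl, .inr ⟨_, rfl, hp⟩, h, by simp, subset_rfl⟩

/-- The first frame is enlarged by what the second step will own, the second by what the first step
has produced; then they are composable. -/
theorem Frame.seq {w₁ w₁' w₂ w₂' : Set P} {μ'' : Store P AU} (h₁ : Frame w₁ μ w₁' μ')
    (h₂ : Frame w₂ μ' w₂' μ'') : Frame (w₁ ∪ w₂) μ (w₁' ∪ w₂') μ'' := by
  have h := h₂.union_right w₁'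
  rw [Set.union_comm w₂, Set.union_comm w₂'] at h
  exact (h₁.union_right w₂).trans h

/-- The conclusion of preservation for an expression that evaluates to `u`. -/
def Preserves (Pr : Program) (R : AbsCorr P AU AV) (E : VEnv AV → Expr → Val AV → Prop)
    (V : VEnv AV) (e : Expr) (t : Ty) (r w : Set P) (μ : Store P AU) (u : UVal P AU)
    (μ' : Store P AU) : Prop :=
  ∃ v r' w', E V e v ∧ r' ⊆ r ∧ Corr Pr R μ' u v t r' w' ∧ Frame w μ w' μ'

/-- Preservation for an evaluation of an expression, in every typed environment. -/
def Simulates (Pr : Program) (R : AbsCorr P AU AV) (E : VEnv AV → Expr → Val AV → Prop)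
    (U : UEnv P AU) (e : Expr) (μ : Store P AU) (u : UVal P AU) (μ' : Store P AU) : Prop :=
  ∀ V Γ t r w, Typing Pr [] Γ e t → CorrEnv Pr R U μ V Γ r w → Preserves Pr R E V e t r w μ u μ'

/-- Preservation for an evaluation of a sequence of expressions. -/
def SimulatesList (Pr : Program) (R : AbsCorr P AU AV)
    (EL : VEnv AV → List Expr → List (Val AV) → Prop)
    (U : UEnv P AU) (es : List Expr) (μ : Store P AU) (us : List (UVal P AU)) (μ' : Store P AU) :
    Prop :=
  ∀ V Γ ts r w, TypingList Pr [] Γ es ts → CorrEnv Pr R U μ V Γ r w →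
    us.length = es.length ∧ ∃ vs r' w', EL V es vs ∧ r' ⊆ r ∧ CorrList Pr R μ' us vs ts r' w' ∧
      Frame w μ w' μ'

variable {E : VEnv AV → Expr → Val AV → Prop} {EL : VEnv AV → List Expr → List (Val AV) → Prop}
  {U U' : UEnv P AU} {μ₁ μ₂ : Store P AU}

/-- The first of two expressions is evaluated. -/
theorem Simulates.first (hR : R.Lawful) {e₁ : Expr} {u₁ : UVal P AU}
    (h : Simulates Pr R E U e₁ μ u₁ μ₁) {Γ Γ₁ Γ₂ : Ctx} {V : VEnv AV} {t : Ty} {r w : Set P}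
    (hs : Split [] Γ Γ₁ Γ₂) (ht : Typing Pr [] Γ₁ e₁ t) (hV : CorrEnv Pr R U μ V Γ r w) :
    ∃ v r₁ w₁ w₁' r₂ w₂, E V e₁ v ∧ Corr Pr R μ₁ u₁ v t r₁ w₁ ∧
      CorrEnv Pr R U μ₁ V Γ₂ r₂ w₂ ∧ NonInterfering r₁ w₁ r₂ w₂ ∧ r₁ ⊆ r ∧ r₂ ⊆ r ∧
      w = w₁' ∪ w₂ ∧ Frame w₁' μ w₁ μ₁ := by
  obtain ⟨r₁, w₁, r₂, w₂, h₁, h₂, hr₁, hr₂, rfl, hd⟩ := hV.split hR hs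
  obtain ⟨v, r', w', hE, hr', hc, hf⟩ := h _ _ _ _ _ ht h₁
  rw [nonInterfering_iff] at hd
  -- The rest of the environment holds allocated pointers that `e₁` may not write; the evaluation
  -- leaves them alone and does not acquire them.
  obtain ⟨h₂, hd'⟩ := h₂.frame hR hd.1 hf
  refine ⟨v, r', w', w₁, r₂, w₂, hE, hc, h₂, nonInterfering_iff.2 ⟨hd', fun p hp => ?_⟩,
    hr'.trans hr₁, hr₂, rfl, hf⟩
  exact ⟨fun h => (hd.2 p hp).1 (hr' h), fun h => (hd' p h).2 hp⟩

/-- The second of two expressions is evaluated in the remaining environment. -/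
theorem Simulates.second (hR : R.Lawful) {e₂ : Expr} {u₁ u₂ : UVal P AU}
    (h : Simulates Pr R E U e₂ μ₁ u₂ μ₂) {Γ₂ : Ctx} {V : VEnv AV} {v₁ : Val AV} {t₁ t₂ : Ty}
    {r₁ w₁ w₁' r₂ w₂ : Set P} (ht : Typing Pr [] Γ₂ e₂ t₂) (hc : Corr Pr R μ₁ u₁ v₁ t₁ r₁ w₁)
    (hV : CorrEnv Pr R U μ₁ V Γ₂ r₂ w₂) (hd : NonInterfering r₁ w₁ r₂ w₂)
    (hf : Frame w₁' μ w₁ μ₁) :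
    ∃ v₂ r₂' w₂', E V e₂ v₂ ∧ r₂' ⊆ r₂ ∧ Corr Pr R μ₂ u₁ v₁ t₁ r₁ w₁ ∧
      Corr Pr R μ₂ u₂ v₂ t₂ r₂' w₂' ∧ NonInterfering r₁ w₁ r₂' w₂' ∧
      Frame (w₁' ∪ w₂) μ (w₁ ∪ w₂') μ₂ := by
  obtain ⟨v₂, r', w', hE, hr', hc₂, hf₂⟩ := h _ _ _ _ _ ht hV
  rw [nonInterfering_iff] at hd
  -- The value already computed is protected from the second evaluation in the same way.
  obtain ⟨hc, hd'⟩ := hc.frame hR hd.2 hf₂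
  refine ⟨v₂, r', w', hE, hr', hc, hc₂, nonInterfering_iff.2 ⟨fun p hp => ?_, hd'⟩, hf.seq hf₂⟩
  exact ⟨fun h => (hd.1 p hp).1 (hr' h), fun h => (hd' p h).2 hp⟩

/-- The body of a binding is evaluated in the extended environment. -/
theorem Simulates.body {x : Name} {e₂ : Expr} {u₁ u : UVal P AU}
    (h : Simulates Pr R E (extend x u₁ U) e₂ μ₁ u μ₂) {Γ₂ : Ctx} {V : VEnv AV} {v₁ : Val AV}
    {t₁ t : Ty} {r r₁ w₁ w₁' r₂ w₂ : Set P} (hx : Γ₂ x = none)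
    (ht : Typing Pr [] (extend x t₁ Γ₂) e₂ t) (hc : Corr Pr R μ₁ u₁ v₁ t₁ r₁ w₁)
    (hV : CorrEnv Pr R U μ₁ V Γ₂ r₂ w₂) (hd : NonInterfering r₁ w₁ r₂ w₂) (hr₁ : r₁ ⊆ r)
    (hr₂ : r₂ ⊆ r) (hf : Frame w₁' μ w₁ μ₁) :
    ∃ v r' w', E (extend x v₁ V) e₂ v ∧ r' ⊆ r ∧ Corr Pr R μ₂ u v t r' w' ∧
      Frame (w₁' ∪ w₂) μ w' μ₂ := by
  obtain ⟨v, r', w', hE, hr', hc', hf'⟩ := h _ _ _ _ _ ht (hV.extend hx hc hd)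
  exact ⟨v, r', w', hE, hr'.trans (Set.union_subset hr₁ hr₂), hc', (hf.union_right w₂).trans hf'⟩

/-- The first expression may read pointers that the second may write, and its read-only set need not
lie in `r`. Both problems vanish after its evaluation: the result is escapable, so its read-only set
is empty. Its writable pointers avoid the second environment because observed variables offered
none. -/
theorem Simulates.letBang (hE : EvalClosed Pr E EL) (hR : R.Lawful) {ys : List Name} {x : Name}
    {e₁ e₂ : Expr} {u₁ u : UVal P AU} (h₁ : Simulates Pr R E U e₁ μ u₁ μ₁)
    (h₂ : Simulates Pr R E (extend x u₁ U) e₂ μ₁ u μ₂) :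
    Simulates Pr R E U (.letBang ys x e₁ e₂) μ u μ₂ := by
  intro V Γ t r w ht hV
  cases ht with
  | letBang hs hk ht₁ hx ht₂ =>
    obtain ⟨r₁, w₁, r₂, w₂, hV₁, hV₂, -, hr₂, rfl, hd, -⟩ := hV.splitBang hR hs
    obtain ⟨v₁, r', w', hE₁, -, hc, hf⟩ := h₁ _ _ _ _ _ ht₁ hV₁
    obtain rfl := hc.escape hR hk
    obtain ⟨hV₂, hd'⟩ := hV₂.frame hR hd hf
    have hd'' : NonInterfering ∅ w' r₂ w₂ :=
      nonInterfering_iff.2 ⟨hd', fun p hp => ⟨by simp, fun h => (hd' p h).2 hp⟩⟩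
    obtain ⟨v, r', w', hE₂, hr', hc', hf'⟩ :=
      h₂.body hx ht₂ hc hV₂ hd'' (Set.empty_subset r) hr₂ hf
    exact ⟨v, r', w', hE.letBang hE₁ hE₂, hr', hc', hf'⟩

/-- The field and the record are bound as two variables. In the linear rule the footprint of the
record is divided between them; in the rule for a shareable field the record keeps everything, and
the overlap consists of read-only pointers that the record itself cannot write. -/
theorem Simulates.take (hE : EvalClosed Pr E EL) (hR : R.Lawful) {x f y : Name}
    {e₁ e₂ : Expr} {fs : List (Name × UVal P AU)} {u₁ u' u : UVal P AU}
    (h₁ : Simulates Pr R E U e₁ μ u₁ μ₁) (hfs : Contents μ₁ u₁ fs)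
    (hu : getField f fs = some u')
    (h₂ : Simulates Pr R E (extend x u₁ (extend y u' U)) e₂ μ₁ u μ₂) :
    Simulates Pr R E U (.take x f y e₁ e₂) μ u μ₂ := by
  intro V Γ t r w ht hV
  cases ht with
  | take₁ hs hm ht₁ hf hx hy hxy ht₂ =>
    obtain ⟨v₁, r₁, w₁, w₁', r₂, w₂, hE₁, hc, hV₂, hd, hr₁, hr₂, rfl, hfr⟩ :=
      h₁.first hR hs ht₁ hV
    obtain ⟨us, vs, s, w', rfl, hrec, hcs, rfl, hsn⟩ := hc.record_inv hm
    obtain rfl := hrec.contents.unique hfs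
    obtain ⟨_, v', r₃, w₃, r₄, w₄, hu', hv', hc', hcs', hd', rfl, rfl⟩ := hcs.get hf
    obtain rfl := Option.some.inj (hu'.symm.trans hu)
    rw [nonInterfering_iff] at hd hd'
    have hV₃ := hV₂.extend hy hc' (nonInterfering_iff.2 (by grind))
    have hV₄ := hV₃.extend (x := x) (by simp [extend, hxy, hx])
      (hrec.corr hcs' (by grind)) (nonInterfering_iff.2 (by grind))
    obtain ⟨v, r', w', hE₂, hr', hc'', hf'⟩ := h₂ _ _ _ _ _ ht₂ hV₄
    refine ⟨v, r', w', hE.take hE₁ hv' hE₂, fun p hp => ?_, hc'', ?_⟩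
    · have := hr' hp
      have := @hr₁ p
      have := @hr₂ p
      grind
    -- The writable sets of the two new variables together make up the one of the record, so the
    -- frames meet in the same set.
    · refine (hfr.union_right w₂).trans ?_
      convert hf' using 1
      grind
  | take₂ hs hk hm hf ht₁ hx hy hxy ht₂ =>
    obtain ⟨v₁, r₁, w₁, w₁', r₂, w₂, hE₁, hc, hV₂, hd, hr₁, hr₂, rfl, hfr⟩ :=
      h₁.first hR hs ht₁ hV
    obtain ⟨us, vs, s, w', rfl, hrec, hcs, rfl, hsn⟩ := hc.record_inv hm
    obtain rfl := hrec.contents.unique hfs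
    obtain ⟨_, v', r₃, w₃, r₄, w₄, hu', hv', hc', -, hd', rfl, rfl⟩ := hcs.get hf
    obtain rfl := Option.some.inj (hu'.symm.trans hu)
    -- The shareable field has no writable pointers, so it may be held twice.
    obtain rfl := hc'.no_writable hR (by decide) hk
    rw [nonInterfering_iff] at hd hd'
    have hV₃ := hV₂.extend hy hc' (nonInterfering_iff.2 (by grind))
    have hV₄ := hV₃.extend (x := x) (by simp [extend, hxy, hx]) hc
      (nonInterfering_iff.2 (by grind))
    obtain ⟨v, r', w', hE₂, hr', hc'', hf'⟩ := h₂ _ _ _ _ _ ht₂ hV₄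
    refine ⟨v, r', w', hE.take hE₁ hv' hE₂, fun p hp => ?_, hc'', ?_⟩
    · have := hr' hp
      have := @hr₁ p
      have := @hr₂ p
      grind
    · refine (hfr.union_right w₂).trans ?_
      convert hf' using 1
      grind

/-- The hypothesis `h` abstracts what updating an unboxed record and overwriting a boxed one have in
common: the new contents are in place, the store changes at most at the pointer of the record, and
framing persists since that pointer is writable in the end. -/
theorem Simulates.put (hE : EvalClosed Pr E EL) (hR : R.Lawful) {f : Name} {e₁ e₂ : Expr}
    {u₁ u' u : UVal P AU} {μ₃ : Store P AU} (h₁ : Simulates Pr R E U e₁ μ u₁ μ₁)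
    (h₂ : Simulates Pr R E U e₂ μ₁ u' μ₂)
    (h : ∀ m us s, RecordAt μ₂ u₁ m us s → RecordAt μ₃ u m (setField f u' us) s ∧
      (∀ p, p ∉ s → μ₃ p = μ₂ p) ∧
      ∀ w w', s ⊆ w' → Frame w μ w' μ₂ → Frame w μ w' μ₃) :
    Simulates Pr R E U (.put e₁ f e₂) μ u μ₃ := by
  suffices key : ∀ V Γ Γ₁ Γ₂ fs fs' m r w t, m ≠ .readOnly → Split [] Γ Γ₁ Γ₂ →
      Typing Pr [] Γ₁ e₁ (.record fs m) → Typing Pr [] Γ₂ e₂ t →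
      getField f fs' = some (.taken t) →
      (∀ us vs r w, CorrFields Pr R μ₂ us vs fs r w →
        ∃ r', r' ⊆ r ∧ CorrFields Pr R μ₂ us vs fs' r' w) →
      CorrEnv Pr R U μ V Γ r w →
      Preserves Pr R E V (.put e₁ f e₂) (.record (setField f (.present t) fs') m) r w μ u μ₃ by
    intro V Γ t r w ht hV
    cases ht with
    | put₁ hs hm ht₁ hf ht₂ =>
      exact key _ _ _ _ _ _ _ _ _ _ hm hs ht₁ ht₂ hf (fun _ _ r _ h => ⟨r, subset_rfl, h⟩) hV
    | put₂ hs hm hf ht₁ hk ht₂ =>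
      -- Overwriting a present field is reduced to filling a taken one: the old value is
      -- discardable, so forgetting it keeps the writable set and only shrinks the read-only set.
      have := key V Γ _ _ _ _ _ r w _ hm hs ht₁ ht₂ (getField_setField hf)
        (fun us vs r w hcs => ?_) hV
      · rwa [setField_setField_self hf] at this
      · obtain ⟨_, v', r₃, w₃, r₄, w₄, -, -, hc', hcs', -, rfl, rfl⟩ := hcs.get hf
        obtain rfl := hc'.no_writable hR (by decide) hk
        exact ⟨r₄, Set.subset_union_right, hcs'.cast rfl (by simp)⟩
  intro V Γ Γ₁ Γ₂ fs fs' m r w t hm hs ht₁ ht₂ hf hfs hV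
  obtain ⟨v₁, r₁, w₁, w₁', r₂, w₂, hE₁, hc, hV₂, hd, hr₁, hr₂, rfl, hfr⟩ :=
    h₁.first hR hs ht₁ hV
  obtain ⟨v₂, r₂', w₂', hE₂, hr₂', hc, hc₂, hd', hfr'⟩ := h₂.second hR ht₂ hc hV₂ hd hfr
  obtain ⟨us, vs, s, w', rfl, hrec, hcs, rfl, hsn⟩ := hc.record_inv hm
  obtain ⟨hrec', heq, hfr''⟩ := h _ _ _ hrec
  obtain ⟨r₃, hr₃, hcs⟩ := hfs _ _ _ _ hcs
  rw [nonInterfering_iff] at hd'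
  have hr₃' := fun p => @hr₃ p
  obtain ⟨⟨v₀, hv₀⟩, hcs'⟩ := hcs.set hf hc₂ (nonInterfering_iff.2 (by grind))
  -- The pointer of the record occurs neither in the old fields nor in the new value, so overwriting
  -- it creates no cycle and leaves all fields intact.
  have hsn' : ∀ p ∈ s, p ∉ (r₂' ∪ r₃) ∪ (w₂' ∪ w') := by
    intro p hp
    have := hsn p hp
    have := hd'.1 p (.inl hp)
    have := hr₃' p
    grind
  have hcs₃ := hcs'.of_eqOn (μ' := μ₃) hR fun p hp => heq p fun h => hsn' p h hp
  refine ⟨_, _, _, hE.put hE₁ hE₂ hv₀, ?_, hrec'.corr hcs₃ hsn', ?_⟩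
  · exact Set.union_subset (hr₂'.trans hr₂) (hr₃.trans hr₁)
  · refine hfr'' _ _ Set.subset_union_left ?_
    convert hfr' using 1
    grind

/-- A shareable record has no writable pointers, so dropping its other fields leaks nothing. -/
theorem Simulates.member (hE : EvalClosed Pr E EL) (hR : R.Lawful) {f : Name} {e : Expr}
    {fs : List (Name × UVal P AU)} {u u' : UVal P AU} (h : Simulates Pr R E U e μ u μ')
    (hfs : Contents μ' u fs) (hu : getField f fs = some u') :
    Simulates Pr R E U (.member e f) μ u' μ' := by
  intro V Γ t r w ht hV
  cases ht with
  | member hk ht hf =>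
    obtain ⟨v, r', w', hE', hr', hc, hfr⟩ := h _ _ _ _ _ ht hV
    obtain rfl := hc.no_writable hR (by decide) hk
    obtain ⟨us, vs, r₁, w₁, rfl, hcont, hcs, hr₁, hw₁⟩ := hc.record_fields
    obtain rfl := hcont.unique hfs
    obtain ⟨_, v', r₃, w₃, r₄, w₄, hu', hv', hc', -, -, rfl, rfl⟩ := hcs.get hf
    obtain rfl := Option.some.inj (hu'.symm.trans hu)
    obtain rfl : w₃ = ∅ := Set.subset_empty_iff.1 (Set.subset_union_left.trans hw₁)
    exact ⟨v', r₃, ∅, hE.member hE' hv', (Set.subset_union_left.trans hr₁).trans hr', hc', hfr⟩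

/-- Evaluation in the update semantics is simulated by every relation that is closed under the
rules of the value semantics. -/
theorem UEval.simulates [DecidableEq P] {semU : USem P AU} (hPr : Pr.WellTyped)
    (hE : EvalClosed Pr E EL) (hR : R.Lawful) (hA : AbsFunsSimulate Pr R semU E) {e : Expr}
    {u : UVal P AU} (h : UEval Pr semU U e μ u μ') : Simulates Pr R E U e μ u μ' := by
  refine UEval.rec (Pr := Pr) (sem := semU)
    (motive_1 := fun U e μ u μ' _ => Simulates Pr R E U e μ u μ')
    (motive_2 := fun U es μ us μ' _ => SimulatesList Pr R EL U es μ us μ')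
    ?var ?unit ?lit ?fn ?absFn ?cast ?app ?absApp ?primOp ?letIn ?letBang ?iteTrue ?iteFalse
    ?con ?promote ?case₁ ?case₂ ?esac ?struct ?member₁ ?member₂ ?take₁ ?take₂ ?put₁ ?put₂
    ?nil ?cons h
  case var =>
    intro U μ x u hu V Γ t r w ht hV
    cases ht with
    | var hw =>
      obtain ⟨u', v, r', hu', hv, hr', hc⟩ := hV.of_weakening_single hR hw
      obtain rfl := Option.some.inj (hu'.symm.trans hu)
      exact ⟨v, r', w, hE.var hv, hr', hc, .refl _ _⟩
  case unit =>
    intro U μ V Γ t r w ht hV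
    cases ht with
    | unit hw =>
      obtain rfl := hV.of_weakening_empty hR hw
      exact ⟨_, ∅, ∅, hE.unit, by simp, .unit, .refl _ _⟩
  case lit =>
    intro U μ l V Γ t r w ht hV
    cases ht with
    | lit hw hl =>
      obtain rfl := hV.of_weakening_empty hR hw
      exact ⟨_, ∅, ∅, hE.lit, by simp, .lit hl, .refl _ _⟩
  case fn =>
    intro U μ f ts ks t r x e hf V Γ t r w ht hV
    cases ht with
    | tyApp hw hd hts =>
      obtain rfl := hV.of_weakening_empty hR hw
      obtain rfl := Option.some.inj (hf.symm.trans hd)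
      exact ⟨_, ∅, ∅, hE.fn hf, by simp, .fn (hPr.body hf hts), .refl _ _⟩
  case absFn =>
    intro U μ f ts ks t r hf V Γ t r w ht hV
    cases ht with
    | tyApp hw hd hts =>
      obtain rfl := hV.of_weakening_empty hR hw
      obtain rfl := Option.some.inj (hf.symm.trans hd)
      exact ⟨_, ∅, ∅, hE.absFn hf, by simp, .absFn hf hts, .refl _ _⟩
  case cast =>
    intro U μ μ' t e l _ ih V Γ t r w ht hV
    cases ht with
    | cast ht hsz =>
      obtain ⟨v, r', w', hE', hr', hc, hfr⟩ := ih _ _ _ _ _ ht hV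
      obtain ⟨l', hl', rfl, hlt, rfl, rfl⟩ := hc.lit_inv
      cases hl'
      exact ⟨_, ∅, ∅, hE.cast hE', hr', .lit (hlt.trans_le hsz), hfr⟩
  case app =>
    intro U μ μ₁ μ₂ μ₃ e₁ e₂ e x u u' _ _ _ ih₁ ih₂ ih₃ V Γ t r w ht hV
    cases ht with
    | app hs ht₁ ht₂ =>
      obtain ⟨v₁, r₁, w₁, w₁', r₂, w₂, hE₁, hc, hV₂, hd, hr₁, hr₂, rfl, hfr⟩ :=
        ih₁.first hR hs ht₁ hV
      obtain ⟨v₂, r₂', w₂', hE₂, hr₂', hc, hc₂, hd', hfr'⟩ := ih₂.second hR ht₂ hc hV₂ hd hfr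
      obtain ⟨rfl, ht₃, rfl, rfl⟩ := hc.fn_inv
      obtain ⟨v, r', w', hE₃, hr', hc', hfr''⟩ := ih₃ _ _ _ _ _ ht₃ hc₂.single
      -- A function value has no pointers; after both subexpressions only the writable pointers of
      -- the argument remain, and the body starts from exactly these.
      rw [Set.empty_union] at hfr'
      exact ⟨v, r', w', hE.app hE₁ hE₂ hE₃, (hr'.trans hr₂').trans hr₂, hc', hfr'.trans hfr''⟩
  case absApp =>
    intro U μ μ₁ μ₂ μ₃ e₁ e₂ f ts u u' _ _ hsem ih₁ ih₂ V Γ t r w ht hV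
    cases ht with
    | app hs ht₁ ht₂ =>
      obtain ⟨v₁, r₁, w₁, w₁', r₂, w₂, hE₁, hc, hV₂, hd, hr₁, hr₂, rfl, hfr⟩ :=
        ih₁.first hR hs ht₁ hV
      obtain ⟨v₂, r₂', w₂', hE₂, hr₂', hc, hc₂, hd', hfr'⟩ := ih₂.second hR ht₂ hc hV₂ hd hfr
      obtain ⟨rfl, ⟨ks, s, s', hf, hts, rfl, rfl⟩, rfl, rfl⟩ := hc.absFn_inv
      obtain ⟨v, r', w', hr', hc', hfr'', hE₃⟩ := hA f ks s s' hf ts hts _ _ _ _ _ hc₂ _ _ hsem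
      rw [Set.empty_union] at hfr'
      exact ⟨v, r', w', hE₃ _ _ _ hE₁ hE₂, (hr'.trans hr₂').trans hr₂, hc', hfr'.trans hfr''⟩
  case primOp =>
    intro U μ μ' o es ls l _ hl ih V Γ t r w ht hV
    cases ht with
    | primOp ht ho =>
      obtain ⟨-, vs, r', w', hE', hr', hcs, hfr⟩ := ih _ _ _ _ _ ht hV
      obtain ⟨ls', hls', rfl, hlt, rfl⟩ := hcs.prims
      obtain rfl : ls = ls' := List.map_injective_iff.2 (fun _ _ h => UVal.lit.inj h) hls'
      exact ⟨_, ∅, ∅, hE.primOp hE' hl, by simp, .lit (PrimOp.eval_lt ho hlt hl), hfr⟩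
  case letIn =>
    intro U μ μ₁ μ₂ x e₁ e₂ u u' _ _ ih₁ ih₂ V Γ t r w ht hV
    cases ht with
    | letIn hs ht₁ hx ht₂ =>
      obtain ⟨v₁, r₁, w₁, w₁', r₂, w₂, hE₁, hc, hV₂, hd, hr₁, hr₂, rfl, hfr⟩ :=
        ih₁.first hR hs ht₁ hV
      obtain ⟨v, r', w', hE₂, h⟩ := ih₂.body hx ht₂ hc hV₂ hd hr₁ hr₂ hfr
      exact ⟨v, r', w', hE.letIn hE₁ hE₂, h⟩
  case letBang => intro U μ μ₁ μ₂ ys x e₁ e₂ u u' _ _ ih₁ ih₂; exact ih₁.letBang hE hR ih₂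
  case iteTrue =>
    intro U μ μ₁ μ₂ e₁ e₂ e₃ u _ _ ih₁ ih₂ V Γ t r w ht hV
    cases ht with
    | ite hs ht₁ ht₂ ht₃ =>
      obtain ⟨v₁, r₁, w₁, w₁', r₂, w₂, hE₁, hc, hV₂, hd, hr₁, hr₂, rfl, hfr⟩ :=
        ih₁.first hR hs ht₁ hV
      obtain ⟨v, r₂', w₂', hE₂, hr₂', hc, hc₂, -, hfr'⟩ := ih₂.second hR ht₂ hc hV₂ hd hfr
      obtain ⟨l', hl', rfl, hlt, rfl, rfl⟩ := hc.lit_inv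
      cases hl'
      rw [Set.empty_union] at hfr'
      exact ⟨v, r₂', w₂', hE.iteTrue hE₁ hE₂, hr₂'.trans hr₂, hc₂, hfr'⟩
  case iteFalse =>
    intro U μ μ₁ μ₂ e₁ e₂ e₃ u _ _ ih₁ ih₂ V Γ t r w ht hV
    cases ht with
    | ite hs ht₁ ht₂ ht₃ =>
      obtain ⟨v₁, r₁, w₁, w₁', r₂, w₂, hE₁, hc, hV₂, hd, hr₁, hr₂, rfl, hfr⟩ :=
        ih₁.first hR hs ht₁ hV
      obtain ⟨v, r₂', w₂', hE₂, hr₂', hc, hc₂, -, hfr'⟩ := ih₂.second hR ht₃ hc hV₂ hd hfr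
      obtain ⟨l', hl', rfl, hlt, rfl, rfl⟩ := hc.lit_inv
      cases hl'
      rw [Set.empty_union] at hfr'
      exact ⟨v, r₂', w₂', hE.iteFalse hE₁ hE₂, hr₂'.trans hr₂, hc₂, hfr'⟩
  case con =>
    intro U μ μ' C e u _ ih V Γ t r w ht hV
    cases ht with
    | con ht =>
      obtain ⟨v, r', w', hE', hr', hc, hfr⟩ := ih _ _ _ _ _ ht hV
      exact ⟨_, r', w', hE.con hE', hr', .con hc (by simp [single]), hfr⟩
  case promote =>
    intro U μ μ' cs C e u _ ih V Γ t r w ht hV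
    cases ht with
    | promote ht hsub =>
      obtain ⟨v, r', w', hE', hr', hc, hfr⟩ := ih _ _ _ _ _ ht hV
      obtain ⟨C', u', v', t', hu, rfl, hC, hc⟩ := hc.con_inv
      cases hu
      exact ⟨_, r', w', hE.promote hE', hr', .con hc (hsub _ _ hC), hfr⟩
  case case₁ =>
    intro U μ μ₁ μ₂ e₁ e₂ e₃ C x y u u' _ _ ih₁ ih₂ V Γ t r w ht hV
    cases ht with
    | caseOf hs ht₁ hC hx ht₂ hy ht₃ =>
      obtain ⟨v₁, r₁, w₁, w₁', r₂, w₂, hE₁, hc, hV₂, hd, hr₁, hr₂, rfl, hfr⟩ :=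
        ih₁.first hR hs ht₁ hV
      obtain ⟨C', u', v', t', hu, rfl, hC', hc⟩ := hc.con_inv
      cases hu
      obtain rfl := Option.some.inj (hC'.symm.trans hC)
      obtain ⟨v, r', w', hE₂, h⟩ := ih₂.body hx ht₂ hc hV₂ hd hr₁ hr₂ hfr
      exact ⟨v, r', w', hE.case₁ hE₁ hE₂, h⟩
  case case₂ =>
    intro U μ μ₁ μ₂ e₁ e₂ e₃ B C x y u u' _ hBC _ ih₁ ih₂ V Γ t r w ht hV
    cases ht with
    | caseOf hs ht₁ hC hx ht₂ hy ht₃ =>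
      obtain ⟨v₁, r₁, w₁, w₁', r₂, w₂, hE₁, hc, hV₂, hd, hr₁, hr₂, rfl, hfr⟩ :=
        ih₁.first hR hs ht₁ hV
      obtain ⟨C', u', v', t', hu, rfl, hC', hc⟩ := hc.con_inv
      cases hu
      -- The alternative of `B` survives the removal of `C`, so the same value corresponds at the
      -- smaller variant type.
      obtain ⟨v, r', w', hE₂, h⟩ := ih₂.body hy ht₃
        (.con hc (by simpa [without, hBC] using hC')) hV₂ hd hr₁ hr₂ hfr
      exact ⟨v, r', w', hE.case₂ hE₁ hBC hE₂, h⟩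
  case esac =>
    intro U μ μ' C e u _ ih V Γ t r w ht hV
    cases ht with
    | esac ht =>
      obtain ⟨v, r', w', hE', hr', hc, hfr⟩ := ih _ _ _ _ _ ht hV
      obtain ⟨C', u', v', t', hu, rfl, hC', hc⟩ := hc.con_inv
      cases hu
      obtain ⟨-, rfl⟩ : _ ∧ t = t' := by simpa [single] using hC'
      exact ⟨_, r', w', hE.esac hE', hr', hc, hfr⟩
  case struct =>
    intro U μ μ' fes us _ ih V Γ t r w ht hV
    cases ht with
    | struct ht =>
      obtain ⟨hlen, vs, r', w', hE', hr', hcs, hfr⟩ := ih _ _ _ _ _ ht hV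
      exact ⟨_, r', w', hE.struct hE', hr', .recU (hcs.zip (by simpa using hlen.symm)), hfr⟩
  case member₁ =>
    intro U μ μ' e f fs u _ hf ih
    exact ih.member hE hR (.inl rfl) hf
  case member₂ =>
    intro U μ μ' e f p fs u _ hp hf ih
    exact ih.member hE hR (.inr ⟨p, rfl, hp⟩) hf
  case take₁ =>
    intro U μ μ₁ μ₂ x f y e₁ e₂ fs u u' _ hf _ ih₁ ih₂
    exact ih₁.take hE hR (.inl rfl) hf ih₂
  case take₂ =>
    intro U μ μ₁ μ₂ x f y e₁ e₂ p fs u u' _ hp hf _ ih₁ ih₂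
    exact ih₁.take hE hR (.inr ⟨p, rfl, hp⟩) hf ih₂
  case put₁ =>
    intro U μ μ₁ μ₂ f e₁ e₂ fs u₀ u' _ _ hf ih₁ ih₂
    refine ih₁.put hE hR ih₂ fun m us s hrec => ?_
    cases hrec
    exact ⟨.unboxed, fun _ _ => rfl, fun _ _ _ h => h⟩
  case put₂ =>
    intro U μ μ₁ μ₂ f e₁ e₂ p fs u₀ u' _ _ hp hf ih₁ ih₂
    refine ih₁.put hE hR ih₂ fun m us s hrec => ?_
    obtain rfl := hrec.contents.unique (.inr ⟨p, rfl, hp⟩)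
    cases hrec
    -- Since `s` contains the overwritten pointer, it belongs to the final writable set and
    -- `Frame.update` applies.
    refine ⟨.boxed (by simp), fun q hq => ?_, fun w w' hs h => h.update (hs rfl) _⟩
    exact Function.update_of_ne (by simpa using hq) _ _
  case nil =>
    intro U μ V Γ ts r w ht hV
    cases ht with
    | nil hw =>
      obtain rfl := hV.of_weakening_empty hR hw
      exact ⟨rfl, [], ∅, ∅, hE.nil, by simp, .nil, .refl _ _⟩
  case cons =>
    intro U μ μ₁ μ₂ e es u us _ _ ih₁ ih₂ V Γ ts r w ht hV
    cases ht with
    | cons hs ht₁ ht₂ =>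
      obtain ⟨v₁, r₁, w₁, w₁', r₂, w₂, hE₁, hc, hV₂, hd, hr₁, hr₂, rfl, hfr⟩ :=
        ih₁.first hR hs ht₁ hV
      obtain ⟨hlen, vs, r', w', hE₂, hr', hcs, hf₂⟩ := ih₂ _ _ _ _ _ ht₂ hV₂
      rw [nonInterfering_iff] at hd
      obtain ⟨hc, hd'⟩ := hc.frame hR hd.2 hf₂
      refine ⟨by simp [hlen], v₁ :: vs, r₁ ∪ r', w₁ ∪ w', hE.cons hE₁ hE₂,
        Set.union_subset hr₁ (hr'.trans hr₂),
        .cons hc hcs (nonInterfering_iff.2 ⟨fun p hp => ?_, hd'⟩), hfr.seq hf₂⟩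
      exact ⟨fun h => (hd.1 p hp).1 (hr' h), fun h => (hd' p h).2 hp⟩

end


/-! ### Determinism of the value semantics -/

/-- The relation says that `v` is the only possible result, without claiming that there is one. It
is closed because the rules are syntax-directed and, where several apply to an expression, the
unique value of the first subexpression selects one of them. -/
theorem evalClosed_unique {AV : Type uV} (Pr : Program) (semV : VSem AV) :
    EvalClosed Pr (fun V e v => ∀ v', VEval Pr semV V e v' → v' = v)
      (fun V es vs => ∀ vs', VEvalList Pr semV V es vs' → vs' = vs) where
  var hv v' h := by cases h; simp_all
  unit v' h := by cases h; rfl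
  lit v' h := by cases h; rfl
  fn hf v' h := by cases h <;> simp_all
  absFn hf v' h := by cases h <;> simp_all
  cast ih v' h := by cases h with | cast h => exact ih _ h
  app ih₁ ih₂ ih₃ v' h := by
    cases h with
    | app h₁ h₂ h₃ =>
      cases ih₁ _ h₁
      obtain rfl := ih₂ _ h₂
      exact ih₃ _ h₃
    | absApp h₁ => cases ih₁ _ h₁
  primOp ih ho v' h := by
    cases h with
    | primOp h ho' =>
      obtain rfl := List.map_injective_iff.2 (fun _ _ h => Val.lit.inj h) (ih _ h)
      simp_all
  letIn ih₁ ih₂ v' h := by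
    cases h with | letIn h₁ h₂ => obtain rfl := ih₁ _ h₁; exact ih₂ _ h₂
  letBang ih₁ ih₂ v' h := by
    cases h with | letBang h₁ h₂ => obtain rfl := ih₁ _ h₁; exact ih₂ _ h₂
  iteTrue ih₁ ih₂ v' h := by
    cases h with
    | iteTrue h₁ h₂ => exact ih₂ _ h₂
    | iteFalse h₁ h₂ => cases ih₁ _ h₁
  iteFalse ih₁ ih₂ v' h := by
    cases h with
    | iteTrue h₁ h₂ => cases ih₁ _ h₁
    | iteFalse h₁ h₂ => exact ih₂ _ h₂
  con ih v' h := by cases h with | con h => rw [ih _ h]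
  promote ih v' h := by cases h with | promote h => exact ih _ h
  case₁ ih₁ ih₂ v' h := by
    cases h with
    | case₁ h₁ h₂ => cases ih₁ _ h₁; exact ih₂ _ h₂
    | case₂ h₁ hBC h₂ => cases ih₁ _ h₁; exact absurd rfl hBC
  case₂ ih₁ hBC ih₂ v' h := by
    cases h with
    | case₁ h₁ h₂ => cases ih₁ _ h₁; exact absurd rfl hBC
    | case₂ h₁ _ h₂ => cases ih₁ _ h₁; exact ih₂ _ h₂
  esac ih v' h := by cases h with | esac h => cases ih _ h; rfl
  struct ih v' h := by cases h with | struct h => rw [ih _ h]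
  member ih hf v' h := by cases h with | member h hf' => cases ih _ h; simp_all
  take ih₁ hf ih₂ v' h := by
    cases h with
    | take h₁ hf' h₂ =>
      cases ih₁ _ h₁
      obtain rfl := Option.some.inj (hf'.symm.trans hf)
      exact ih₂ _ h₂
  put ih₁ ih₂ hf v' h := by
    cases h with | put h₁ h₂ hf' => cases ih₁ _ h₁; rw [ih₂ _ h₂]
  nil vs' h := by cases h; rfl
  cons ih₁ ih₂ vs' h := by cases h with | cons h₁ h₂ => rw [ih₁ _ h₁, ih₂ _ h₂]

theorem AbsFunsCorr.simulate {P : Type uP} {AU : Type uU} {AV : Type uV} {Pr : Program}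
    {R : AbsCorr P AU AV} {semU : USem P AU} {semV : VSem AV}
    (h : AbsFunsCorr Pr R semU semV) :
    AbsFunsSimulate Pr R semU fun V e v => ∀ v', VEval Pr semV V e v' → v' = v := by
  intro f ks t t' hf rs hrs u μ v r w hc u' μ' hsem
  -- The result of the value semantics is `semV f v`, supplied by `rfl`.
  obtain ⟨r', w', hr', hc', hfr⟩ := h f ks t t' hf rs hrs u μ v r w hc _ u' μ' rfl hsem
  refine ⟨_, r', w', hr', hc', hfr, fun V e₁ e₂ ih₁ ih₂ v' hv => ?_⟩
  cases hv with
  | app h₁ => cases ih₁ _ h₁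
  | absApp h₁ h₂ hs => cases ih₁ _ h₁; rw [← hs, ih₂ _ h₂]

/-! ### Erasure of the value semantics -/

section UTyping

variable {P : Type uP} {AU : Type uU} {Pr : Program} {R : AbsUTy P AU} {μ : Store P AU}

/-- The correspondence with a trivial abstract value. -/
def AbsUTy.toCorr (R : AbsUTy P AU) : AbsCorr P AU Unit := fun a μ _ => R a μ

theorem AbsUTy.Lawful.toCorr (hR : R.Lawful) : R.toCorr.Lawful where
  allocated a μ _ := hR.allocated a μ
  local_store a μ _ := hR.local_store a μ
  bang a μ _ := hR.bang a μ
  discard a μ _ := hR.discard a μ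
  share a μ _ := hR.share a μ
  escape a μ _ := hR.escape a μ

/-- A value can be read off the typing derivation: it copies the update value, with records in place
of pointers and the unit element for abstract values. Together with `Corr.uTyping` this identifies
update typing with correspondence to some value. -/
theorem UTyping.exists_corr {u : UVal P AU} {t : Ty} {r w : Set P} (h : UTyping Pr R μ u t r w) :
    ∃ v, Corr Pr R.toCorr μ u v t r w := by
  refine UTyping.rec (Pr := Pr) (R := R) (μ := μ)
    (motive_1 := fun u t r w _ => ∃ v, Corr Pr R.toCorr μ u v t r w)
    (motive_2 := fun us fs r w _ => ∃ vs, CorrFields Pr R.toCorr μ us vs fs r w)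
    ?lit ?unit ?con ?fn ?absFn ?recU ?absU ?recW ?absW ?recR ?absR ?nil ?present ?taken h
  case lit => intro _ _ h; exact ⟨_, .lit h⟩
  case unit => exact ⟨_, .unit⟩
  case con => rintro _ _ _ _ _ _ _ hC ⟨v, ih⟩; exact ⟨_, .con ih hC⟩
  case fn => intro _ _ _ _ h; exact ⟨_, .fn h⟩
  case absFn => intro _ _ _ _ _ h h'; exact ⟨_, .absFn h h'⟩
  case recU => rintro _ _ _ _ _ ⟨vs, ih⟩; exact ⟨_, .recU ih⟩
  case absU => intro _ _ _ _ _ h; exact ⟨_, .absU (b := .unit) h⟩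
  case recW => rintro _ _ _ _ _ hp _ hn ⟨vs, ih⟩; exact ⟨_, .recW hp ih hn⟩
  case absW => intro _ _ _ _ _ _ hp h hn; exact ⟨_, .absW (b := .unit) hp h hn⟩
  case recR => rintro _ _ _ _ hp _ ⟨vs, ih⟩; exact ⟨_, .recR hp ih⟩
  case absR => intro _ _ _ _ _ hp h; exact ⟨_, .absR (b := .unit) hp h⟩
  case nil => exact ⟨_, .nil⟩
  case present =>
    rintro _ _ _ _ _ _ _ _ _ _ _ h₁ h₂ ⟨v, ih₁⟩ ⟨vs, ih₂⟩
    exact ⟨_, .present ih₁ ih₂ h₁ h₂⟩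
  -- Nothing is required of a taken field, so any value serves.
  case taken => rintro _ _ _ _ _ _ _ _ ⟨vs, ih⟩; exact ⟨_, .taken (v := .unit) ih⟩

theorem Corr.uTyping {u : UVal P AU} {v : Val Unit} {t : Ty} {r w : Set P}
    (h : Corr Pr R.toCorr μ u v t r w) : UTyping Pr R μ u t r w := by
  refine Corr.rec (Pr := Pr) (R := R.toCorr) (μ := μ)
    (motive_1 := fun u _ t r w _ => UTyping Pr R μ u t r w)
    (motive_2 := fun us _ fs r w _ => UTypingFields Pr R μ us fs r w)
    ?lit ?unit ?con ?fn ?absFn ?recU ?absU ?recW ?absW ?recR ?absR ?nil ?present ?taken h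
  case lit => intro _ _ h; exact .lit h
  case unit => exact .unit
  case con => intro _ _ _ _ _ _ _ _ hC ih; exact .con ih hC
  case fn => intro _ _ _ _ h; exact .fn h
  case absFn => intro _ _ _ _ _ h h'; exact .absFn h h'
  case recU => intro _ _ _ _ _ _ ih; exact .recU ih
  case absU => intro _ _ _ _ _ _ h; exact .absU h
  case recW => intro _ _ _ _ _ _ hp _ hn ih; exact .recW hp ih hn
  case absW => intro _ _ _ _ _ _ _ hp h hn; exact .absW hp h hn
  case recR => intro _ _ _ _ _ hp _ ih; exact .recR hp ih
  case absR => intro _ _ _ _ _ _ hp h; exact .absR hp h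
  case nil => exact .nil
  case present => intro _ _ _ _ _ _ _ _ _ _ _ _ _ h₁ h₂ ih₁ ih₂; exact .present ih₁ ih₂ h₁ h₂
  case taken => intro _ _ _ _ _ _ _ _ _ _ ih; exact .taken ih

theorem UTypingEnv.exists_corrEnv {U : UEnv P AU} {Γ : Ctx} {r w : Set P}
    (h : UTypingEnv Pr R U μ Γ r w) : ∃ V, CorrEnv Pr R.toCorr U μ V Γ r w := by
  obtain ⟨rs, ws, hc, h⟩ := h
  -- The value is chosen before the type is given, so that variables outside `Γ` can receive a
  -- default and the choice is total.
  have : ∀ x, ∃ v, ∀ t, Γ x = some t →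
      ∃ u, U x = some u ∧ Corr Pr R.toCorr μ u v t (rs x) (ws x) := by
    intro x
    cases hx : Γ x with
    | none => exact ⟨.unit, by simp⟩
    | some t =>
      obtain ⟨u, hu, ht⟩ := hc x t hx
      obtain ⟨v, hv⟩ := ht.exists_corr
      refine ⟨v, fun s hs => ?_⟩
      cases hs
      exact ⟨u, hu, hv⟩
  choose V hV using this
  refine ⟨fun x => some (V x), rs, ws, fun x t hx => ?_, h⟩
  obtain ⟨u, hu, hv⟩ := hV x t hx
  exact ⟨u, V x, hu, rfl, hv⟩

/-- Here the existential choice of the result value in `AbsFunsSimulate` matters: no meaning in the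
value semantics is available, and the witness comes from `UTyping.exists_corr`. -/
theorem AbsFunsUTyped.simulate {semU : USem P AU} (h : AbsFunsUTyped Pr R semU) :
    AbsFunsSimulate Pr R.toCorr semU fun _ _ _ => True := by
  intro f ks t t' hf rs hrs u μ v r w hc u' μ' hsem
  obtain ⟨r', w', hr', ht, hfr⟩ := h f ks t t' hf rs hrs u μ r w hc.uTyping u' μ' hsem
  obtain ⟨v', hv'⟩ := ht.exists_corr
  exact ⟨v', r', w', hr', hv', hfr, fun _ _ _ _ _ => trivial⟩

theorem evalClosed_true {AV : Type uV} (Pr : Program) :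
    EvalClosed (AV := AV) Pr (fun _ _ _ => True) (fun _ _ _ => True) := by
  constructor <;> intros <;> trivial

end UTyping

/-! ### Type preservation for the value semantics -/

section VTyping

variable {AV : Type uV} {Pr : Program} {R : AbsVTy AV}

theorem VTyping.bang (hR : R.Lawful) {v : Val AV} {t : Ty} (h : VTyping Pr R v t) :
    VTyping Pr R v t.bang := by
  refine VTyping.rec (Pr := Pr) (R := R)
    (motive_1 := fun v t _ => VTyping Pr R v t.bang)
    (motive_2 := fun vs fs _ => VTypingFields Pr R vs (Ty.bangFields fs))
    ?lit ?unit ?con ?fn ?absFn ?record ?abs ?nil ?present ?taken h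
  case lit => intro _ _ h; exact .lit h
  case unit => exact .unit
  case con => intro _ _ _ _ _ hC ih; exact .con ih (Ty.bangOpt_eq_some.2 ⟨_, hC, rfl⟩)
  case fn => intro _ _ _ _ h; exact .fn h
  case absFn => intro _ _ _ _ _ h h'; exact .absFn h h'
  case record => intro _ _ _ _ ih; exact .record ih
  case abs =>
    intro _ _ _ _ h
    have := hR _ _ _ _ h
    rw [← Ty.bangList_eq_map] at this
    exact .abs this
  case nil => exact .nil
  case present => intro _ _ _ _ _ _ _ ih₁ ih₂; exact .present ih₁ ih₂
  case taken => intro _ _ _ _ _ _ ih; exact .taken ih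

theorem VTyping.absFn_inv {f : Name} {rs : List Ty} {t t' : Ty}
    (h : VTyping (AV := AV) Pr R (.absFn f rs) (.fn t t')) :
    ∃ ks s s', Pr f = some (.abstract ks s s') ∧
      List.Forall₂ (Kinding []) rs ks ∧ t = s.subst rs ∧ t' = s'.subst rs := by
  generalize hT : Ty.fn t t' = T at h
  cases h with
  | absFn hf hrs =>
    rw [Ty.subst, Ty.fn.injEq] at hT
    exact ⟨_, _, _, hf, hrs, hT.1, hT.2⟩

theorem VTypingFields.get {vs : List (Name × Val AV)} {fs : Fields} {f : Name} {t : Ty}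
    (h : VTypingFields Pr R vs fs) (hf : getField f fs = some (.present t)) :
    ∃ v, getField f vs = some v ∧ VTyping Pr R v t ∧
      VTypingFields Pr R vs (setField f (.taken t) fs) := by
  induction fs generalizing vs with
  | nil => simp [getField] at hf
  | cons a fs ih =>
    cases h with
    | @present g v t' vs _ h hs =>
      by_cases hg : g = f
      · obtain rfl : t' = t := by simpa [getField, hg] using hf
        exact ⟨v, by simp [getField, hg], h, by simpa [setField, hg] using hs.taken⟩
      · obtain ⟨v', hv, hc, hcs⟩ := ih hs (by simpa [getField, hg] using hf)
        exact ⟨v', by simpa [getField, hg] using hv, hc,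
          by simpa [setField, hg] using hcs.present h⟩
    | @taken g v t' vs _ hs =>
      by_cases hg : g = f
      · simp [getField, hg] at hf
      · obtain ⟨v', hv, hc, hcs⟩ := ih hs (by simpa [getField, hg] using hf)
        exact ⟨v', by simpa [getField, hg] using hv, hc,
          by simpa [setField, hg] using hcs.taken⟩

theorem VTypingFields.set {vs : List (Name × Val AV)} {fs : Fields} {f : Name} {t : Ty}
    {v : Val AV} (h : VTypingFields Pr R vs fs) (hf : getField f fs = some (.taken t))
    (hv : VTyping Pr R v t) :
    VTypingFields Pr R (setField f v vs) (setField f (.present t) fs) := by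
  induction fs generalizing vs with
  | nil => simp [getField] at hf
  | cons a fs ih =>
    cases h with
    | @present g v t' vs _ h hs =>
      by_cases hg : g = f
      · simp [getField, hg] at hf
      · simpa [setField, hg] using (ih hs (by simpa [getField, hg] using hf)).present h
    | @taken g v t' vs _ hs =>
      by_cases hg : g = f
      · obtain rfl : t' = t := by simpa [getField, hg] using hf
        simpa [setField, hg] using hs.present hv
      · simpa [setField, hg] using (ih hs (by simpa [getField, hg] using hf)).taken

theorem VTypingEnv.extend {V : VEnv AV} {Γ : Ctx} (h : VTypingEnv Pr R V Γ) (x : Name)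
    {v : Val AV} {t : Ty} (hv : VTyping Pr R v t) :
    VTypingEnv Pr R (extend x v V) (extend x t Γ) := by
  intro y s hy
  by_cases hyx : y = x
  · obtain rfl : t = s := by simpa [Cogent.extend, hyx] using hy
    exact ⟨v, by simp [Cogent.extend, hyx], hv⟩
  · simpa [Cogent.extend, hyx] using h y s (by simpa [Cogent.extend, hyx] using hy)

theorem VTyping.single (x : Name) {v : Val AV} {t : Ty} (hv : VTyping Pr R v t) :
    VTypingEnv Pr R (single x v) (single x t) :=
  VTypingEnv.extend (V := fun _ => none) (Γ := fun _ => none) (by simp [VTypingEnv]) x hv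

/-- Without footprints, contraction needs no kinding: a value may be duplicated freely, and an
observed one retypes by `VTyping.bang`. -/
theorem VTypingEnv.splitBang (hR : R.Lawful) {ys : List Name} {V : VEnv AV} {Γ Γ₁ Γ₂ : Ctx}
    (hs : SplitBang [] ys Γ Γ₁ Γ₂) (h : VTypingEnv Pr R V Γ) :
    VTypingEnv Pr R V Γ₁ ∧ VTypingEnv Pr R V Γ₂ := by
  refine ⟨fun x t hx => ?_, fun x t hx => ?_⟩ <;>
    rcases hs x with ⟨-, s, h₀, h₁, h₂⟩ | ⟨-, hs⟩
  · obtain ⟨v, hv, hvt⟩ := h x s h₀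
    obtain rfl := Option.some.inj (h₁.symm.trans hx)
    exact ⟨v, hv, hvt.bang hR⟩
  · rw [hx] at hs
    generalize hΓ : Γ x = a at hs
    generalize Γ₂ x = b at hs
    cases hs <;> exact h x t hΓ
  · obtain rfl := Option.some.inj (h₂.symm.trans hx)
    exact h x s h₀
  · rw [hx] at hs
    generalize hΓ : Γ x = a at hs
    generalize Γ₁ x = b at hs
    cases hs <;> exact h x t hΓ

theorem VTypingEnv.split (hR : R.Lawful) {V : VEnv AV} {Γ Γ₁ Γ₂ : Ctx}
    (hs : Split [] Γ Γ₁ Γ₂) (h : VTypingEnv Pr R V Γ) :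
    VTypingEnv Pr R V Γ₁ ∧ VTypingEnv Pr R V Γ₂ :=
  h.splitBang hR hs.splitBang

theorem VTypingFields.zip {vs : List (Val AV)} {ts : List Ty}
    (h : List.Forall₂ (VTyping Pr R) vs ts) {ns : List Name} :
    VTypingFields Pr R (ns.zip vs) (ns.zip (ts.map Fld.present)) := by
  induction h generalizing ns with
  | nil => simpa using .nil
  | cons h _ ih =>
    cases ns with
    | nil => exact .nil
    | cons n ns => exact .present h ih

theorem VTyping.forall₂_lit {ls : List ℕ} {ts : List PrimTy}
    (h : List.Forall₂ (VTyping (AV := AV) Pr R) (ls.map Val.lit) (ts.map Ty.prim)) :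
    List.Forall₂ (fun l t => l < PrimTy.size t) ls ts := by
  rw [List.forall₂_map_left_iff, List.forall₂_map_right_iff] at h
  exact h.imp fun l t h => by cases h; assumption

/-- Evaluation in the value semantics preserves types. -/
theorem VEval.preserves {semV : VSem AV} (hPr : Pr.WellTyped) (hR : R.Lawful)
    (hA : AbsFunsVTyped Pr R semV) {V : VEnv AV} {e : Expr} {v : Val AV}
    (h : VEval Pr semV V e v) :
    ∀ Γ t, Typing Pr [] Γ e t → VTypingEnv Pr R V Γ → VTyping Pr R v t := by
  refine VEval.rec (Pr := Pr) (sem := semV)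
    (motive_1 := fun V e v _ =>
      ∀ Γ t, Typing Pr [] Γ e t → VTypingEnv Pr R V Γ → VTyping Pr R v t)
    (motive_2 := fun V es vs _ =>
      ∀ Γ ts, TypingList Pr [] Γ es ts → VTypingEnv Pr R V Γ →
        List.Forall₂ (VTyping Pr R) vs ts)
    ?var ?unit ?lit ?fn ?absFn ?cast ?app ?absApp ?primOp ?letIn ?letBang ?iteTrue ?iteFalse
    ?con ?promote ?case₁ ?case₂ ?esac ?struct ?member ?take ?put ?nil ?cons h
  case var =>
    intro V x v hx Γ t ht hV
    cases ht with
    | var hw =>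
      have hΓ : Γ x = some t := by
        rcases hw x with h | ⟨h, -⟩ <;> simp_all [Cogent.single]
      obtain ⟨v', hv', hvt⟩ := hV x t hΓ
      obtain rfl := Option.some.inj (hv'.symm.trans hx)
      exact hvt
  case unit => intro V Γ t ht _; cases ht; exact .unit
  case lit => intro V l Γ t ht _; cases ht with | lit _ hl => exact .lit hl
  case fn =>
    intro V f ts ks t r x e hf Γ t ht _
    cases ht with
    | tyApp _ hd hts =>
      obtain rfl := Option.some.inj (hf.symm.trans hd)
      exact .fn (hPr.body hf hts)
  case absFn =>
    intro V f ts ks t r hf Γ t ht _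
    cases ht with
    | tyApp _ hd hts =>
      obtain rfl := Option.some.inj (hf.symm.trans hd)
      exact .absFn hf hts
  case cast =>
    intro V t e l _ ih Γ t ht hV
    cases ht with
    | cast ht hsz =>
      cases ih _ _ ht hV with
      | lit hl => exact .lit (hl.trans_le hsz)
  case app =>
    intro V e₁ e₂ e x v v' _ _ _ ih₁ ih₂ ih₃ Γ t ht hV
    cases ht with
    | app hs ht₁ ht₂ =>
      obtain ⟨hV₁, hV₂⟩ := hV.split hR hs
      cases ih₁ _ _ ht₁ hV₁ with
      | fn ht₃ => exact ih₃ _ _ ht₃ ((ih₂ _ _ ht₂ hV₂).single x)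
  case absApp =>
    intro V e₁ e₂ f ts v v' _ _ hsem ih₁ ih₂ Γ t ht hV
    cases ht with
    | app hs ht₁ ht₂ =>
      obtain ⟨hV₁, hV₂⟩ := hV.split hR hs
      obtain ⟨ks, s, s', hf, hts, rfl, rfl⟩ := (ih₁ _ _ ht₁ hV₁).absFn_inv
      exact hA f ks s s' hf ts hts _ (ih₂ _ _ ht₂ hV₂) _ hsem
  case primOp =>
    intro V o es ls l _ hl ih Γ t ht hV
    cases ht with
    | primOp ht ho =>
      exact .lit (PrimOp.eval_lt ho (VTyping.forall₂_lit (ih _ _ ht hV)) hl)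
  case letIn =>
    intro V x e₁ e₂ v v' _ _ ih₁ ih₂ Γ t ht hV
    cases ht with
    | letIn hs ht₁ hx ht₂ =>
      obtain ⟨hV₁, hV₂⟩ := hV.split hR hs
      exact ih₂ _ _ ht₂ (hV₂.extend x (ih₁ _ _ ht₁ hV₁))
  case letBang =>
    intro V ys x e₁ e₂ v v' _ _ ih₁ ih₂ Γ t ht hV
    cases ht with
    | letBang hs _ ht₁ hx ht₂ =>
      obtain ⟨hV₁, hV₂⟩ := hV.splitBang hR hs
      exact ih₂ _ _ ht₂ (hV₂.extend x (ih₁ _ _ ht₁ hV₁))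
  case iteTrue =>
    intro V e₁ e₂ e₃ v _ _ _ ih₂ Γ t ht hV
    cases ht with
    | ite hs _ ht₂ _ => exact ih₂ _ _ ht₂ (hV.split hR hs).2
  case iteFalse =>
    intro V e₁ e₂ e₃ v _ _ _ ih₂ Γ t ht hV
    cases ht with
    | ite hs _ _ ht₃ => exact ih₂ _ _ ht₃ (hV.split hR hs).2
  case con =>
    intro V C e v _ ih Γ t ht hV
    cases ht with
    | con ht => exact .con (ih _ _ ht hV) (by simp [Cogent.single])
  case promote =>
    intro V cs C e v _ ih Γ t ht hV
    cases ht with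
    | promote ht hsub =>
      cases ih _ _ ht hV with
      | con hv hC => exact .con hv (hsub _ _ hC)
  case case₁ =>
    intro V e₁ e₂ e₃ C x y v v' _ _ ih₁ ih₂ Γ t ht hV
    cases ht with
    | caseOf hs ht₁ hC hx ht₂ hy ht₃ =>
      obtain ⟨hV₁, hV₂⟩ := hV.split hR hs
      cases ih₁ _ _ ht₁ hV₁ with
      | con hv hC' =>
        obtain rfl := Option.some.inj (hC'.symm.trans hC)
        exact ih₂ _ _ ht₂ (hV₂.extend x hv)
  case case₂ =>
    intro V e₁ e₂ e₃ B C x y v v' _ hBC _ ih₁ ih₂ Γ t ht hV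
    cases ht with
    | caseOf hs ht₁ hC hx ht₂ hy ht₃ =>
      obtain ⟨hV₁, hV₂⟩ := hV.split hR hs
      cases ih₁ _ _ ht₁ hV₁ with
      | con hv hC' =>
        exact ih₂ _ _ ht₃ (hV₂.extend y (.con hv (by simpa [without, hBC] using hC')))
  case esac =>
    intro V C e v _ ih Γ t ht hV
    cases ht with
    | esac ht =>
      cases ih _ _ ht hV with
      | @con _ _ t' _ hv hC =>
        obtain ⟨-, rfl⟩ : _ ∧ t = t' := by simpa [Cogent.single] using hC
        exact hv
  case struct =>
    intro V fes vs _ ih Γ t ht hV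
    cases ht with
    | struct ht => exact .record (VTypingFields.zip (ih _ _ ht hV))
  case member =>
    intro V e f fs v _ hf ih Γ t ht hV
    cases ht with
    | member _ ht hf' =>
      cases ih _ _ ht hV with
      | record hfs =>
        obtain ⟨v', hv', hvt, -⟩ := hfs.get hf'
        obtain rfl := Option.some.inj (hv'.symm.trans hf)
        exact hvt
  case take =>
    intro V x f y e₁ e₂ fs v v' _ hf _ ih₁ ih₂ Γ t ht hV
    cases ht with
    | take₁ hs hm ht₁ hf' hx hy hxy ht₂ =>
      obtain ⟨hV₁, hV₂⟩ := hV.split hR hs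
      cases ih₁ _ _ ht₁ hV₁ with
      | record hfs =>
        obtain ⟨_, hv', hvt, hfs'⟩ := hfs.get hf'
        obtain rfl := Option.some.inj (hv'.symm.trans hf)
        exact ih₂ _ _ ht₂ ((hV₂.extend y hvt).extend x (.record hfs'))
    | take₂ hs hk hm hf' ht₁ hx hy hxy ht₂ =>
      obtain ⟨hV₁, hV₂⟩ := hV.split hR hs
      cases ih₁ _ _ ht₁ hV₁ with
      | record hfs =>
        obtain ⟨_, hv', hvt, -⟩ := hfs.get hf'
        obtain rfl := Option.some.inj (hv'.symm.trans hf)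
        exact ih₂ _ _ ht₂ ((hV₂.extend y hvt).extend x (.record hfs))
  case put =>
    intro V f e₁ e₂ fs v₀ v' _ _ _ ih₁ ih₂ Γ t ht hV
    cases ht with
    | put₁ hs hm ht₁ hf ht₂ =>
      obtain ⟨hV₁, hV₂⟩ := hV.split hR hs
      cases ih₁ _ _ ht₁ hV₁ with
      | record hfs => exact .record (hfs.set hf (ih₂ _ _ ht₂ hV₂))
    | put₂ hs hm hf ht₁ hk ht₂ =>
      obtain ⟨hV₁, hV₂⟩ := hV.split hR hs
      cases ih₁ _ _ ht₁ hV₁ with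
      | record hfs =>
        -- As in `Simulates.put`, the present field is first regarded as taken.
        obtain ⟨-, -, -, hfs'⟩ := hfs.get hf
        have := hfs'.set (getField_setField hf) (ih₂ _ _ ht₂ hV₂)
        rw [setField_setField_self hf] at this
        exact .record this
  case nil => intro V Γ ts ht _; cases ht; exact .nil
  case cons =>
    intro V e es v vs _ _ ih₁ ih₂ Γ ts ht hV
    cases ht with
    | cons hs ht₁ ht₂ =>
      obtain ⟨hV₁, hV₂⟩ := hV.split hR hs
      exact .cons (ih₁ _ _ ht₁ hV₁) (ih₂ _ _ ht₂ hV₂)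

end VTyping

end Cogent

open Cogent
theorem theorem1 {P : Type uP} {AU : Type uU} {AV : Type uV} [DecidableEq P]
    (Pr : Program) (hPr : Pr.WellTyped) (semU : USem P AU) (semV : VSem AV)
    (Γ : Ctx) (e : Expr) (t : Ty) (he : Typing Pr [] Γ e t) :
    -- preservation of types and correspondence
    (∀ R : AbsCorr P AU AV, R.Lawful → AbsFunsCorr Pr R semU semV →
      ∀ (U : UEnv P AU) (V : VEnv AV) (μ μ' : Store P AU) (r w : Set P)
        (u : UVal P AU) (v : Val AV),
      CorrEnv Pr R U μ V Γ r w → VEval Pr semV V e v → UEval Pr semU U e μ u μ' →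
      ∃ r' w' : Set P, r' ⊆ r ∧ Corr Pr R μ' u v t r' w' ∧ Frame w μ w' μ') ∧
    -- the update semantics erased: type preservation for the value semantics
    (∀ R : AbsVTy AV, R.Lawful → AbsFunsVTyped Pr R semV →
      ∀ (V : VEnv AV) (v : Val AV),
      VTypingEnv Pr R V Γ → VEval Pr semV V e v → VTyping Pr R v t) ∧
    -- the value semantics erased: type preservation for the update semantics
    (∀ R : AbsUTy P AU, R.Lawful → AbsFunsUTyped Pr R semU →
      ∀ (U : UEnv P AU) (μ μ' : Store P AU) (r w : Set P) (u : UVal P AU),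
      UTypingEnv Pr R U μ Γ r w → UEval Pr semU U e μ u μ' →
      ∃ r' w' : Set P, r' ⊆ r ∧ UTyping Pr R μ' u t r' w' ∧ Frame w μ w' μ') := by

  refine ⟨fun R hR hA U V μ μ' r w u v hV hv hu => ?_, fun R hR hA V v hV hv =>
    hv.preserves hPr hR hA _ _ he hV, fun R hR hA U μ μ' r w u hU hu => ?_⟩
  · obtain ⟨v', r', w', hE, hr', hc, hf⟩ :=
      hu.simulates hPr (evalClosed_unique Pr semV) hR hA.simulate _ _ _ _ _ he hV
    -- The simulated value is the only possible result, hence the one given.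
    obtain rfl := hE v hv
    exact ⟨r', w', hr', hc, hf⟩
  · obtain ⟨V, hV⟩ := hU.exists_corrEnv
    obtain ⟨v', r', w', -, hr', hc, hf⟩ :=
      hu.simulates hPr (evalClosed_true Pr) hR.toCorr hA.simulate _ _ _ _ _ he hV
    exact ⟨r', w', hr', hc.uTyping, hf⟩
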